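/- **Setting.** Let $\Omega=\bigsqcup_{i=1}^p S_i$ be a measurable space partitioned into $p$ measurable pixels, and let $\mathcal W$ be the space of finite point patterns on $\Omega$ with a $\sigma$-finite reference measure $\nu$; $N_B(y)$ denotes the number of points of $y$ in $B$. At times $t=1,2,\dots$ a random treatment $W_t\in\mathcal W$ is assigned; $Y_t(w_1,\dots,w_t)$ (point patterns) and $X_t(w_1,\dots,w_{t-1})$ are the potential outcomes and covariates, and $Y_t=Y_t(W_1,\dots,W_t)$, $X_t=X_t(W_1,\dots,W_{t-1})$ the observed ones. The observed history is $H_t=(W_1,\dots,W_t,Y_1,\dots,Y_t,X_1,\dots,X_{t+1})$, and the complete history $H_t^*$ consists of $W_1,\dots,W_t$ and all potential outcomes and covariates (which may be fixed). $R_{i,t}$, a function of $X_t$, is the moderator of pixel $i$, $z=(z_1,\dots,z_L)$ are given basis functions, $M\ge 1$ is fixed, and $Z_t$ is the $p\times L$ matrix with rows $z(R_{i,t-M+1})^\top$. Let $F_{h'},F_{h''}$ be two probability measures on $\mathcal W$ with $\nu$-densities $f_{h'},f_{h''}$. Let $e_t(w;\gamma)=f(W_t=w\mid H_{t-1};\gamma)$,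 $\gamma\in\Gamma$ with $\Gamma\subset\mathbb R^K$ open, be a parametric model of densities with respect to $\nu$, and $\psi_t(\gamma)=\partial_\gamma\log e_t(W_t;\gamma)$. For $h\in\{h',h''\}$ and $t\ge M$ put $$\rho_{th}(\gamma)=\prod_{j=t-M+1}^{t}\frac{f_h(W_j)}{e_j(W_j;\gamma)},\qquad \widetilde Y_t(F_h;\gamma)=\rho_{th}(\gamma)\,(N_{S_1}(Y_t),\dots,N_{S_p}(Y_t))^\top,\qquad B_t=(Z_t^\top Z_t)^{-1}Z_t^\top,$$ $$\beta_t^{h}=B_t\Big(\int_{\mathcal W^M}N_{S_i}\big(Y_t(W_1,\dots,W_{t-M},w_1,\dots,w_M)\big)\,dF_h^{\otimes M}(w)\Big)_{i\le p},\quad A_t(\gamma)=\begin{pmatrix}B_t\widetilde Y_t(F_{h'};\gamma)\\ B_t\widetilde Y_t(F_{h''};\gamma)\\ \rho_{th'}(\gamma)\\ \rho_{th''}(\gamma)\end{pmatrix},\quad s_t(\gamma)=A_t(\gamma)-\begin{pmatrix}\beta_t^{h'}\\ \beta_t^{h''}\\1\\1\end{pmatrix}.$$ Write $\mathrm{avg}_t\,g_t=\frac1{T-M+1}\sum_{t=M}^Tg_t$,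 and let $H^*_{t-M}$ mean $H^*_0$ if $t<M$. All limits are as $T\to\infty$. **Assumptions.** 1. (Unconfoundedness, correct specification) The conditional law of $W_t$ given $H^*_{t-1}$ equals its conditional law given $H_{t-1}$, and the latter has density $e_t(\cdot;\gamma^*)$, $\gamma^*\in\Gamma$. 2. (Overlap) There is $\delta_W>0$ with $e_t(w;\gamma^*)>\delta_Wf_h(w)$ whenever $f_h(w)>0$, for $h\in\{h',h''\}$ and all $t$. 3. All $N_\Omega(Y_t(\cdot))$ and all $|z_l(R_{i,t})|$ (over all potential values) are uniformly bounded; $\det(Z_t^\top Z_t)$ is bounded away from $0$; and $\mathrm{avg}_t\mathbb V[B_t(\widetilde Y_t(F_{h''};\gamma^*)-\widetilde Y_t(F_{h'};\gamma^*))\mid H^*_{t-M}]$ converges in probability to a positive definite matrix. 4. Wherever $e_t(w;\gamma^*)>0$ (for any history), $e_t(w;\cdot)$ is positive and differentiable on $\Gamma$ with twice continuously differentiable score. $\mathbb E\|\psi_t(\gamma^*)\|^2<\infty$; $\frac1T\sum_{t\le T}\mathbb E[\psi_t(\gamma^*)\psi_t(\gamma^*)^\top\mid H^*_{t-M}]\to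 V_{ps}$ in probability with $V_{ps}$ positive definite; and $\frac1T\sum_{t\le T}\mathbb E[\|\psi_t(\gamma^*)\|^2\mathbf 1\{\|\psi_t(\gamma^*)\|>\epsilon\sqrt T\}\mid H^*_{t-M}]\to0$ in probability for all $\epsilon>0$. For all $k,j$, $P_t=\partial_{\gamma_j}\psi_{t,k}(\gamma^*)$ is integrable and, for some $r\in(0,2]$, the variables $|P_t-\mathbb E[P_t\mid H^*_{t-M}]|^r$ are integrable with $\sum_{t\ge1}t^{-r}\,\mathbb E[|P_t-\mathbb E[P_t\mid H^*_{t-M}]|^r\mid H^*_{t-M}]<\infty$ almost surely. In a neighbourhood of $\gamma^*$ not depending on $t$, the second partial derivatives of the score at time $t$ are dominated by a function $\ddot\psi_t(w_t,h_{t-1})$ with $\sup_t\mathbb E\,\ddot\psi_t(W_t,H_{t-1})<\infty$. 5. $\mathrm{avg}_t\mathbb V[A_t(\gamma^*)\mid H^*_{t-M}]\to\widetilde V^H$ in probability, with $\widetilde V^H$ positive definite. 6. $\mathrm{avg}_t\mathbb E[\psi_t(\gamma^*)s_t(\gamma^*)^\top\mid H^*_{t-M}]\to U\in\mathbb R^{K\times(2L+2)}$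 in probability, $\begin{pmatrix}\widetilde V^H&U^\top\\U&V_{ps}\end{pmatrix}$ is positive definite, and for every $j$ there is $r_j\in(0,2]$ with $\mathrm{avg}_t\,t^{-r_j}\big|\partial_{\gamma_j}s_t(\gamma^*)-\mathbb E[\partial_{\gamma_j}s_t(\gamma^*)\mid H^*_{t-M}]\big|\to0$ in probability. 7. $\hat\gamma=\hat\gamma_T$ is a consistent estimator of $\gamma^*$ that solves $\sum_{t=M}^T\psi_t(\gamma)=0$ with probability tending to one. **Corollary.** Let $V^{H^*}$ be the probability limit of $\mathrm{avg}_t\,\mathbb E[A_t(\gamma^*)A_t(\gamma^*)^\top\mid H^*_{t-M}]$, and let $$\hat V^H=\mathrm{avg}_t\,A_t(\hat\gamma)A_t(\hat\gamma)^\top,\qquad J=\begin{bmatrix}I&-I&-\mathrm{avg}_t\beta_t^{h'}&\mathrm{avg}_t\beta_t^{h''}\end{bmatrix},\qquad \hat J=\begin{bmatrix}I&-I&-\mathrm{avg}_tB_t\hat Y_t(h')&\mathrm{avg}_tB_t\hat Y_t(h'')\end{bmatrix},$$ where $\hat Y_t(h)$ is the Hájek pseudo-outcome $\widetilde Y_t(F_h;\hat\gamma)/\mathrm{avg}_u\,\rho_{uh}(\hat\gamma)$.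 If $Q=Q_T$ is any sequence of random $(2L+2)\times(2L+2)$ matrices converging in probability to the identity, then $$\hat JQ\hat V^HQ^\top\hat J^\top-JV^{H^*}J^\top\to0\quad\text{in probability}.$$ The same holds if $\hat Y_t(h)=\widetilde Y_t(F_h;\hat\gamma)$ in $\hat J$. Moreover $JV^{H^*}J^\top$ is an upper bound of the asymptotic variance $JV^HJ^\top$, $V^H=\widetilde V^H-U^\top V_{ps}^{-1}U$: the difference $JV^{H^*}J^\top-JV^HJ^\top$ is positive semidefinite. -/

import Mathlib

open MeasureTheory Filter Topology

namespace SpatioTemporal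

noncomputable section

/-! ### Point patterns -/

/-- A (finite) point pattern on the space `Ω`. -/
def PointPattern (Ω : Type*) : Type _ := Finset Ω

/-- `N_B(y)`: the number of points of the pattern `y` that fall in `B`. -/
def count {Ω : Type*} (B : Set Ω) (y : PointPattern Ω) : ℕ :=
  {s : Ω | s ∈ (show Finset Ω from y) ∧ s ∈ B}.ncard

/-- The usual σ-algebra on point patterns, generated by the counts of measurable sets. -/
instance instMeasurableSpacePointPattern {Ω : Type*} [MeasurableSpace Ω] :
    MeasurableSpace (PointPattern Ω) :=
  ⨆ B : {B : Set Ω // MeasurableSet B}, MeasurableSpace.comap (count B.1) ⊤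

/-! ### Stochastic interventions -/

/-- A single-period stochastic intervention, given by its density `f_h` with respect to the
reference measure `ν` on treatment patterns. -/
structure Intervention (Ω : Type*) [MeasurableSpace Ω] (ν : Measure (PointPattern Ω)) where
  /-- the density `f_h` -/
  f : PointPattern Ω → ℝ
  measurable_f : Measurable f
  nonneg_f : ∀ w, 0 ≤ f w
  lintegral_f : ∫⁻ w, ENNReal.ofReal (f w) ∂ν = 1

/-- The distribution `F_h` of the intervention. -/
def Intervention.dist {Ω : Type*} [MeasurableSpace Ω] {ν : Measure (PointPattern Ω)}
    (h : Intervention Ω ν) : Measure (PointPattern Ω) :=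
  ν.withDensity fun w => ENNReal.ofReal (h.f w)

/-! ### Observed histories, parameters -/

/-- Values of the observed history `H_n`: treatments at times `1, …, n`, outcomes at times
`1, …, n`, covariates at times `1, …, n + 1`. -/
abbrev ObsHist (Ω 𝒳 : Type*) (n : ℕ) : Type _ :=
  (Fin n → PointPattern Ω) × (Fin n → PointPattern Ω) × (Fin (n + 1) → 𝒳)

/-- The parameter space `ℝ^K`. -/
abbrev Param (K : ℕ) : Type := EuclideanSpace ℝ (Fin K)

/-- The partial derivative `∂F/∂γ_j`. -/
def partialDeriv {K : ℕ} (j : Fin K) (F : Param K → ℝ) : Param K → ℝ :=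
  fun γ => fderiv ℝ F γ (EuclideanSpace.single j 1)

/-- Index set of the blocks (`L`, `L`, `1`, `1`) of the vector `A_t`. -/
abbrev AIdx (L : ℕ) : Type := (Fin L ⊕ Fin L) ⊕ Fin 2

/-- The row block `[I, -I, -b', b'']`. -/
def jacobian {L : ℕ} (b' b'' : Fin L → ℝ) : Matrix (Fin L) (AIdx L) ℝ :=
  Matrix.of fun l => Sum.elim
    (Sum.elim ((1 : Matrix (Fin L) (Fin L) ℝ) l) (-(1 : Matrix (Fin L) (Fin L) ℝ) l))
    ![-(b' l), b'' l]

/-! ### Averages, conditional moments, convergence in probability -/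

/-- `(T - M + 1)⁻¹ ∑_{t = M}^T g t`. -/
def avg {E : Type*} [AddCommGroup E] [Module ℝ E] (M T : ℕ) (g : ℕ → E) : E :=
  ((T : ℝ) - (M : ℝ) + 1)⁻¹ • ∑ t ∈ Finset.Icc M T, g t

/-- The matrix `𝔼[A Bᵀ ∣ m]`. -/
def condOuter {Ξ : Type*} {m0 : MeasurableSpace Ξ} (P : Measure Ξ) (m : MeasurableSpace Ξ)
    {ι κ : Type*} (A : Ξ → ι → ℝ) (B : Ξ → κ → ℝ) (ξ : Ξ) : Matrix ι κ ℝ :=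
  Matrix.of fun i k => (P[fun ξ' => A ξ' i * B ξ' k | m]) ξ

/-- The conditional covariance matrix `𝕍[A ∣ m]`. -/
def condCov {Ξ : Type*} {m0 : MeasurableSpace Ξ} (P : Measure Ξ) (m : MeasurableSpace Ξ)
    {ι : Type*} (A : Ξ → ι → ℝ) (ξ : Ξ) : Matrix ι ι ℝ :=
  Matrix.of fun i k => (P[fun ξ' => A ξ' i * A ξ' k | m]) ξ -
    (P[fun ξ' => A ξ' i | m]) ξ * (P[fun ξ' => A ξ' k | m]) ξ

/-- Convergence in probability of random matrices to a constant matrix as `T → ∞`. -/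
def MatTendstoInProb {Ξ : Type*} {m0 : MeasurableSpace Ξ} (P : Measure Ξ) {ι κ : Type*}
    (X : ℕ → Ξ → Matrix ι κ ℝ) (X₀ : Matrix ι κ ℝ) : Prop :=
  ∀ i k, TendstoInMeasure P (fun T ξ => X T ξ i k) atTop fun _ => X₀ i k

/-! ### The model -/

/-- The spatio-temporal setting on a probability space `(Ξ, P)`: pixels, potential outcomes and
covariates, treatments, moderators, basis functions, and a parametric propensity score model.
The random element `U` carries the collection of all potential outcomes and potential covariates;
the case of fixed potential values is `𝒰 = Unit`. -/
structure Model (Ω 𝒰 𝒳 ℛ Ξ : Type*) [MeasurableSpace Ω] [MeasurableSpace 𝒰] [MeasurableSpace 𝒳]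
    [MeasurableSpace ℛ] [MeasurableSpace Ξ] (p L K : ℕ) where
  /-- the pixels `S_1, …, S_p`, a partition of `Ω` -/
  pixel : Fin p → Set Ω
  measurableSet_pixel : ∀ i, MeasurableSet (pixel i)
  disjoint_pixel : ∀ i j, i ≠ j → Disjoint (pixel i) (pixel j)
  iUnion_pixel : ⋃ i, pixel i = Set.univ
  /-- the collection of all potential outcomes and covariates, as a random element -/
  U : Ξ → 𝒰
  measurable_U : Measurable U
  /-- `W t` is the treatment pattern at time `t ≥ 1` -/
  W : ℕ → Ξ → PointPattern Ω
  measurable_W : ∀ t, Measurable (W t)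
  /-- `Y t u w` is the potential outcome `Y_t(w_1, …, w_t)` -/
  Y : (t : ℕ) → 𝒰 → (Fin t → PointPattern Ω) → PointPattern Ω
  measurable_Y : ∀ t, Measurable fun q : 𝒰 × (Fin t → PointPattern Ω) => Y t q.1 q.2
  /-- `X n u w` is the potential covariate `X_{n+1}(w_1, …, w_n)` -/
  X : (n : ℕ) → 𝒰 → (Fin n → PointPattern Ω) → 𝒳
  measurable_X : ∀ n, Measurable fun q : 𝒰 × (Fin n → PointPattern Ω) => X n q.1 q.2
  /-- the moderator of pixel `i`, a function of the covariates of the same period -/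
  moderator : Fin p → 𝒳 → ℛ
  measurable_moderator : ∀ i, Measurable (moderator i)
  /-- the basis functions `z_1, …, z_L` -/
  z : Fin L → ℛ → ℝ
  measurable_z : ∀ l, Measurable (z l)
  /-- the reference measure on treatment patterns, with respect to which densities are taken -/
  ν : Measure (PointPattern Ω)
  sigmaFinite_ν : SigmaFinite ν
  /-- the parameter set of the propensity score model -/
  Γ : Set (Param K)
  isOpen_Γ : IsOpen Γ
  /-- `e n h w γ` is the model density `f(W_{n+1} = w ∣ H_n = h; γ)` -/
  e : (n : ℕ) → ObsHist Ω 𝒳 n → PointPattern Ω → Param K → ℝ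
  measurable_e : ∀ n, ∀ γ ∈ Γ,
    Measurable fun q : ObsHist Ω 𝒳 n × PointPattern Ω => e n q.1 q.2 γ
  nonneg_e : ∀ n h w, ∀ γ ∈ Γ, 0 ≤ e n h w γ
  lintegral_e : ∀ n h, ∀ γ ∈ Γ, ∫⁻ w, ENNReal.ofReal (e n h w γ) ∂ν = 1

namespace Model

section

variable {Ω 𝒰 𝒳 ℛ Ξ : Type*} [MeasurableSpace Ω] [MeasurableSpace 𝒰] [MeasurableSpace 𝒳]
  [MeasurableSpace ℛ] [MeasurableSpace Ξ] {p L K : ℕ} (D : Model Ω 𝒰 𝒳 ℛ Ξ p L K)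

/-- The treatment path `(W_1, …, W_n)`. -/
def path (n : ℕ) (ξ : Ξ) : Fin n → PointPattern Ω := fun j => D.W (j + 1) ξ

/-- The observed outcome `Y_t = Y_t(W_1, …, W_t)`. -/
def obsY (t : ℕ) (ξ : Ξ) : PointPattern Ω := D.Y t (D.U ξ) (D.path t ξ)

/-- The observed covariate `X_{n+1} = X_{n+1}(W_1, …, W_n)`. -/
def obsX (n : ℕ) (ξ : Ξ) : 𝒳 := D.X n (D.U ξ) (D.path n ξ)

/-- The observed history `H_n`. -/
def obsHist (n : ℕ) (ξ : Ξ) : ObsHist Ω 𝒳 n :=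
  (D.path n ξ, fun j => D.obsY (j + 1) ξ, fun j => D.obsX j ξ)

/-- The σ-algebra of the observed history `H_n`. -/
abbrev obsSigma (n : ℕ) : MeasurableSpace Ξ := MeasurableSpace.comap (D.obsHist n) inferInstance

/-- The σ-algebra of the complete history `H*_n`: the treatments up to time `n` together with all
potential outcomes and covariates. -/
abbrev fullSigma (n : ℕ) : MeasurableSpace Ξ :=
  MeasurableSpace.comap (fun ξ => (D.U ξ, D.path n ξ)) inferInstance

/-! #### Design matrix and estimands -/

/-- The matrix `Z_t`, with rows `z(R_{i, t-M+1})`. -/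
def Z (M t : ℕ) (ξ : Ξ) : Matrix (Fin p) (Fin L) ℝ :=
  Matrix.of fun i l => D.z l (D.moderator i (D.obsX (t - M) ξ))

/-- The regression operator `(Z_tᵀ Z_t)⁻¹ Z_tᵀ`. -/
def proj (M t : ℕ) (ξ : Ξ) : Matrix (Fin L) (Fin p) ℝ :=
  ((D.Z M t ξ).transpose * D.Z M t ξ)⁻¹ * (D.Z M t ξ).transpose

/-- The treatment path up to time `t` in which the last `M` treatments are replaced by `w`. -/
def pathWith (M t : ℕ) (ξ : Ξ) (w : Fin M → PointPattern Ω) : Fin t → PointPattern Ω :=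
  fun j => if hj : (j : ℕ) < t - M then D.W (j + 1) ξ else w ⟨j - (t - M), by omega⟩

/-- The vector `N_t(F_h)` of expected outcome counts in the pixels under the intervention
`F_h × ⋯ × F_h` over the periods `t-M+1, …, t`. -/
def expCount (M : ℕ) (h : Intervention Ω D.ν) (t : ℕ) (ξ : Ξ) : Fin p → ℝ := fun i =>
  ∫ w, (count (D.pixel i) (D.Y t (D.U ξ) (D.pathWith M t ξ w)) : ℝ)
    ∂(Measure.pi fun _ : Fin M => h.dist)

/-- The projection coefficients `(Z_tᵀ Z_t)⁻¹ Z_tᵀ N_t(F_h)`. -/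
def beta (M : ℕ) (h : Intervention Ω D.ν) (t : ℕ) (ξ : Ξ) : Fin L → ℝ :=
  (D.proj M t ξ).mulVec (D.expCount M h t ξ)

/-! #### Weights and pseudo-outcomes -/

/-- The weight `ρ_{t h}(γ) = ∏_{j = t-M+1}^t f_h(W_j) / e_j(W_j; γ)` (`j = n + 1` below). -/
def rho (M : ℕ) (h : Intervention Ω D.ν) (t : ℕ) (ξ : Ξ) (γ : Param K) : ℝ :=
  ∏ n ∈ Finset.Ico (t - M) t, h.f (D.W (n + 1) ξ) / D.e n (D.obsHist n ξ) (D.W (n + 1) ξ) γ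

/-- The pixel counts `(N_{S_1}(Y_t), …, N_{S_p}(Y_t))` of the observed outcome. -/
def obsCount (t : ℕ) (ξ : Ξ) : Fin p → ℝ := fun i => (count (D.pixel i) (D.obsY t ξ) : ℝ)

/-- The weighted outcome `ρ_{t h}(γ) (N_{S_1}(Y_t), …, N_{S_p}(Y_t))`. -/
def pseudo (M : ℕ) (h : Intervention Ω D.ν) (t : ℕ) (ξ : Ξ) (γ : Param K) : Fin p → ℝ :=
  D.rho M h t ξ γ • D.obsCount t ξ

/-- The Hájek pseudo-outcome, with weights divided by their average over `t = M, …, T`. -/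
def hajekPseudo (M : ℕ) (h : Intervention Ω D.ν) (T t : ℕ) (ξ : Ξ) (γ : Param K) :
    Fin p → ℝ :=
  (D.rho M h t ξ γ / avg M T fun t' => D.rho M h t' ξ γ) • D.obsCount t ξ

/-- The vector `A_t(γ)`. -/
def A (M : ℕ) (h' h'' : Intervention Ω D.ν) (t : ℕ) (γ : Param K) (ξ : Ξ) : AIdx L → ℝ :=
  Sum.elim
    (Sum.elim ((D.proj M t ξ).mulVec (D.pseudo M h' t ξ γ))
      ((D.proj M t ξ).mulVec (D.pseudo M h'' t ξ γ)))
    ![D.rho M h' t ξ γ, D.rho M h'' t ξ γ]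

/-- The vector `s(H_{t-1}, W_t, Y_t; γ)`, which is `A_t(γ)` minus `(β'_t, β''_t, 1, 1)`. -/
def s (M : ℕ) (h' h'' : Intervention Ω D.ν) (t : ℕ) (γ : Param K) (ξ : Ξ) : AIdx L → ℝ :=
  D.A M h' h'' t γ ξ - Sum.elim (Sum.elim (D.beta M h' t ξ) (D.beta M h'' t ξ)) ![1, 1]

/-- `(Z_tᵀ Z_t)⁻¹ Z_tᵀ` applied to the contrast of the (unstabilized) IPW pseudo-outcomes. -/
def ipwA (M : ℕ) (h' h'' : Intervention Ω D.ν) (t : ℕ) (γ : Param K) (ξ : Ξ) : Fin L → ℝ :=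
  (D.proj M t ξ).mulVec (D.pseudo M h'' t ξ γ - D.pseudo M h' t ξ γ)

/-- The matrix `J` (random and depending on `T`). -/
def J (M : ℕ) (h' h'' : Intervention Ω D.ν) (T : ℕ) (ξ : Ξ) : Matrix (Fin L) (AIdx L) ℝ :=
  jacobian (avg M T fun t => D.beta M h' t ξ) (avg M T fun t => D.beta M h'' t ξ)

/-- The plug-in `Ĵ` at the parameter value `γ`, with Hájek pseudo-outcomes. -/
def Jhat (M : ℕ) (h' h'' : Intervention Ω D.ν) (T : ℕ) (γ : Param K) (ξ : Ξ) :
    Matrix (Fin L) (AIdx L) ℝ :=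
  jacobian (avg M T fun t => (D.proj M t ξ).mulVec (D.hajekPseudo M h' T t ξ γ))
    (avg M T fun t => (D.proj M t ξ).mulVec (D.hajekPseudo M h'' T t ξ γ))

/-- The plug-in `Ĵ` at the parameter value `γ`, with the pseudo-outcomes that enter `A_t`. -/
def JhatRaw (M : ℕ) (h' h'' : Intervention Ω D.ν) (T : ℕ) (γ : Param K) (ξ : Ξ) :
    Matrix (Fin L) (AIdx L) ℝ :=
  jacobian (avg M T fun t => (D.proj M t ξ).mulVec (D.pseudo M h' t ξ γ))
    (avg M T fun t => (D.proj M t ξ).mulVec (D.pseudo M h'' t ξ γ))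

/-- `V̂ = (T - M + 1)⁻¹ ∑_{t = M}^T A_t(γ) A_t(γ)ᵀ` at the parameter value `γ`. -/
def Vhat (M : ℕ) (h' h'' : Intervention Ω D.ν) (T : ℕ) (γ : Param K) (ξ : Ξ) :
    Matrix (AIdx L) (AIdx L) ℝ :=
  avg M T fun t => Matrix.vecMulVec (D.A M h' h'' t γ ξ) (D.A M h' h'' t γ ξ)

/-! #### Score functions -/

/-- The score function `ψ(w, h; γ) = ∂/∂γ log f(W_{n+1} = w ∣ H_n = h; γ)`. -/
def scoreFn (n : ℕ) (h : ObsHist Ω 𝒳 n) (w : PointPattern Ω) (γ : Param K) : Param K :=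
  WithLp.toLp 2 fun k => partialDeriv k (fun γ' => Real.log (D.e n h w γ')) γ

/-- The score `ψ(W_t, H_{t-1}; γ)` at time `t ≥ 1`. -/
def score (t : ℕ) (γ : Param K) (ξ : Ξ) : Param K :=
  D.scoreFn (t - 1) (D.obsHist (t - 1) ξ) (D.W t ξ) γ

/-- The derivative `∂ψ_k/∂γ_j (W_t, H_{t-1}; γ)`. -/
def scoreDeriv (k j : Fin K) (t : ℕ) (γ : Param K) (ξ : Ξ) : ℝ :=
  partialDeriv j (fun γ' => D.score t γ' ξ k) γ

/-- The derivative `∂s_i/∂γ_j`. -/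
def sDeriv (M : ℕ) (h' h'' : Intervention Ω D.ν) (i : AIdx L) (j : Fin K) (t : ℕ)
    (γ : Param K) (ξ : Ξ) : ℝ :=
  partialDeriv j (fun γ' => D.s M h' h'' t γ' ξ i) γ

/-! #### Assumptions -/

/-- Unconfoundedness: the conditional law of `W_t` given the complete history is its conditional
law given the observed history. -/
def Unconfounded (P : Measure Ξ) : Prop :=
  ∀ (n : ℕ) (B : Set (PointPattern Ω)), MeasurableSet B →
    P[(D.W (n + 1) ⁻¹' B).indicator (fun _ => (1 : ℝ)) | D.fullSigma n] =ᵐ[P]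
      P[(D.W (n + 1) ⁻¹' B).indicator (fun _ => (1 : ℝ)) | D.obsSigma n]

/-- Correct specification: the density of `W_t` given the observed history is the model density
at `γstar`. -/
def CorrectlySpecified (P : Measure Ξ) (γstar : Param K) : Prop :=
  γstar ∈ D.Γ ∧ ∀ (n : ℕ) (B : Set (PointPattern Ω)), MeasurableSet B →
    P[(D.W (n + 1) ⁻¹' B).indicator (fun _ => (1 : ℝ)) | D.obsSigma n] =ᵐ[P]
      fun ξ => ∫ w in B, D.e n (D.obsHist n ξ) w γstar ∂D.ν

/-- Bounded relative overlap of the true propensity score with the intervention `h`. -/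
def Overlap (γstar : Param K) (h : Intervention Ω D.ν) : Prop :=
  ∃ δ : ℝ, 0 < δ ∧ ∀ (n : ℕ) (ξ : Ξ) (w : PointPattern Ω), 0 < h.f w →
    δ * h.f w < D.e n (D.obsHist n ξ) w γstar

/-- Bounded outcomes and covariates, (uniform) non-singularity of `Z_tᵀ Z_t`, and convergence of
the average conditional covariance of the IPW terms to a positive definite matrix. -/
def IPWRegular (P : Measure Ξ) (M : ℕ) (h' h'' : Intervention Ω D.ν) (γstar : Param K) : Prop :=
  (∃ δY : ℝ, ∀ (t : ℕ), 1 ≤ t → ∀ u w, (count Set.univ (D.Y t u w) : ℝ) < δY) ∧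
  (∃ δz : ℝ, ∀ (n : ℕ) u w (i : Fin p) (l : Fin L), |D.z l (D.moderator i (D.X n u w))| < δz) ∧
  (∃ c : ℝ, 0 < c ∧ ∀ (t : ℕ), M ≤ t → ∀ ξ, c ≤ ((D.Z M t ξ).transpose * D.Z M t ξ).det) ∧
  ∃ VI : Matrix (Fin L) (Fin L) ℝ, VI.PosDef ∧
    MatTendstoInProb P
      (fun T ξ => avg M T fun t =>
        condCov P (D.fullSigma (t - M)) (D.ipwA M h' h'' t γstar) ξ) VI

/-- Regularity conditions on the propensity score model, with `Vps` the limiting matrix. The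
conditioning σ-algebra `𝓕_{t-1}` is that of the complete history `H*_{t-M}`, which for `t < M`
means `H*_0`. Smoothness is only required at treatment patterns that are possible under the true
parameter. -/
structure PropensityRegular (P : Measure Ξ) (M : ℕ) (γstar : Param K)
    (Vps : Matrix (Fin K) (Fin K) ℝ) : Prop where
  smooth : ∀ n h w, 0 < D.e n h w γstar →
    (∀ γ ∈ D.Γ, 0 < D.e n h w γ) ∧ DifferentiableOn ℝ (D.e n h w) D.Γ ∧
      ContDiffOn ℝ 2 (D.scoreFn n h w) D.Γ
  square_integrable : ∀ t, 1 ≤ t → MemLp (D.score t γstar) 2 P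
  posDef : Vps.PosDef
  information : MatTendstoInProb P
    (fun T ξ => avg 1 T fun t =>
      condOuter P (D.fullSigma (t - M)) (fun ξ' k => D.score t γstar ξ' k)
        (fun ξ' k => D.score t γstar ξ' k) ξ) Vps
  lindeberg : ∀ ε : ℝ, 0 < ε → TendstoInMeasure P
    (fun T ξ => avg 1 T fun t =>
      (P[{ξ' | ε * Real.sqrt T < ‖D.score t γstar ξ'‖}.indicator
          (fun ξ' => ‖D.score t γstar ξ'‖ ^ 2) | D.fullSigma (t - M)]) ξ)
    atTop fun _ => (0 : ℝ)
  deriv_integrable : ∀ k j t, 1 ≤ t → Integrable (D.scoreDeriv k j t γstar) P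
  deriv_variation : ∀ k j, ∃ r : ℝ, 0 < r ∧ r ≤ 2 ∧
    (∀ t, 1 ≤ t → Integrable (fun ξ => |D.scoreDeriv k j t γstar ξ -
        (P[D.scoreDeriv k j t γstar | D.fullSigma (t - M)]) ξ| ^ r) P) ∧
    ∀ᵐ ξ ∂P, Summable fun n : ℕ => (((n + 1 : ℕ) : ℝ) ^ r)⁻¹ *
      (P[fun ξ' => |D.scoreDeriv k j (n + 1) γstar ξ' -
        (P[D.scoreDeriv k j (n + 1) γstar | D.fullSigma (n + 1 - M)]) ξ'| ^ r |
          D.fullSigma (n + 1 - M)]) ξ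
  second_deriv_dominated : ∃ N ∈ 𝓝 γstar,
    ∃ dom : (n : ℕ) → ObsHist Ω 𝒳 n → PointPattern Ω → ℝ,
      (∀ n, Measurable fun q : ObsHist Ω 𝒳 n × PointPattern Ω => dom n q.1 q.2) ∧
      (∀ n, Integrable (fun ξ => dom n (D.obsHist n ξ) (D.W (n + 1) ξ)) P) ∧
      (∃ C : ℝ, ∀ n, ∫ ξ, dom n (D.obsHist n ξ) (D.W (n + 1) ξ) ∂P ≤ C) ∧
      ∀ n h w, 0 < D.e n h w γstar → ∀ γ ∈ N, ∀ k j l : Fin K,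
        |partialDeriv l (partialDeriv j fun γ' => D.scoreFn n h w γ' k) γ| ≤ dom n h w

/-- The average conditional covariance matrix of `A_t` converges to the positive definite matrix
`Vtil`. -/
def HajekRegular (P : Measure Ξ) (M : ℕ) (h' h'' : Intervention Ω D.ν) (γstar : Param K)
    (Vtil : Matrix (AIdx L) (AIdx L) ℝ) : Prop :=
  Vtil.PosDef ∧ MatTendstoInProb P
    (fun T ξ => avg M T fun t =>
      condCov P (D.fullSigma (t - M)) (D.A M h' h'' t γstar) ξ) Vtil

/-- Joint regularity conditions on the score function and on `s`. -/
def HajekScoreRegular (P : Measure Ξ) (M : ℕ) (h' h'' : Intervention Ω D.ν) (γstar : Param K)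
    (Vtil : Matrix (AIdx L) (AIdx L) ℝ) (Vps : Matrix (Fin K) (Fin K) ℝ)
    (Umat : Matrix (Fin K) (AIdx L) ℝ) : Prop :=
  MatTendstoInProb P
    (fun T ξ => avg M T fun t =>
      condOuter P (D.fullSigma (t - M)) (fun ξ' k => D.score t γstar ξ' k)
        (D.s M h' h'' t γstar) ξ) Umat ∧
  (Matrix.fromBlocks Vtil Umat.transpose Umat Vps).PosDef ∧
  ∀ j : Fin K, ∃ r : ℝ, 0 < r ∧ r ≤ 2 ∧ ∀ i : AIdx L, TendstoInMeasure P
    (fun T ξ => avg M T fun t => ((t : ℝ) ^ r)⁻¹ *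
      |D.sDeriv M h' h'' i j t γstar ξ -
        (P[D.sDeriv M h' h'' i j t γstar | D.fullSigma (t - M)]) ξ|)
    atTop fun _ => (0 : ℝ)

/-- `γhat T` is a consistent solution of the estimating equation `∑_{t = M}^T ψ(W_t, H_{t-1}; γ) = 0`
(a solution with probability tending to one). -/
def ConsistentRoot (P : Measure Ξ) (M : ℕ) (γstar : Param K) (γhat : ℕ → Ξ → Param K) : Prop :=
  Tendsto (fun T => P {ξ | ∑ t ∈ Finset.Icc M T, D.score t (γhat T ξ) ξ ≠ 0}) atTop (𝓝 0) ∧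
  TendstoInMeasure P γhat atTop fun _ => γstar

/-- `Vstar` is the probability limit of `(T - M + 1)⁻¹ ∑_{t = M}^T 𝔼[A_t A_tᵀ ∣ H*_{t-M}]`. -/
def IsVarianceBound (P : Measure Ξ) (M : ℕ) (h' h'' : Intervention Ω D.ν) (γstar : Param K)
    (Vstar : Matrix (AIdx L) (AIdx L) ℝ) : Prop :=
  MatTendstoInProb P
    (fun T ξ => avg M T fun t =>
      condOuter P (D.fullSigma (t - M)) (D.A M h' h'' t γstar) (D.A M h' h'' t γstar) ξ) Vstar

end

end Model

end

end SpatioTemporal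

namespace SpatioTemporal

/-! ### Convergence in probability as convergence along a filter -/

/-! Write v for the estimation error `γhat - γstar`. At the true parameter the argument is
elementary. Overlap bounds the weights, and unconfoundedness with correct specification makes the
weighted law of the last M treatments equal to the intervention. Hence A_t is bounded, and its
conditional mean given H*_{t-M} is (β', β'', 1, 1) (`condExp_rho_mul`, `condExp_A`). Variables
centred given the information M periods back are orthogonal as soon as they are M periods apart, so
averages of A_t and of A_t A_tᵀ follow the averages of their conditional means in probability
(`tendsto_avg_sub_condExp_of_bounded`).

The difficulty is to replace the true parameter by the estimator. Exactly, A_t(γhat) = exp(-∑ x_j)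
A_t(γstar), where j runs over the M periods up to t and x_j is the log-ratio of the propensities at
the two parameters. It suffices that, on events of probability close to one, the x_t with t ≤ T are
uniformly bounded and their absolute values average to o(1) (`exists_good_logE`,
`tendsto_avg_sub_of_weight`). By Taylor, x_t is ψ_t·v + vᵀH_t v / 2 up to a cubic term, with H_t the
derivative of the score. Since the scores up to T are only known to be O(√T) uniformly, consistency
is not enough: the rate ‖v‖ = O(T^(-1/2)) is needed.

The rate comes from the estimating equation tested against v. It expresses -∑ vᵀH_t v through ∑
ψ_t·v = O(√T ‖v‖) and small terms. A law of large numbers replaces H_t by its conditional mean H'_t,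
and the information inequality -E[H_t | ·] ≥ E[ψ_t ψ_tᵀ | ·] then bounds the left side below by a
multiple of T‖v‖². Moreover each -vᵀH'_t v is nonnegative, so the bound on their sum also controls
every single one (`rate_and_expansion`).

Two devices make the assumptions sufficient. The information inequality is proved without
differentiating under the integral, by Fatou's lemma for difference quotients of square roots of
likelihood ratios (`integral_gradient_sq_le`). Conditional moment conditions become unconditional
ones by predictable stopping (`sum_setIntegral_stoppedSet_le`).

At the end, J is bounded but need not converge, so the difference of the sandwich products is
telescoped (`tendsto_sandwich_sub`). For the upper bound, `Vstar - Vtil` is a limit of averages of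
m_t m_tᵀ with m_t the conditional mean of A_t, and UᵀVps⁻¹U is positive semidefinite as well.

Convergence in probability is phrased as `Tendsto` along the filter `inProb P` on pairs (T, ξ), so
that squeezing and the O/o calculus apply verbatim. -/

/-- The filter of events on `ℕ × Ξ` whose sections have probability tending to one. -/
def inProb {Ξ : Type*} {m0 : MeasurableSpace Ξ} (P : Measure Ξ) : Filter (ℕ × Ξ) where
  sets := {S | Tendsto (fun T => P {ξ | (T, ξ) ∉ S}) atTop (𝓝 0)}
  univ_sets := by simp
  sets_of_superset := by
    intro S S' hS hSS'
    exact tendsto_of_tendsto_of_tendsto_of_le_of_le tendsto_const_nhds hS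
      (fun _ => zero_le) fun T => measure_mono fun ξ hξ hξ' => hξ (hSS' hξ')
  inter_sets := by
    intro S S' hS hS'
    have h := hS.add hS'
    rw [add_zero] at h
    refine tendsto_of_tendsto_of_tendsto_of_le_of_le tendsto_const_nhds h
      (fun _ => zero_le) fun T => (measure_mono ?_).trans (measure_union_le _ _)
    intro ξ hξ
    by_cases h1 : (T, ξ) ∈ S
    · exact Or.inr fun h2 => hξ ⟨h1, h2⟩
    · exact Or.inl h1

section InProb

variable {Ξ : Type*} {m0 : MeasurableSpace Ξ} {P : Measure Ξ}

lemma mem_inProb {S : Set (ℕ × Ξ)} :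
    S ∈ inProb P ↔ Tendsto (fun T => P {ξ | (T, ξ) ∉ S}) atTop (𝓝 0) := Iff.rfl

lemma eventually_inProb {p : ℕ × Ξ → Prop} :
    (∀ᶠ q in inProb P, p q) ↔ Tendsto (fun T => P {ξ | ¬ p (T, ξ)}) atTop (𝓝 0) := Iff.rfl

/-- Both sides say that the event dist ≥ ε has vanishing probability for every ε. Constancy of the
limit is what allows a single neighbourhood filter on the right. -/
lemma tendsto_inProb_iff {E : Type*} [PseudoMetricSpace E] {f : ℕ → Ξ → E} {c : E} :
    TendstoInMeasure P f atTop (fun _ => c) ↔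
      Tendsto (fun q : ℕ × Ξ => f q.1 q.2) (inProb P) (𝓝 c) := by
  rw [tendstoInMeasure_iff_dist, Metric.tendsto_nhds]
  refine forall_congr' fun ε => imp_congr_right fun _ => ?_
  rw [eventually_inProb]
  simp only [not_lt]

lemma tendsto_fst_inProb : Tendsto Prod.fst (inProb P) atTop := by
  refine tendsto_atTop.2 fun n => ?_
  rw [eventually_inProb]
  refine tendsto_const_nhds.congr' ?_
  filter_upwards [eventually_ge_atTop n] with T hT
  simp [hT]

lemma eventually_inProb_of_ae {p : Ξ → Prop} (h : ∀ᵐ ξ ∂P, p ξ) :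
    ∀ᶠ q in inProb P, p q.2 := by
  rw [eventually_inProb]
  simp only [ae_iff.1 h]
  exact tendsto_const_nhds

/-- It suffices to argue on sets of probability at least `1 - η`. -/
lemma tendsto_inProb_of_forall_good {E : Type*} {f : ℕ × Ξ → E} {l : Filter E}
    (h : ∀ η : ENNReal, 0 < η → ∃ S : Set (ℕ × Ξ), (∀ᶠ T in atTop, P {ξ | (T, ξ) ∉ S} ≤ η) ∧
      Tendsto f (inProb P ⊓ 𝓟 S) l) : Tendsto f (inProb P) l := by
  intro s hs
  change f ⁻¹' s ∈ inProb P
  rw [mem_inProb, ENNReal.tendsto_nhds_zero]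
  intro η hη
  obtain ⟨S, hS, hf⟩ := h (η / 2) (ENNReal.half_pos hη.ne')
  have h1 : f ⁻¹' s ∈ inProb P ⊓ 𝓟 S := hf hs
  rw [mem_inf_principal, mem_inProb, ENNReal.tendsto_nhds_zero] at h1
  filter_upwards [hS, h1 (η / 2) (ENNReal.half_pos hη.ne')] with T hT1 hT2
  calc P {ξ | (T, ξ) ∉ f ⁻¹' s}
      ≤ P ({ξ | (T, ξ) ∉ S} ∪ {ξ | (T, ξ) ∉ {q | q ∈ S → q ∈ f ⁻¹' s}}) := by
        refine measure_mono fun ξ hξ => ?_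
        by_cases h2 : (T, ξ) ∈ S
        · exact Or.inr fun h3 => hξ (h3 h2)
        · exact Or.inl h2
    _ ≤ η / 2 + η / 2 := (measure_union_le _ _).trans (add_le_add hT1 hT2)
    _ = η := ENNReal.add_halves η

lemma eventually_inProb_of_forall_good {p : ℕ × Ξ → Prop}
    (h : ∀ η : ENNReal, 0 < η → ∃ S : Set (ℕ × Ξ), (∀ᶠ T in atTop, P {ξ | (T, ξ) ∉ S} ≤ η) ∧
      ∀ᶠ q in inProb P ⊓ 𝓟 S, p q) : ∀ᶠ q in inProb P, p q :=
  tendsto_principal.1 (tendsto_inProb_of_forall_good (f := id) (l := 𝓟 {q | p q}) fun η hη =>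
    (h η hη).imp fun _ hS => ⟨hS.1, tendsto_principal.2 hS.2⟩)

/-- Boundedness in probability (from above) of a sequence of real random variables. -/
def BddInProb (P : Measure Ξ) (f : ℕ → Ξ → ℝ) : Prop :=
  ∀ η : ENNReal, 0 < η → ∃ C : ℝ, ∀ᶠ T in atTop, P {ξ | ¬ f T ξ ≤ C} ≤ η

lemma BddInProb.exists_ge {f : ℕ → Ξ → ℝ} (h : BddInProb P f) {η : ENNReal} (hη : 0 < η)
    (c : ℝ) : ∃ C : ℝ, c ≤ C ∧ ∀ᶠ T in atTop, P {ξ | ¬ f T ξ ≤ C} ≤ η := by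
  obtain ⟨C, hC⟩ := h η hη
  refine ⟨max c C, le_max_left _ _, ?_⟩
  filter_upwards [hC] with T hT
  refine le_trans (measure_mono ?_) hT
  intro ξ hξ h1
  exact hξ (h1.trans (le_max_right _ _))

/-- Markov's inequality: uniformly bounded expectations imply boundedness in probability. -/
lemma BddInProb.of_integral_le [IsProbabilityMeasure P] {f : ℕ → Ξ → ℝ}
    (hf0 : ∀ T, 0 ≤ᵐ[P] f T) (hfi : ∀ T, Integrable (f T) P) {c : ℝ}
    (hc : ∀ᶠ T in atTop, ∫ ξ, f T ξ ∂P ≤ c) : BddInProb P f := by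
  intro η hη
  have hlim : Tendsto (fun C : ℝ => ENNReal.ofReal (c / C)) atTop (𝓝 0) := by
    have := (tendsto_const_nhds (x := c)).div_atTop (tendsto_id (α := ℝ) (x := atTop))
    simpa using ENNReal.tendsto_ofReal this
  obtain ⟨C, hC, hC0⟩ := ((ENNReal.tendsto_nhds_zero.1 hlim η hη).and
    (eventually_gt_atTop (0 : ℝ))).exists
  refine ⟨C, hc.mono fun T hT => ?_⟩
  refine le_trans ?_ hC
  have h1 := mul_meas_ge_le_integral_of_nonneg (hf0 T) (hfi T) C
  have h2 : P.real {ξ | C ≤ f T ξ} ≤ c / C := by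
    rw [le_div_iff₀ hC0, mul_comm]
    exact h1.trans hT
  calc P {ξ | ¬ f T ξ ≤ C} ≤ P {ξ | C ≤ f T ξ} :=
        measure_mono fun ξ hξ => (not_le.1 hξ).le
    _ = ENNReal.ofReal (P.real {ξ | C ≤ f T ξ}) := by
        rw [measureReal_def, ENNReal.ofReal_toReal (measure_ne_top _ _)]
    _ ≤ _ := ENNReal.ofReal_le_ofReal h2

/-- Convergence in mean to zero implies convergence in probability. -/
lemma tendsto_inProb_of_integral_abs [IsFiniteMeasure P] {f : ℕ → Ξ → ℝ}
    (hfi : ∀ T, Integrable (f T) P)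
    (h : Tendsto (fun T => ∫ ξ, |f T ξ| ∂P) atTop (𝓝 0)) :
    Tendsto (fun q : ℕ × Ξ => f q.1 q.2) (inProb P) (𝓝 0) := by
  rw [← tendsto_inProb_iff, tendstoInMeasure_iff_norm]
  intro ε hε
  have hlim : Tendsto (fun T => ENNReal.ofReal ((∫ ξ, |f T ξ| ∂P) / ε)) atTop (𝓝 0) := by
    simpa using ENNReal.tendsto_ofReal (h.div_const ε)
  refine tendsto_of_tendsto_of_tendsto_of_le_of_le tendsto_const_nhds hlim
    (fun _ => zero_le) fun T => ?_
  have h1 := mul_meas_ge_le_integral_of_nonneg (μ := P) (f := fun ξ => |f T ξ|)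
    (Eventually.of_forall fun _ => abs_nonneg _) (hfi T).abs ε
  simp only [sub_zero, Real.norm_eq_abs]
  calc P {ξ | ε ≤ |f T ξ|} = ENNReal.ofReal (P.real {ξ | ε ≤ |f T ξ|}) := by
        rw [measureReal_def, ENNReal.ofReal_toReal (measure_ne_top _ _)]
    _ ≤ _ := ENNReal.ofReal_le_ofReal (by rw [le_div_iff₀ hε, mul_comm]; exact h1)

/-- Convergence in mean square to zero implies convergence in probability. -/
lemma tendsto_inProb_of_integral_sq [IsProbabilityMeasure P] {f : ℕ → Ξ → ℝ}
    (hfi : ∀ T, MemLp (f T) 2 P)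
    (h : Tendsto (fun T => ∫ ξ, f T ξ ^ 2 ∂P) atTop (𝓝 0)) :
    Tendsto (fun q : ℕ × Ξ => f q.1 q.2) (inProb P) (𝓝 0) := by
  have h1 := tendsto_inProb_of_integral_abs (P := P) (f := fun T ξ => f T ξ ^ 2)
    (fun T => (hfi T).integrable_sq) (by simpa only [abs_pow, sq_abs] using h)
  have h2 : Tendsto (fun q : ℕ × Ξ => Real.sqrt (f q.1 q.2 ^ 2)) (inProb P) (𝓝 0) := by
    simpa using h1.sqrt
  simp only [Real.sqrt_sq_eq_abs] at h2
  exact (tendsto_zero_iff_abs_tendsto_zero _).2 h2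

end InProb

/-! ### Laws of large numbers for lagged martingale differences -/

section Lagged

variable {Ξ : Type*} {m0 : MeasurableSpace Ξ} {P : Measure Ξ} [IsProbabilityMeasure P]

/-- The factor X is pulled out of the conditional expectation of the product. This is the
orthogonality behind all the second-moment bounds. -/
lemma integral_mul_eq_zero_of_condExp_eq_zero {m : MeasurableSpace Ξ} (hm : m ≤ m0)
    {X Y : Ξ → ℝ} (hX : MemLp X 2 P) (hY : MemLp Y 2 P) (hXm : AEStronglyMeasurable[m] X P)
    (hY0 : P[Y | m] =ᵐ[P] 0) : ∫ ξ, X ξ * Y ξ ∂P = 0 := by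
  have hXY : Integrable (X * Y) P := hX.integrable_mul hY
  have h1 := condExp_mul_of_aestronglyMeasurable_left (m := m) hXm hXY
    (hY.integrable (by norm_num))
  have h2 : ∫ ξ, (P[X * Y | m]) ξ ∂P = ∫ ξ, (X * Y) ξ ∂P := integral_condExp hm
  have h3 : P[X * Y | m] =ᵐ[P] 0 := by
    filter_upwards [h1, hY0] with ξ h h'
    simp [h, h']
  calc ∫ ξ, X ξ * Y ξ ∂P = ∫ ξ, (P[X * Y | m]) ξ ∂P := h2.symm
    _ = 0 := by rw [integral_congr_ae h3]; simp

/-- Differences that are centred given the information `M` periods before have sums with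
second moment of the order of the sum of second moments. -/
lemma integral_sum_sq_le_of_lagged {𝒢 : ℕ → MeasurableSpace Ξ} (hmono : Monotone 𝒢)
    (hle : ∀ t, 𝒢 t ≤ m0) {M : ℕ} {X : ℕ → Ξ → ℝ} (hX : ∀ t, M ≤ t → MemLp (X t) 2 P)
    (hXm : ∀ t, M ≤ t → AEStronglyMeasurable[𝒢 t] (X t) P)
    (hX0 : ∀ t, M ≤ t → P[X t | 𝒢 (t - M)] =ᵐ[P] 0) (T : ℕ) :
    ∫ ξ, (∑ t ∈ Finset.Icc M T, X t ξ) ^ 2 ∂P ≤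
      2 * M * ∑ t ∈ Finset.Icc M T, ∫ ξ, X t ξ ^ 2 ∂P := by
  have hmul : ∀ s ∈ Finset.Icc M T, ∀ t ∈ Finset.Icc M T,
      Integrable (fun ξ => X s ξ * X t ξ) P := fun s hs t ht =>
    (hX s (Finset.mem_Icc.1 hs).1).integrable_mul (hX t (Finset.mem_Icc.1 ht).1)
  have hexp : ∫ ξ, (∑ t ∈ Finset.Icc M T, X t ξ) ^ 2 ∂P =
      ∑ s ∈ Finset.Icc M T, ∑ t ∈ Finset.Icc M T, ∫ ξ, X s ξ * X t ξ ∂P := by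
    simp_rw [sq, Finset.sum_mul_sum]
    rw [integral_finsetSum _ fun s hs => integrable_finsetSum _ fun t ht => hmul s hs t ht]
    exact Finset.sum_congr rfl fun s hs => integral_finsetSum _ fun t ht => hmul s hs t ht
  set v : ℕ → ℝ := fun t => ∫ ξ, X t ξ ^ 2 ∂P with hv
  have hv0 : ∀ t, 0 ≤ v t := fun t => integral_nonneg fun ξ => sq_nonneg _
  -- Only pairs of times less than M apart contribute. For the others the earlier variable is known
  -- when the later one is still centred, so the product integrates to zero. Near pairs are bounded
  -- by the arithmetic mean of the squares.
  set near : ℕ → ℕ → Prop := fun s t => s < t + M ∧ t < s + M with hnear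
  have hterm : ∀ s ∈ Finset.Icc M T, ∀ t ∈ Finset.Icc M T,
      ∫ ξ, X s ξ * X t ξ ∂P ≤ if near s t then (v s + v t) / 2 else 0 := by
    intro s hs t ht
    have hs' := (Finset.mem_Icc.1 hs).1
    have ht' := (Finset.mem_Icc.1 ht).1
    split_ifs with h
    · have hi : Integrable (fun ξ => (X s ξ ^ 2 + X t ξ ^ 2) / 2) P :=
        ((hX s hs').integrable_sq.add (hX t ht').integrable_sq).div_const 2
      calc ∫ ξ, X s ξ * X t ξ ∂P ≤ ∫ ξ, (X s ξ ^ 2 + X t ξ ^ 2) / 2 ∂P := by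
            refine integral_mono (hmul s hs t ht) hi fun ξ => ?_
            have := sq_nonneg (X s ξ - X t ξ)
            dsimp only
            nlinarith
        _ = (v s + v t) / 2 := by
            rw [integral_div, integral_add (hX s hs').integrable_sq (hX t ht').integrable_sq]
    · rw [hnear] at h
      simp only [not_and_or, not_lt] at h
      refine le_of_eq ?_
      rcases h with h | h
      · simp_rw [mul_comm (X s _)]
        exact integral_mul_eq_zero_of_condExp_eq_zero (hle (s - M)) (hX t ht') (hX s hs')
          ((hXm t ht').mono (hmono (by omega))) (hX0 s hs')
      · exact integral_mul_eq_zero_of_condExp_eq_zero (hle (t - M)) (hX s hs') (hX t ht')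
          ((hXm s hs').mono (hmono (by omega))) (hX0 t ht')
  -- A window of radius M - 1 has at most 2M - 1 members; 2M is enough. Each neighbour contributes
  -- half of `v s`, hence the factor M in `hsum`.
  have hcard : ∀ s, ((Finset.Icc M T).filter (near s)).card ≤ 2 * M := by
    intro s
    calc ((Finset.Icc M T).filter (near s)).card ≤ (Finset.Ico (s + 1 - M) (s + M)).card := by
          refine Finset.card_le_card fun t ht => ?_
          have := (Finset.mem_filter.1 ht).2
          simp only [hnear] at this
          rw [Finset.mem_Ico]
          omega
      _ ≤ 2 * M := by rw [Nat.card_Ico]; omega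
  have hsum : ∀ s, ∑ t ∈ Finset.Icc M T, (if near s t then v s / 2 else 0) ≤ M * v s := by
    intro s
    rw [← Finset.sum_filter, Finset.sum_const, nsmul_eq_mul]
    have h1 : ((((Finset.Icc M T).filter (near s)).card : ℕ) : ℝ) ≤ 2 * M := by
      exact_mod_cast hcard s
    nlinarith [hv0 s]
  rw [hexp]
  -- The relation `near` is symmetric, so after exchanging the summations the two halves of (v s + v
  -- t) / 2 give the same double sum.
  calc ∑ s ∈ Finset.Icc M T, ∑ t ∈ Finset.Icc M T, ∫ ξ, X s ξ * X t ξ ∂P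
      ≤ ∑ s ∈ Finset.Icc M T, ∑ t ∈ Finset.Icc M T,
          ((if near s t then v s / 2 else 0) + (if near t s then v t / 2 else 0)) := by
        refine Finset.sum_le_sum fun s hs => Finset.sum_le_sum fun t ht => ?_
        refine (hterm s hs t ht).trans (le_of_eq ?_)
        have : near t s ↔ near s t := and_comm
        simp only [this]
        split_ifs <;> ring
    _ = (∑ s ∈ Finset.Icc M T, ∑ t ∈ Finset.Icc M T, (if near s t then v s / 2 else 0)) +
          ∑ s ∈ Finset.Icc M T, ∑ t ∈ Finset.Icc M T, (if near s t then v s / 2 else 0) := by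
        simp_rw [Finset.sum_add_distrib]
        congr 1
        exact Finset.sum_comm
    _ ≤ (∑ s ∈ Finset.Icc M T, M * v s) + ∑ s ∈ Finset.Icc M T, M * v s :=
        add_le_add (Finset.sum_le_sum fun s _ => hsum s) (Finset.sum_le_sum fun s _ => hsum s)
    _ = 2 * M * ∑ t ∈ Finset.Icc M T, v t := by rw [← Finset.mul_sum]; ring

lemma cast_card_Icc {M T : ℕ} (h : M ≤ T) :
    ((Finset.Icc M T).card : ℝ) = (T : ℝ) - (M : ℝ) + 1 := by
  rw [Nat.card_Icc, Nat.cast_sub (by omega)]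
  push_cast
  ring

lemma tendsto_natCast_sub_add_one (M : ℕ) :
    Tendsto (fun T : ℕ => (T : ℝ) - (M : ℝ) + 1) atTop atTop :=
  tendsto_atTop_add_const_right _ _
    (tendsto_atTop_add_const_right _ _ tendsto_natCast_atTop_atTop)

/-- Weak law of large numbers for bounded variables centred at their lagged conditional
expectations. -/
lemma tendsto_avg_sub_condExp_of_bounded {𝒢 : ℕ → MeasurableSpace Ξ} (hmono : Monotone 𝒢)
    (hle : ∀ t, 𝒢 t ≤ m0) {M : ℕ} {X : ℕ → Ξ → ℝ} {C : ℝ}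
    (hXm : ∀ t, M ≤ t → StronglyMeasurable[𝒢 t] (X t))
    (hXC : ∀ t, M ≤ t → ∀ ξ, |X t ξ| ≤ C) :
    Tendsto (fun q : ℕ × Ξ => avg M q.1 fun t => X t q.2 - (P[X t | 𝒢 (t - M)]) q.2)
      (inProb P) (𝓝 0) := by
  set D : ℕ → Ξ → ℝ := fun t ξ => X t ξ - (P[X t | 𝒢 (t - M)]) ξ with hD
  have hXi : ∀ t, M ≤ t → Integrable (X t) P := fun t ht =>
    Integrable.of_bound ((hXm t ht).mono (hle t)).aestronglyMeasurable C
      (Eventually.of_forall fun ξ => hXC t ht ξ)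
  have hDb : ∀ t, M ≤ t → ∀ᵐ ξ ∂P, |D t ξ| ≤ 2 * C := by
    intro t ht
    have h1 : ∀ᵐ ξ ∂P, |(P[X t | 𝒢 (t - M)]) ξ| ≤ C := by
      have hup : P[X t | 𝒢 (t - M)] ≤ᵐ[P] P[fun _ => C | 𝒢 (t - M)] :=
        condExp_mono (hXi t ht) (integrable_const _)
          (Eventually.of_forall fun ξ => (abs_le.1 (hXC t ht ξ)).2)
      have hlo : P[fun _ => -C | 𝒢 (t - M)] ≤ᵐ[P] P[X t | 𝒢 (t - M)] :=
        condExp_mono (integrable_const _) (hXi t ht)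
          (Eventually.of_forall fun ξ => (abs_le.1 (hXC t ht ξ)).1)
      rw [condExp_const (hle _)] at hup hlo
      filter_upwards [hup, hlo] with ξ h1 h2
      exact abs_le.2 ⟨h2, h1⟩
    filter_upwards [h1] with ξ h
    calc |D t ξ| ≤ |X t ξ| + |(P[X t | 𝒢 (t - M)]) ξ| := abs_sub _ _
      _ ≤ 2 * C := by linarith [hXC t ht ξ]
  have hDm : ∀ t, M ≤ t → StronglyMeasurable[𝒢 t] (D t) := fun t ht =>
    (hXm t ht).sub (stronglyMeasurable_condExp.mono (hmono (by omega)))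
  have hDL : ∀ t, M ≤ t → MemLp (D t) 2 P := fun t ht =>
    MemLp.of_bound ((hDm t ht).mono (hle t)).aestronglyMeasurable (2 * C) (hDb t ht)
  have hD0 : ∀ t, M ≤ t → P[D t | 𝒢 (t - M)] =ᵐ[P] 0 := by
    intro t ht
    have h1 := condExp_sub (hXi t ht) (integrable_condExp (m := 𝒢 (t - M)) (f := X t)) (𝒢 (t - M))
    have h2 : P[P[X t | 𝒢 (t - M)] | 𝒢 (t - M)] = P[X t | 𝒢 (t - M)] :=
      condExp_of_stronglyMeasurable (hle _) stronglyMeasurable_condExp integrable_condExp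
    filter_upwards [h1] with ξ h
    change (P[X t - P[X t | 𝒢 (t - M)] | 𝒢 (t - M)]) ξ = 0
    rw [h, h2]
    simp
  refine tendsto_inProb_of_integral_sq (f := fun T ξ => avg M T fun t => D t ξ) (fun T => ?_) ?_
  · exact (memLp_finsetSum _ fun t ht => hDL t (Finset.mem_Icc.1 ht).1).const_mul _
  -- With n = T - M + 1 terms bounded by 2C, the second moment of the average is at most 2M · n(2C)²
  -- / n², of order 1/T.
  · have hlim : Tendsto (fun T : ℕ => 2 * M * (2 * C) ^ 2 * ((T : ℝ) - (M : ℝ) + 1)⁻¹)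
        atTop (𝓝 0) := by
      simpa using (tendsto_natCast_sub_add_one M).inv_tendsto_atTop.const_mul
        (2 * M * (2 * C) ^ 2)
    refine tendsto_of_tendsto_of_tendsto_of_le_of_le' tendsto_const_nhds hlim
      (Eventually.of_forall fun T => integral_nonneg fun ξ => sq_nonneg _) ?_
    filter_upwards [eventually_ge_atTop M] with T hT
    have hn : (0 : ℝ) < (T : ℝ) - (M : ℝ) + 1 := by
      have : (M : ℝ) ≤ T := by exact_mod_cast hT
      linarith
    have h1 := integral_sum_sq_le_of_lagged hmono hle hDL
      (fun t ht => (hDm t ht).aestronglyMeasurable) hD0 T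
    have h2 : ∑ t ∈ Finset.Icc M T, ∫ ξ, D t ξ ^ 2 ∂P ≤
        ((T : ℝ) - (M : ℝ) + 1) * (2 * C) ^ 2 := by
      rw [← cast_card_Icc hT, ← nsmul_eq_mul]
      refine Finset.sum_le_card_nsmul _ _ _ fun t ht => ?_
      have ht' := (Finset.mem_Icc.1 ht).1
      calc ∫ ξ, D t ξ ^ 2 ∂P ≤ ∫ _, (2 * C) ^ 2 ∂P := by
            refine integral_mono_ae (hDL t ht').integrable_sq (integrable_const _) ?_
            filter_upwards [hDb t ht'] with ξ h
            exact sq_le_sq' (by linarith [(abs_le.1 h).1]) (abs_le.1 h).2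
        _ = (2 * C) ^ 2 := by simp
    simp only [avg, smul_eq_mul, mul_pow]
    rw [integral_const_mul]
    have h3 : (0 : ℝ) ≤ 2 * M := by positivity
    calc (((T : ℝ) - M + 1)⁻¹) ^ 2 * ∫ ξ, (∑ t ∈ Finset.Icc M T, D t ξ) ^ 2 ∂P
        ≤ (((T : ℝ) - M + 1)⁻¹) ^ 2 * (2 * M * (((T : ℝ) - M + 1) * (2 * C) ^ 2)) := by
          gcongr
          exact h1.trans (by gcongr)
      _ = 2 * M * (2 ^ 2 * C ^ 2) * ((T : ℝ) - M + 1)⁻¹ := by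
          field_simp

/-! ### Stopped sums -/

/-- Since the terms are nonnegative, the partial sums increase and the retained indices form an
initial segment. Its total is the partial sum at the last retained index, hence at most C. -/
lemma sum_stopped_le {h : ℕ → ℝ} (hh : ∀ t, 0 ≤ h t) (a : ℕ) {C : ℝ} (hC : 0 ≤ C) (T : ℕ) :
    ∑ t ∈ Finset.Icc a T, (if ∑ s ∈ Finset.Icc a t, h s ≤ C then h t else 0) ≤ C := by
  have key : ∀ T, ∑ s ∈ Finset.Icc a T, h s ≤ C →
      ∑ t ∈ Finset.Icc a T, (if ∑ s ∈ Finset.Icc a t, h s ≤ C then h t else 0) ≤ C := by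
    intro T hT
    refine (Finset.sum_le_sum fun t _ => ?_).trans hT
    split_ifs
    · exact le_rfl
    · exact hh t
  induction T with
  | zero =>
    by_cases h0 : ∑ s ∈ Finset.Icc a 0, h s ≤ C
    · exact key 0 h0
    · refine le_trans (Finset.sum_nonpos fun t ht => ?_) hC
      have : t = 0 := by have := (Finset.mem_Icc.1 ht).2; omega
      subst this
      rw [if_neg h0]
  | succ T ih =>
    by_cases h0 : ∑ s ∈ Finset.Icc a (T + 1), h s ≤ C
    · exact key _ h0
    · by_cases ha : a ≤ T + 1
      · rw [Finset.sum_Icc_succ_top ha, if_neg h0, add_zero]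
        exact ih
      · rw [Finset.Icc_eq_empty (by omega)]
        simpa using hC

/-- The event that the weighted conditional expectations up to time `t` sum to at most `C`. -/
def stoppedSet (P : Measure Ξ) (𝒢 : ℕ → MeasurableSpace Ξ) (M a : ℕ) (c : ℕ → ℝ)
    (f : ℕ → Ξ → ℝ) (C : ℝ) (t : ℕ) : Set Ξ :=
  {ξ | ∑ s ∈ Finset.Icc a t, c s * (P[f s | 𝒢 (s - M)]) ξ ≤ C}

/-- The event at time t involves only conditional expectations given the information at times s - M
with s ≤ t, so it is known at time t - M. This predictability is what preserves centring when a
variable is multiplied by the indicator. -/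
lemma measurableSet_stoppedSet {P : Measure Ξ} {𝒢 : ℕ → MeasurableSpace Ξ} (hmono : Monotone 𝒢)
    (M a : ℕ) (c : ℕ → ℝ) (f : ℕ → Ξ → ℝ) (C : ℝ) (t : ℕ) :
    MeasurableSet[𝒢 (t - M)] (stoppedSet P 𝒢 M a c f C t) := by
  refine measurableSet_le (mδ := 𝒢 (t - M)) ?_ measurable_const
  refine Finset.measurable_sum _ fun s hs => ?_
  refine Measurable.const_mul ?_ _
  have hs' := (Finset.mem_Icc.1 hs).2
  exact (stronglyMeasurable_condExp.mono (hmono (by omega))).measurable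

/-- On a predictable event the integral of `f t` equals that of its conditional expectation, and the
stopped sum of the latter is at most C pointwise. Random bounds on conditional moments thus become
deterministic bounds on moments of the stopped variables. -/
lemma sum_setIntegral_stoppedSet_le {𝒢 : ℕ → MeasurableSpace Ξ} (hmono : Monotone 𝒢)
    (hle : ∀ t, 𝒢 t ≤ m0) {M a : ℕ} {c : ℕ → ℝ} (hc : ∀ t, 0 ≤ c t) {f : ℕ → Ξ → ℝ}
    (hf0 : ∀ t ξ, 0 ≤ f t ξ) (hfi : ∀ t, a ≤ t → Integrable (f t) P) {C : ℝ} (hC : 0 ≤ C)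
    (T : ℕ) :
    ∑ t ∈ Finset.Icc a T, c t * ∫ ξ in stoppedSet P 𝒢 M a c f C t, f t ξ ∂P ≤ C := by
  set K := stoppedSet P 𝒢 M a c f C
  have hK : ∀ t, MeasurableSet[𝒢 (t - M)] (K t) := measurableSet_stoppedSet hmono M a c f C
  have h1 : ∀ t ∈ Finset.Icc a T, c t * ∫ ξ in K t, f t ξ ∂P =
      ∫ ξ, (K t).indicator (fun ξ => c t * (P[f t | 𝒢 (t - M)]) ξ) ξ ∂P := by
    intro t ht
    rw [integral_indicator (hle _ _ (hK t)), integral_const_mul,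
      setIntegral_condExp (hle _) (hfi t (Finset.mem_Icc.1 ht).1) (hK t)]
  rw [Finset.sum_congr rfl h1, ← integral_finsetSum _ fun t _ =>
    (integrable_condExp.const_mul _).indicator (hle _ _ (hK t))]
  have h2 : ∀ᵐ ξ ∂P, ∀ t, 0 ≤ (P[f t | 𝒢 (t - M)]) ξ :=
    ae_all_iff.2 fun t => condExp_nonneg (Eventually.of_forall fun ξ => hf0 t ξ)
  calc ∫ ξ, ∑ t ∈ Finset.Icc a T,
          (K t).indicator (fun ξ => c t * (P[f t | 𝒢 (t - M)]) ξ) ξ ∂P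
      ≤ ∫ _, C ∂P := by
        refine integral_mono_ae (integrable_finsetSum _ fun t _ =>
          (integrable_condExp.const_mul _).indicator (hle _ _ (hK t))) (integrable_const _) ?_
        filter_upwards [h2] with ξ hξ
        have h3 := sum_stopped_le (h := fun t => c t * (P[f t | 𝒢 (t - M)]) ξ)
          (fun t => mul_nonneg (hc t) (hξ t)) a hC T
        refine le_trans (le_of_eq (Finset.sum_congr rfl fun t _ => ?_)) h3
        by_cases hξt : ξ ∈ K t
        · rw [Set.indicator_of_mem hξt]
          exact (if_pos hξt).symm
        · rw [Set.indicator_of_notMem hξt]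
          exact (if_neg hξt).symm
    _ = C := by simp

end Lagged

/-! ### Law of large numbers under scaled moments of order r ≤ 2, by truncation -/

section LaggedMoments

variable {Ξ : Type*} {m0 : MeasurableSpace Ξ} {P : Measure Ξ}

lemma aestronglyMeasurable_measurable_comp {m : MeasurableSpace Ξ} {f : Ξ → ℝ} {φ : ℝ → ℝ}
    (hφ : Measurable φ) (hf : AEStronglyMeasurable[m] f P) :
    AEStronglyMeasurable[m] (fun ξ => φ (f ξ)) P := by
  obtain ⟨g, hg, hfg⟩ := hf
  exact ⟨fun ξ => φ (g ξ), (hφ.comp hg.measurable).stronglyMeasurable, hfg.fun_comp φ⟩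

/-- Kronecker's lemma for nonnegative terms and power weights. -/
lemma tendsto_rpow_inv_mul_sum {M : ℕ} {c : ℕ → ℝ} (hc : ∀ t, 0 ≤ c t) {C r : ℝ} (hr : 0 < r)
    (hC : ∀ T, ∑ t ∈ Finset.Icc M T, c t ≤ C) :
    Tendsto (fun T : ℕ => ((T : ℝ) ^ r)⁻¹ * ∑ t ∈ Finset.Icc M T, (t : ℝ) ^ r * c t)
      atTop (𝓝 0) := by
  set c' : ℕ → ℝ := fun t => if M ≤ t then c t else 0 with hc'
  have hc'0 : ∀ t, 0 ≤ c' t := fun t => by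
    simp only [hc']
    split_ifs
    exacts [hc t, le_rfl]
  have hsum : Summable c' := by
    refine summable_of_sum_range_le (c := C) hc'0 fun n => ?_
    refine le_trans ?_ (hC n)
    rw [← Finset.sum_filter]
    refine Finset.sum_le_sum_of_subset_of_nonneg (fun t ht => ?_) fun t _ _ => hc t
    simp only [Finset.mem_filter, Finset.mem_range] at ht
    exact Finset.mem_Icc.2 ⟨ht.2, ht.1.le⟩
  -- The weighted sum is written as a series in t with terms (t/T)^r c_t, dominated by the summable
  -- `c'` and tending to zero for each fixed t, so that dominated convergence applies.
  set F : ℕ → ℕ → ℝ := fun T t =>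
    if t ∈ Finset.Icc M T then ((T : ℝ) ^ r)⁻¹ * ((t : ℝ) ^ r * c t) else 0 with hF
  have hF' : ∀ T : ℕ, ((T : ℝ) ^ r)⁻¹ * ∑ t ∈ Finset.Icc M T, (t : ℝ) ^ r * c t =
      ∑' t, F T t := by
    intro T
    rw [tsum_eq_sum (s := Finset.Icc M T) fun t ht => if_neg ht, Finset.mul_sum]
    exact Finset.sum_congr rfl fun t ht => (if_pos ht).symm
  simp_rw [hF']
  have h0 : (0 : ℝ) = ∑' _ : ℕ, (0 : ℝ) := by simp
  rw [h0]
  refine tendsto_tsum_of_dominated_convergence hsum (fun t => ?_) (Eventually.of_forall ?_)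
  · have h1 : Tendsto (fun T : ℕ => ((T : ℝ) ^ r)⁻¹ * ((t : ℝ) ^ r * c t)) atTop (𝓝 0) := by
      have := ((tendsto_rpow_atTop hr).comp tendsto_natCast_atTop_atTop).inv_tendsto_atTop
      simpa using this.mul_const ((t : ℝ) ^ r * c t)
    refine squeeze_zero (fun T => ?_) (fun T => ?_) h1
    · simp only [hF]
      split_ifs
      · have := hc t
        positivity
      · exact le_rfl
    · simp only [hF]
      split_ifs
      · exact le_rfl
      · have := hc t
        positivity
  · intro T t
    simp only [hF]
    split_ifs with h
    · have ht := Finset.mem_Icc.1 h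
      rw [Real.norm_of_nonneg (by have := hc t; positivity)]
      simp only [hc', if_pos ht.1]
      -- For T = 0 the quotient (t/T)^r is degenerate, but then t = 0 and the convention 0⁻¹ = 0
      -- makes the term vanish.
      rcases Nat.eq_zero_or_pos T with h0 | h0
      · have : t = 0 := by omega
        subst this
        rw [Nat.cast_zero, Real.zero_rpow hr.ne']
        simpa using hc 0
      · have hT : (0 : ℝ) < (T : ℝ) ^ r := Real.rpow_pos_of_pos (by exact_mod_cast h0) r
        rw [inv_mul_le_iff₀ hT]
        refine mul_le_mul_of_nonneg_right ?_ (hc t)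
        exact Real.rpow_le_rpow (by positivity) (by exact_mod_cast ht.2) hr.le
    · rw [norm_zero]
      exact hc'0 t

/-- This and the next two lemmas trade |x|^a = |x|^(a-r) |x|^r for T^(a-r) |x|^r, with a = 1 or 2.
The sign of a - r decides whether the bound holds below or above the truncation level T. The case x
= 0 is separate where exponents cannot be added. -/
lemma abs_le_rpow_mul_of_le {x T r : ℝ} (hr : r ≤ 1) (hx : |x| ≤ T) :
    |x| ≤ T ^ (1 - r) * |x| ^ r := by
  rcases eq_or_ne x 0 with h | h
  · subst h
    rw [abs_zero] at hx ⊢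
    positivity
  · have hx0 : 0 < |x| := abs_pos.2 h
    calc |x| = |x| ^ (1 - r) * |x| ^ r := by
          rw [← Real.rpow_add hx0]; simp
      _ ≤ _ := by
          gcongr

lemma abs_le_rpow_mul_of_lt {x T r : ℝ} (hr : 1 ≤ r) (hT : 0 < T) (hx : T < |x|) :
    |x| ≤ T ^ (1 - r) * |x| ^ r := by
  have hx0 : 0 < |x| := hT.trans hx
  calc |x| = |x| ^ (1 - r) * |x| ^ r := by
        rw [← Real.rpow_add hx0]; simp
    _ ≤ _ := by
        gcongr ?_ * _
        exact Real.rpow_le_rpow_of_nonpos hT hx.le (by linarith)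

lemma sq_le_rpow_mul_of_le {x T r : ℝ} (hr : r ≤ 2) (hx : |x| ≤ T) :
    x ^ 2 ≤ T ^ (2 - r) * |x| ^ r := by
  rcases eq_or_ne x 0 with h | h
  · subst h
    rw [abs_zero] at hx ⊢
    have : (0 : ℝ) ≤ T ^ (2 - r) * 0 ^ r := by positivity
    simpa using this
  · have hx0 : 0 < |x| := abs_pos.2 h
    calc x ^ 2 = |x| ^ (2 - r) * |x| ^ r := by
          rw [← Real.rpow_add hx0, sub_add_cancel, ← sq_abs]; simp
      _ ≤ _ := by
          gcongr

variable [IsProbabilityMeasure P]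

lemma condExp_sub_condExp_ae_eq_zero {m : MeasurableSpace Ξ} (hm : m ≤ m0) {f : Ξ → ℝ}
    (hf : Integrable f P) : P[fun ξ => f ξ - (P[f | m]) ξ | m] =ᵐ[P] 0 := by
  have h1 := condExp_sub hf (integrable_condExp (m := m) (f := f)) m
  have h2 : P[P[f | m] | m] = P[f | m] :=
    condExp_of_stronglyMeasurable hm stronglyMeasurable_condExp integrable_condExp
  filter_upwards [h1] with ξ h
  change (P[f - P[f | m] | m]) ξ = 0
  rw [h, h2]
  simp

lemma memLp_condExp_of_bound {m : MeasurableSpace Ξ} (hm : m ≤ m0) {f : Ξ → ℝ} {C : ℝ}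
    (hf : Integrable f P) (hC : ∀ ξ, |f ξ| ≤ C) : MemLp (P[f | m]) 2 P := by
  have h1 : ∀ᵐ ξ ∂P, ‖(P[f | m]) ξ‖ ≤ C := by
    have hup : P[f | m] ≤ᵐ[P] P[fun _ => C | m] :=
      condExp_mono hf (integrable_const _) (Eventually.of_forall fun ξ => (abs_le.1 (hC ξ)).2)
    have hlo : P[fun _ => -C | m] ≤ᵐ[P] P[f | m] :=
      condExp_mono (integrable_const _) hf (Eventually.of_forall fun ξ => (abs_le.1 (hC ξ)).1)
    rw [condExp_const hm] at hup hlo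
    filter_upwards [hup, hlo] with ξ h1 h2
    exact abs_le.2 ⟨h2, h1⟩
  exact MemLp.of_bound (stronglyMeasurable_condExp.mono hm).aestronglyMeasurable C h1

/-- Pythagoras: the conditional mean and the deviation from it are orthogonal, so centring can only
lower the second moment. -/
lemma integral_sub_condExp_sq_le {m : MeasurableSpace Ξ} (hm : m ≤ m0) {f : Ξ → ℝ}
    (hf : MemLp f 2 P) (hf' : MemLp (P[f | m]) 2 P) :
    ∫ ξ, (f ξ - (P[f | m]) ξ) ^ 2 ∂P ≤ ∫ ξ, f ξ ^ 2 ∂P := by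
  set d : Ξ → ℝ := fun ξ => f ξ - (P[f | m]) ξ with hd
  have hdL : MemLp d 2 P := hf.sub hf'
  have h0 : ∫ ξ, (P[f | m]) ξ * d ξ ∂P = 0 :=
    integral_mul_eq_zero_of_condExp_eq_zero hm hf' hdL
      stronglyMeasurable_condExp.aestronglyMeasurable
      (condExp_sub_condExp_ae_eq_zero hm (hf.integrable (by norm_num)))
  have h1 : ∫ ξ, f ξ ^ 2 ∂P =
      ∫ ξ, d ξ ^ 2 ∂P + ∫ ξ, (P[f | m]) ξ ^ 2 ∂P + 2 * ∫ ξ, (P[f | m]) ξ * d ξ ∂P := by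
    have hi1 : Integrable (fun ξ => d ξ ^ 2 + (P[f | m]) ξ ^ 2) P :=
      hdL.integrable_sq.add hf'.integrable_sq
    have hi2 : Integrable (fun ξ => 2 * ((P[f | m]) ξ * d ξ)) P :=
      (hf'.integrable_mul hdL).const_mul 2
    rw [← integral_const_mul, ← integral_add hdL.integrable_sq hf'.integrable_sq,
      ← integral_add hi1 hi2]
    refine integral_congr_ae (Eventually.of_forall fun ξ => ?_)
    simp only [hd]
    ring
  have h2 : 0 ≤ ∫ ξ, (P[f | m]) ξ ^ 2 ∂P := integral_nonneg fun ξ => sq_nonneg _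
  rw [h1, h0]
  linarith

section Unconditional

variable {𝒢 : ℕ → MeasurableSpace Ξ} {M : ℕ} {X : ℕ → Ξ → ℝ} {r C : ℝ}

/-- Kronecker's lemma gives the convergence of the expectations; the second claim follows because
convergence in mean implies convergence in probability. -/
lemma tendsto_rpow_inv_mul_sum_abs_rpow (hr : 0 < r) (hM : 1 ≤ M)
    (hXr : ∀ t, M ≤ t → Integrable (fun ξ => |X t ξ| ^ r) P)
    (hC : ∀ T, ∑ t ∈ Finset.Icc M T, ((t : ℝ) ^ r)⁻¹ * ∫ ξ, |X t ξ| ^ r ∂P ≤ C) :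
    Tendsto (fun T : ℕ => ((T : ℝ) ^ r)⁻¹ * ∑ t ∈ Finset.Icc M T, ∫ ξ, |X t ξ| ^ r ∂P)
      atTop (𝓝 0) ∧
    Tendsto (fun q : ℕ × Ξ => ((q.1 : ℝ) ^ r)⁻¹ * ∑ t ∈ Finset.Icc M q.1, |X t q.2| ^ r)
      (inProb P) (𝓝 0) := by
  have h1 : Tendsto (fun T : ℕ => ((T : ℝ) ^ r)⁻¹ *
      ∑ t ∈ Finset.Icc M T, ∫ ξ, |X t ξ| ^ r ∂P) atTop (𝓝 0) := by
    refine (tendsto_rpow_inv_mul_sum (M := M)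
      (c := fun t => ((t : ℝ) ^ r)⁻¹ * ∫ ξ, |X t ξ| ^ r ∂P)
      (fun t => mul_nonneg (by positivity) (integral_nonneg fun ξ => by positivity)) hr
      hC).congr fun T => ?_
    congr 1
    refine Finset.sum_congr rfl fun t ht => ?_
    have ht0 : (0 : ℝ) < (t : ℝ) ^ r :=
      Real.rpow_pos_of_pos (by exact_mod_cast hM.trans (Finset.mem_Icc.1 ht).1) r
    rw [mul_inv_cancel_left₀ ht0.ne']
  refine ⟨h1, tendsto_inProb_of_integral_abs (P := P)
    (f := fun T ξ => ((T : ℝ) ^ r)⁻¹ * ∑ t ∈ Finset.Icc M T, |X t ξ| ^ r) (fun T => ?_) ?_⟩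
  · exact (integrable_finsetSum _ fun t ht => hXr t (Finset.mem_Icc.1 ht).1).const_mul _
  · refine h1.congr fun T => ?_
    rw [← integral_finsetSum _ fun t ht => hXr t (Finset.mem_Icc.1 ht).1, ← integral_const_mul]
    refine integral_congr_ae (Eventually.of_forall fun ξ => ?_)
    exact (abs_of_nonneg (by positivity)).symm

/-- The maximum of |X_t|^r over t ≤ T is at most the sum, which is o(T^r) in probability and hence
eventually below (εT)^r. -/
lemma eventually_forall_abs_le_of_moments (hr : 0 < r) (hM : 1 ≤ M)
    (hXr : ∀ t, M ≤ t → Integrable (fun ξ => |X t ξ| ^ r) P)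
    (hC : ∀ T, ∑ t ∈ Finset.Icc M T, ((t : ℝ) ^ r)⁻¹ * ∫ ξ, |X t ξ| ^ r ∂P ≤ C)
    {ε : ℝ} (hε : 0 < ε) :
    ∀ᶠ q : ℕ × Ξ in inProb P, ∀ t ∈ Finset.Icc M q.1, |X t q.2| ≤ ε * q.1 := by
  have h1 := (tendsto_rpow_inv_mul_sum_abs_rpow hr hM hXr hC).2
  filter_upwards [h1.eventually_lt_const (Real.rpow_pos_of_pos hε r),
    tendsto_fst_inProb.eventually (eventually_gt_atTop 0)] with q hq hq0 t ht
  have hT : (0 : ℝ) < q.1 := by exact_mod_cast hq0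
  rw [inv_mul_lt_iff₀ (Real.rpow_pos_of_pos hT r), ← Real.mul_rpow hT.le hε.le] at hq
  have h2 : |X t q.2| ^ r ≤ (q.1 * ε) ^ r :=
    (Finset.single_le_sum (f := fun t => |X t q.2| ^ r) (fun t _ => by positivity) ht).trans hq.le
  rw [mul_comm]
  exact (Real.rpow_le_rpow_iff (abs_nonneg _) (by positivity) hr).1 h2

/-- Weak law of large numbers for lagged martingale differences with summable scaled moments. -/
lemma tendsto_inv_mul_sum_of_moments (hmono : Monotone 𝒢) (hle : ∀ t, 𝒢 t ≤ m0) (hr : 0 < r)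
    (hr2 : r ≤ 2) (hM : 1 ≤ M) (hXi : ∀ t, M ≤ t → Integrable (X t) P)
    (hXm : ∀ t, M ≤ t → AEStronglyMeasurable[𝒢 t] (X t) P)
    (hX0 : ∀ t, M ≤ t → P[X t | 𝒢 (t - M)] =ᵐ[P] 0)
    (hXr : ∀ t, M ≤ t → Integrable (fun ξ => |X t ξ| ^ r) P)
    (hC : ∀ T, ∑ t ∈ Finset.Icc M T, ((t : ℝ) ^ r)⁻¹ * ∫ ξ, |X t ξ| ^ r ∂P ≤ C) :
    Tendsto (fun q : ℕ × Ξ => (q.1 : ℝ)⁻¹ * ∑ t ∈ Finset.Icc M q.1, X t q.2)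
      (inProb P) (𝓝 0) := by
  obtain ⟨hw, hwp⟩ := tendsto_rpow_inv_mul_sum_abs_rpow hr hM hXr hC
  have hmax : ∀ᶠ q : ℕ × Ξ in inProb P, ∀ t ∈ Finset.Icc M q.1, |X t q.2| ≤ q.1 := by
    simpa using eventually_forall_abs_le_of_moments hr hM hXr hC one_pos
  have hpos : ∀ᶠ q : ℕ × Ξ in inProb P, 0 < q.1 :=
    tendsto_fst_inProb.eventually (eventually_gt_atTop 0)
  -- For r ≤ 1 no centring is needed: once all |X_t| ≤ T, the sum of absolute values is at most
  -- T^(1-r) times the sum of r-th powers. For r ≥ 1 the variables are truncated at the horizon T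
  -- and recentred.
  rcases le_total r 1 with hr1 | hr1
  · refine squeeze_zero_norm' ?_ hwp
    filter_upwards [hmax, hpos] with q hq hq0
    have hT : (0 : ℝ) < q.1 := by exact_mod_cast hq0
    rw [norm_mul, norm_inv, Real.norm_of_nonneg hT.le, inv_mul_le_iff₀ hT]
    calc ‖∑ t ∈ Finset.Icc M q.1, X t q.2‖
        ≤ ∑ t ∈ Finset.Icc M q.1, (q.1 : ℝ) ^ (1 - r) * |X t q.2| ^ r :=
          norm_sum_le_of_le _ fun t ht => abs_le_rpow_mul_of_le hr1 (hq t ht)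
      _ = q.1 * (((q.1 : ℝ) ^ r)⁻¹ * ∑ t ∈ Finset.Icc M q.1, |X t q.2| ^ r) := by
          rw [← Finset.mul_sum, Real.rpow_sub hT, Real.rpow_one]
          ring
  · set φ : ℝ → ℝ → ℝ := fun T x => if |x| ≤ T then x else 0 with hφ
    have hφm : ∀ T, Measurable (φ T) := fun T =>
      Measurable.ite (measurableSet_le measurable_norm measurable_const) measurable_id
        measurable_const
    have hφb : ∀ T : ℕ, ∀ x, |φ T x| ≤ T := by
      intro T x
      simp only [hφ]
      split_ifs with h
      · exact h
      · simp
    set Y : ℕ → ℕ → Ξ → ℝ := fun T t ξ => φ T (X t ξ) with hY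
    set μ : ℕ → ℕ → Ξ → ℝ := fun T t => P[Y T t | 𝒢 (t - M)] with hμ
    have hYm : ∀ T t, M ≤ t → AEStronglyMeasurable[𝒢 t] (Y T t) P := fun T t ht =>
      aestronglyMeasurable_measurable_comp (hφm T) (hXm t ht)
    have hYL : ∀ T t, M ≤ t → MemLp (Y T t) 2 P := fun T t ht =>
      MemLp.of_bound ((hYm T t ht).mono (hle t)) T (Eventually.of_forall fun ξ => hφb T _)
    have hYi : ∀ T t, M ≤ t → Integrable (Y T t) P := fun T t ht =>
      (hYL T t ht).integrable (by norm_num)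
    have hμL : ∀ T t, M ≤ t → MemLp (μ T t) 2 P := fun T t ht =>
      memLp_condExp_of_bound (hle _) (hYi T t ht) fun ξ => hφb T _
    -- Truncated squares are at most T^(2-r)|X_t|^r, so the second moment of the normalized sum is
    -- bounded by the Kronecker average `hw` times 2M.
    have hcent : Tendsto (fun q : ℕ × Ξ => (q.1 : ℝ)⁻¹ *
        ∑ t ∈ Finset.Icc M q.1, (Y q.1 t q.2 - μ q.1 t q.2)) (inProb P) (𝓝 0) := by
      refine tendsto_inProb_of_integral_sq (f := fun T ξ => (T : ℝ)⁻¹ *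
        ∑ t ∈ Finset.Icc M T, (Y T t ξ - μ T t ξ)) (fun T => ?_) ?_
      · exact (memLp_finsetSum _ fun t ht => (hYL T t (Finset.mem_Icc.1 ht).1).sub
          (hμL T t (Finset.mem_Icc.1 ht).1)).const_mul _
      · have hlim := hw.const_mul (2 * (M : ℝ))
        rw [mul_zero] at hlim
        refine tendsto_of_tendsto_of_tendsto_of_le_of_le' tendsto_const_nhds hlim
          (Eventually.of_forall fun T => integral_nonneg fun ξ => sq_nonneg _) ?_
        filter_upwards [eventually_gt_atTop 0] with T hT0
        have hT : (0 : ℝ) < T := by exact_mod_cast hT0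
        have h1 := integral_sum_sq_le_of_lagged (P := P) (M := M) hmono hle
          (X := fun t ξ => Y T t ξ - μ T t ξ)
          (fun t ht => (hYL T t ht).sub (hμL T t ht))
          (fun t ht => (hYm T t ht).sub (stronglyMeasurable_condExp.mono
            (hmono (by omega))).aestronglyMeasurable)
          (fun t ht => condExp_sub_condExp_ae_eq_zero (hle _) (hYi T t ht)) T
        have h2 : ∀ t ∈ Finset.Icc M T, ∫ ξ, (Y T t ξ - μ T t ξ) ^ 2 ∂P ≤
            (T : ℝ) ^ (2 - r) * ∫ ξ, |X t ξ| ^ r ∂P := by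
          intro t ht
          have ht' := (Finset.mem_Icc.1 ht).1
          refine (integral_sub_condExp_sq_le (hle _) (hYL T t ht') (hμL T t ht')).trans ?_
          rw [← integral_const_mul]
          refine integral_mono (hYL T t ht').integrable_sq ((hXr t ht').const_mul _) fun ξ => ?_
          simp only [hY, hφ]
          split_ifs with h
          · exact sq_le_rpow_mul_of_le hr2 h
          · have : (0 : ℝ) ≤ (T : ℝ) ^ (2 - r) * |X t ξ| ^ r := by positivity
            simpa using this
        simp only [mul_pow]
        rw [integral_const_mul]
        calc ((T : ℝ)⁻¹) ^ 2 * ∫ ξ, (∑ t ∈ Finset.Icc M T, (Y T t ξ - μ T t ξ)) ^ 2 ∂P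
            ≤ ((T : ℝ)⁻¹) ^ 2 * (2 * M * ∑ t ∈ Finset.Icc M T,
                ((T : ℝ) ^ (2 - r) * ∫ ξ, |X t ξ| ^ r ∂P)) := by
              refine mul_le_mul_of_nonneg_left (h1.trans ?_) (by positivity)
              exact mul_le_mul_of_nonneg_left (Finset.sum_le_sum h2) (by positivity)
          _ = _ := by
              rw [← Finset.mul_sum, Real.rpow_sub hT, Real.rpow_two]
              field_simp
    have hmean : Tendsto (fun q : ℕ × Ξ => (q.1 : ℝ)⁻¹ * ∑ t ∈ Finset.Icc M q.1, μ q.1 t q.2)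
        (inProb P) (𝓝 0) := by
      refine tendsto_inProb_of_integral_abs (f := fun T ξ => (T : ℝ)⁻¹ *
        ∑ t ∈ Finset.Icc M T, μ T t ξ) (fun T => ?_) ?_
      · exact (integrable_finsetSum _ fun t ht => integrable_condExp).const_mul _
      · refine tendsto_of_tendsto_of_tendsto_of_le_of_le' tendsto_const_nhds hw
          (Eventually.of_forall fun T => integral_nonneg fun ξ => abs_nonneg _) ?_
        filter_upwards [eventually_gt_atTop 0] with T hT0
        have hT : (0 : ℝ) < T := by exact_mod_cast hT0
        have h1 : ∀ t ∈ Finset.Icc M T, ∫ ξ, |μ T t ξ| ∂P ≤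
            (T : ℝ) ^ (1 - r) * ∫ ξ, |X t ξ| ^ r ∂P := by
          intro t ht
          have ht' := (Finset.mem_Icc.1 ht).1
          -- As X_t is centred, the conditional mean of its truncation is minus that of the
          -- discarded tail, where |X_t| > T and the negative power of T helps.
          have h2 : μ T t =ᵐ[P] P[Y T t - X t | 𝒢 (t - M)] := by
            filter_upwards [condExp_sub (hYi T t ht') (hXi t ht') (𝒢 (t - M)), hX0 t ht']
              with ξ h3 h4
            rw [h3, Pi.sub_apply, h4]
            simp [hμ]
          have h5 : ∫ ξ, |μ T t ξ| ∂P = ∫ ξ, |(P[Y T t - X t | 𝒢 (t - M)]) ξ| ∂P :=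
            integral_congr_ae (h2.fun_comp abs)
          rw [h5, ← integral_const_mul]
          refine (integral_abs_condExp_le _).trans ?_
          refine integral_mono ((hYi T t ht').sub (hXi t ht')).abs ((hXr t ht').const_mul _)
            fun ξ => ?_
          simp only [hY, hφ, Pi.sub_apply]
          split_ifs with h
          · simp only [sub_self, abs_zero]
            positivity
          · rw [zero_sub, abs_neg]
            exact abs_le_rpow_mul_of_lt hr1 hT (not_le.1 h)
        calc ∫ ξ, |(T : ℝ)⁻¹ * ∑ t ∈ Finset.Icc M T, μ T t ξ| ∂P
            ≤ ∫ ξ, (T : ℝ)⁻¹ * ∑ t ∈ Finset.Icc M T, |μ T t ξ| ∂P := by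
              refine integral_mono
                ((integrable_finsetSum _ fun t ht => integrable_condExp).const_mul _).abs
                ((integrable_finsetSum _ fun t ht => integrable_condExp.abs).const_mul _)
                fun ξ => ?_
              dsimp only
              rw [abs_mul, abs_of_nonneg (by positivity : (0 : ℝ) ≤ (T : ℝ)⁻¹)]
              exact mul_le_mul_of_nonneg_left (Finset.abs_sum_le_sum_abs _ _) (by positivity)
          _ = (T : ℝ)⁻¹ * ∑ t ∈ Finset.Icc M T, ∫ ξ, |μ T t ξ| ∂P := by
              rw [integral_const_mul, integral_finsetSum _ fun t ht => integrable_condExp.abs]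
          _ ≤ (T : ℝ)⁻¹ * ∑ t ∈ Finset.Icc M T, (T : ℝ) ^ (1 - r) * ∫ ξ, |X t ξ| ^ r ∂P :=
              mul_le_mul_of_nonneg_left (Finset.sum_le_sum h1) (by positivity)
          _ = _ := by
              rw [← Finset.mul_sum, Real.rpow_sub hT, Real.rpow_one]
              field_simp
    have hsum := hcent.add hmean
    rw [add_zero] at hsum
    -- With probability tending to one no variable with t ≤ T exceeds T, so the truncation changes
    -- nothing and the conditional means added back cancel.
    refine hsum.congr' ?_
    filter_upwards [hmax] with q hq
    rw [← mul_add, ← Finset.sum_add_distrib]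
    congr 1
    refine Finset.sum_congr rfl fun t ht => ?_
    simp only [hY, hφ, if_pos (hq t ht)]
    ring

end Unconditional

end LaggedMoments

/-! ### Limit theorems under conditional moment bounds, by predictable stopping -/

section LaggedConditional

variable {Ξ : Type*} {m0 : MeasurableSpace Ξ} {P : Measure Ξ}
  {𝒢 : ℕ → MeasurableSpace Ξ} {M : ℕ}

lemma BddInProb.congr {f g : ℕ → Ξ → ℝ} (hf : BddInProb P f)
    (hfg : ∀ᶠ q : ℕ × Ξ in inProb P, g q.1 q.2 ≤ f q.1 q.2) : BddInProb P g := by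
  intro η hη
  obtain ⟨C, hC⟩ := hf (η / 2) (ENNReal.half_pos hη.ne')
  refine ⟨C, ?_⟩
  rw [eventually_inProb, ENNReal.tendsto_nhds_zero] at hfg
  filter_upwards [hC, hfg (η / 2) (ENNReal.half_pos hη.ne')] with T h1 h2
  calc P {ξ | ¬ g T ξ ≤ C} ≤ P ({ξ | ¬ f T ξ ≤ C} ∪ {ξ | ¬ g T ξ ≤ f T ξ}) := by
        refine measure_mono fun ξ hξ => ?_
        by_contra h
        simp only [Set.mem_union, Set.mem_ofPred_eq, not_or, not_not] at h
        exact hξ (h.2.trans h.1)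
    _ ≤ η / 2 + η / 2 := (measure_union_le _ _).trans (add_le_add h1 h2)
    _ = η := ENNReal.add_halves η

lemma aestronglyMeasurable_indicator_sub {m : MeasurableSpace Ξ} {f : Ξ → ℝ} {A : Set Ξ}
    (hf : AEStronglyMeasurable[m] f P) (hA : MeasurableSet[m] A) :
    AEStronglyMeasurable[m] (A.indicator f) P := by
  obtain ⟨g, hg, hfg⟩ := hf
  refine ⟨A.indicator g, hg.indicator hA, ?_⟩
  filter_upwards [hfg] with ξ h
  by_cases hξ : ξ ∈ A
  · rw [Set.indicator_of_mem hξ, Set.indicator_of_mem hξ, h]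
  · rw [Set.indicator_of_notMem hξ, Set.indicator_of_notMem hξ]

variable [IsProbabilityMeasure P]

/-- The events that stopping occurs at level n decrease in n, and their intersection is null because
the running sums are almost surely bounded. Continuity from above gives a level with small stopping
probability. -/
lemma exists_measure_compl_stoppedSet_le (hmono : Monotone 𝒢) (hle : ∀ t, 𝒢 t ≤ m0)
    {a : ℕ} {c : ℕ → ℝ} {f : ℕ → Ξ → ℝ}
    (h : ∀ᵐ ξ ∂P, ∃ C : ℝ, ∀ t, ξ ∈ stoppedSet P 𝒢 M a c f C t) {η : ENNReal} (hη : 0 < η) :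
    ∃ C : ℝ, 0 ≤ C ∧ P {ξ | ¬ ∀ t, ξ ∈ stoppedSet P 𝒢 M a c f C t} ≤ η := by
  set B : ℕ → Set Ξ := fun n => {ξ | ¬ ∀ t, ξ ∈ stoppedSet P 𝒢 M a c f n t} with hB
  have hBm : ∀ n, MeasurableSet (B n) := by
    intro n
    have : B n = (⋂ t, stoppedSet P 𝒢 M a c f n t)ᶜ := by
      ext ξ
      simp [hB]
    rw [this]
    exact (MeasurableSet.iInter fun t =>
      hle _ _ (measurableSet_stoppedSet hmono M a c f n t)).compl
  have hanti : Antitone B := by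
    intro n n' hn ξ hξ h1
    refine hξ fun t => le_trans (show _ ≤ (n : ℝ) from h1 t) ?_
    exact_mod_cast hn
  have hnull : P (⋂ n, B n) = 0 := by
    refine measure_mono_null ?_ (ae_iff.1 h)
    intro ξ hξ h1
    obtain ⟨C, hC⟩ := h1
    obtain ⟨n, hn⟩ := exists_nat_ge C
    exact Set.mem_iInter.1 hξ n fun t => (hC t).trans hn
  have hlim := tendsto_measure_iInter_atTop (μ := P) (fun n => (hBm n).nullMeasurableSet) hanti
    ⟨0, measure_ne_top _ _⟩
  rw [hnull, ENNReal.tendsto_nhds_zero] at hlim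
  obtain ⟨n, hn⟩ := (hlim η hη).exists
  exact ⟨n, Nat.cast_nonneg n, hn⟩

/-- Weak law of large numbers and uniform bound for lagged martingale differences whose scaled
conditional moments are almost surely summable. -/
lemma lagged_lln_of_condExp_moments (hmono : Monotone 𝒢) (hle : ∀ t, 𝒢 t ≤ m0) {r : ℝ}
    (hr : 0 < r) (hr2 : r ≤ 2) (hM : 1 ≤ M) {D : ℕ → Ξ → ℝ}
    (hDi : ∀ t, M ≤ t → Integrable (D t) P)
    (hDm : ∀ t, M ≤ t → AEStronglyMeasurable[𝒢 t] (D t) P)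
    (hD0 : ∀ t, M ≤ t → P[D t | 𝒢 (t - M)] =ᵐ[P] 0)
    (hDr : ∀ t, M ≤ t → Integrable (fun ξ => |D t ξ| ^ r) P)
    (hsum : ∀ᵐ ξ ∂P, ∃ C : ℝ, ∀ T, ∑ t ∈ Finset.Icc M T, ((t : ℝ) ^ r)⁻¹ *
      (P[fun ξ' => |D t ξ'| ^ r | 𝒢 (t - M)]) ξ ≤ C) :
    Tendsto (fun q : ℕ × Ξ => (q.1 : ℝ)⁻¹ * ∑ t ∈ Finset.Icc M q.1, D t q.2)
      (inProb P) (𝓝 0) ∧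
    ∀ ε : ℝ, 0 < ε →
      ∀ᶠ q : ℕ × Ξ in inProb P, ∀ t ∈ Finset.Icc M q.1, |D t q.2| ≤ ε * q.1 := by
  set c : ℕ → ℝ := fun t => ((t : ℝ) ^ r)⁻¹ with hc
  have hc0 : ∀ t, 0 ≤ c t := fun t => by positivity
  set f : ℕ → Ξ → ℝ := fun t ξ => |D t ξ| ^ r with hf
  set K : ℝ → ℕ → Set Ξ := fun C => stoppedSet P 𝒢 M M c f C with hK
  have hKm : ∀ C t, MeasurableSet[𝒢 (t - M)] (K C t) := fun C =>
    measurableSet_stoppedSet hmono M M c f C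
  have hKm0 : ∀ C t, MeasurableSet (K C t) := fun C t => hle _ _ (hKm C t)
  -- The stopped differences stay adapted and centred because the indicator is predictable, and now
  -- they satisfy the unconditional moment bound `hXC`.
  set X : ℝ → ℕ → Ξ → ℝ := fun C t => (K C t).indicator (D t) with hX
  have hXr : ∀ C t, (fun ξ => |X C t ξ| ^ r) = (K C t).indicator (f t) := by
    intro C t
    ext ξ
    by_cases h : ξ ∈ K C t
    · simp only [hX, Set.indicator_of_mem h, hf]
    · simp only [hX, Set.indicator_of_notMem h, abs_zero]
      exact Real.zero_rpow hr.ne'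
  have hXi : ∀ C t, M ≤ t → Integrable (X C t) P := fun C t ht =>
    (hDi t ht).indicator (hKm0 C t)
  have hXm : ∀ C t, M ≤ t → AEStronglyMeasurable[𝒢 t] (X C t) P := fun C t ht =>
    aestronglyMeasurable_indicator_sub (hDm t ht) (hmono (Nat.sub_le t M) _ (hKm C t))
  have hX0 : ∀ C t, M ≤ t → P[X C t | 𝒢 (t - M)] =ᵐ[P] 0 := by
    intro C t ht
    filter_upwards [condExp_indicator (m := 𝒢 (t - M)) (hDi t ht) (hKm C t), hD0 t ht]
      with ξ h1 h2
    rw [h1, Set.indicator_apply_eq_zero.2 fun _ => h2]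
    rfl
  have hXri : ∀ C t, M ≤ t → Integrable (fun ξ => |X C t ξ| ^ r) P := by
    intro C t ht
    rw [hXr]
    exact (hDr t ht).indicator (hKm0 C t)
  have hXC : ∀ C, 0 ≤ C → ∀ T, ∑ t ∈ Finset.Icc M T,
      ((t : ℝ) ^ r)⁻¹ * ∫ ξ, |X C t ξ| ^ r ∂P ≤ C := by
    intro C hC T
    refine le_trans (le_of_eq (Finset.sum_congr rfl fun t _ => ?_))
      (sum_setIntegral_stoppedSet_le (M := M) (a := M) hmono hle hc0
        (fun t ξ => by positivity) hDr hC T)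
    rw [hXr, integral_indicator (hKm0 C t)]
  have hgood : ∀ᵐ ξ ∂P, ∃ C : ℝ, ∀ t, ξ ∈ stoppedSet P 𝒢 M M c f C t := hsum
  constructor
  · refine tendsto_inProb_of_forall_good fun η hη => ?_
    obtain ⟨C, hC0, hC⟩ := exists_measure_compl_stoppedSet_le hmono hle hgood hη
    refine ⟨{q | ∀ t, q.2 ∈ K C t}, Eventually.of_forall fun T => hC, ?_⟩
    have h1 := tendsto_inv_mul_sum_of_moments hmono hle hr hr2 hM (hXi C) (hXm C) (hX0 C)
      (hXri C) (hXC C hC0)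
    refine (h1.mono_left inf_le_left).congr' ?_
    filter_upwards [mem_inf_of_right (mem_principal_self _)] with q hq
    congr 1
    exact Finset.sum_congr rfl fun t _ => Set.indicator_of_mem (hq t) _
  · intro ε hε
    refine eventually_inProb_of_forall_good fun η hη => ?_
    obtain ⟨C, hC0, hC⟩ := exists_measure_compl_stoppedSet_le hmono hle hgood hη
    refine ⟨{q | ∀ t, q.2 ∈ K C t}, Eventually.of_forall fun T => hC, ?_⟩
    have h1 := eventually_forall_abs_le_of_moments hr hM (hXri C) (hXC C hC0) hε
    filter_upwards [mem_inf_of_right (mem_principal_self _), h1.filter_mono inf_le_left]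
      with q hq hq' t ht
    have := hq' t ht
    rwa [show X C t q.2 = D t q.2 from Set.indicator_of_mem (hq t) _] at this

/-- If the average conditional second moments converge in probability, then averages of squares
and normalized squares of sums are bounded in probability. -/
lemma bddInProb_of_condExp_sq (hmono : Monotone 𝒢) (hle : ∀ t, 𝒢 t ≤ m0) (hM : 1 ≤ M)
    {Z : ℕ → Ξ → ℝ} {v : ℝ} (hZL : ∀ t, 1 ≤ t → MemLp (Z t) 2 P)
    (hZm : ∀ t, M ≤ t → AEStronglyMeasurable[𝒢 t] (Z t) P)
    (hZ0 : ∀ t, M ≤ t → P[Z t | 𝒢 (t - M)] =ᵐ[P] 0)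
    (hv : Tendsto (fun q : ℕ × Ξ => avg 1 q.1 fun t =>
      (P[fun ξ' => Z t ξ' * Z t ξ' | 𝒢 (t - M)]) q.2) (inProb P) (𝓝 v)) :
    BddInProb P (fun T ξ => (T : ℝ)⁻¹ * ∑ t ∈ Finset.Icc 1 T, Z t ξ ^ 2) ∧
    BddInProb P (fun T ξ => (T : ℝ)⁻¹ * (∑ t ∈ Finset.Icc M T, Z t ξ) ^ 2) := by
  -- Any constant that is nonnegative and larger than the limit v will do. The stopping level C·T
  -- below depends on the horizon, since the conditional second moments grow linearly.
  set C : ℝ := |v| + 1 with hC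
  have hC0 : 0 ≤ C := by positivity
  set f : ℕ → Ξ → ℝ := fun t ξ => Z t ξ * Z t ξ with hf
  have hf0 : ∀ t ξ, 0 ≤ f t ξ := fun t ξ => mul_self_nonneg _
  have hfi : ∀ t, 1 ≤ t → Integrable (f t) P := fun t ht => (hZL t ht).integrable_mul (hZL t ht)
  set K : ℕ → ℕ → Set Ξ := fun T => stoppedSet P 𝒢 M 1 (fun _ => 1) f (C * T) with hK
  have hKm : ∀ T t, MeasurableSet[𝒢 (t - M)] (K T t) := fun T =>
    measurableSet_stoppedSet hmono M 1 _ f _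
  have hKm0 : ∀ T t, MeasurableSet (K T t) := fun T t => hle _ _ (hKm T t)
  set X : ℕ → ℕ → Ξ → ℝ := fun T t => (K T t).indicator (Z t) with hX
  have hX2 : ∀ T t ξ, X T t ξ ^ 2 = (K T t).indicator (f t) ξ := by
    intro T t ξ
    by_cases h : ξ ∈ K T t
    · simp only [hX, Set.indicator_of_mem h, hf, sq]
    · simp only [hX, Set.indicator_of_notMem h]
      norm_num
  have hXL : ∀ T t, 1 ≤ t → MemLp (X T t) 2 P := fun T t ht => (hZL t ht).indicator (hKm0 T t)
  have hXsum : ∀ T : ℕ, ∑ t ∈ Finset.Icc 1 T, ∫ ξ, X T t ξ ^ 2 ∂P ≤ C * T := by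
    intro T
    refine le_trans (le_of_eq (Finset.sum_congr rfl fun t _ => ?_))
      (sum_setIntegral_stoppedSet_le (P := P) (M := M) (a := 1) (c := fun _ => 1) hmono hle
        (fun _ => zero_le_one) hf0 hfi (by positivity : 0 ≤ C * T) T)
    simp_rw [hX2]
    rw [integral_indicator (hKm0 T t), one_mul]
  -- Conditional second moments are nonnegative, so if their sum up to T is below C·T, then all
  -- partial sums are too, and stopping never happens before T.
  have hgood : ∀ᶠ q : ℕ × Ξ in inProb P, ∀ t ∈ Finset.Icc 1 q.1, X q.1 t q.2 = Z t q.2 := by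
    have h1 : ∀ᵐ ξ ∂P, ∀ t, 0 ≤ (P[f t | 𝒢 (t - M)]) ξ :=
      ae_all_iff.2 fun t => condExp_nonneg (Eventually.of_forall fun ξ => hf0 t ξ)
    filter_upwards [eventually_inProb_of_ae h1,
      hv.eventually_lt_const (show v < C by rw [hC]; linarith [le_abs_self v]),
      tendsto_fst_inProb.eventually (eventually_gt_atTop 0)] with q hq1 hq2 hq0 t ht
    have hT : (0 : ℝ) < q.1 := by exact_mod_cast hq0
    have ht' := Finset.mem_Icc.1 ht
    refine Set.indicator_of_mem ?_ _
    change ∑ s ∈ Finset.Icc 1 t, 1 * (P[f s | 𝒢 (s - M)]) q.2 ≤ C * q.1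
    simp only [one_mul]
    simp only [avg, Nat.cast_one, sub_add_cancel, smul_eq_mul] at hq2
    rw [inv_mul_lt_iff₀ hT] at hq2
    calc ∑ s ∈ Finset.Icc 1 t, (P[f s | 𝒢 (s - M)]) q.2
        ≤ ∑ s ∈ Finset.Icc 1 q.1, (P[f s | 𝒢 (s - M)]) q.2 :=
          Finset.sum_le_sum_of_subset_of_nonneg
            (Finset.Icc_subset_Icc_right ht'.2) fun s _ _ => hq1 s
      _ ≤ C * q.1 := by rw [mul_comm]; exact hq2.le
  constructor
  · refine BddInProb.congr (f := fun T ξ => (T : ℝ)⁻¹ * ∑ t ∈ Finset.Icc 1 T, X T t ξ ^ 2) ?_ ?_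
    · refine BddInProb.of_integral_le (c := C)
        (fun T => Eventually.of_forall fun ξ => ?_) (fun T => ?_) ?_
      · change (0 : ℝ) ≤ (T : ℝ)⁻¹ * ∑ t ∈ Finset.Icc 1 T, X T t ξ ^ 2
        positivity
      · exact (integrable_finsetSum _ fun t ht =>
          (hXL T t (Finset.mem_Icc.1 ht).1).integrable_sq).const_mul _
      · filter_upwards [eventually_gt_atTop 0] with T hT0
        have hT : (0 : ℝ) < T := by exact_mod_cast hT0
        rw [integral_const_mul, integral_finsetSum _ fun t ht =>
          (hXL T t (Finset.mem_Icc.1 ht).1).integrable_sq, inv_mul_le_iff₀ hT, mul_comm]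
        exact hXsum T
    · filter_upwards [hgood] with q hq
      exact (congrArg _ (Finset.sum_congr rfl fun t ht => by rw [hq t ht])).le
  · refine BddInProb.congr (f := fun T ξ => (T : ℝ)⁻¹ * (∑ t ∈ Finset.Icc M T, X T t ξ) ^ 2)
      ?_ ?_
    · refine BddInProb.of_integral_le (c := 2 * M * C)
        (fun T => Eventually.of_forall fun ξ => ?_) (fun T => ?_) ?_
      · change (0 : ℝ) ≤ (T : ℝ)⁻¹ * (∑ t ∈ Finset.Icc M T, X T t ξ) ^ 2
        positivity
      · exact (memLp_finsetSum _ fun t ht =>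
          hXL T t (hM.trans (Finset.mem_Icc.1 ht).1)).integrable_sq.const_mul _
      · filter_upwards [eventually_gt_atTop 0] with T hT0
        have hT : (0 : ℝ) < T := by exact_mod_cast hT0
        have h1 := integral_sum_sq_le_of_lagged (P := P) (M := M) hmono hle (X := X T)
          (fun t ht => hXL T t (hM.trans ht))
          (fun t ht => aestronglyMeasurable_indicator_sub (hZm t ht)
            (hmono (Nat.sub_le t M) _ (hKm T t)))
          (fun t ht => by
            filter_upwards [condExp_indicator (m := 𝒢 (t - M))
              ((hZL t (hM.trans ht)).integrable (by norm_num)) (hKm T t), hZ0 t ht] with ξ h1 h2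
            rw [h1, Set.indicator_apply_eq_zero.2 fun _ => h2]
            rfl) T
        have h2 : ∑ t ∈ Finset.Icc M T, ∫ ξ, X T t ξ ^ 2 ∂P ≤ C * T :=
          (Finset.sum_le_sum_of_subset_of_nonneg (Finset.Icc_subset_Icc_left hM)
            fun t _ _ => integral_nonneg fun ξ => sq_nonneg _).trans (hXsum T)
        rw [integral_const_mul, inv_mul_le_iff₀ hT]
        calc _ ≤ _ := h1
          _ ≤ 2 * M * (C * T) := mul_le_mul_of_nonneg_left h2 (by positivity)
          _ = T * (2 * M * C) := by ring
    · filter_upwards [hgood] with q hq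
      rw [Finset.sum_congr rfl fun t ht => hq t (Finset.Icc_subset_Icc_left hM ht)]

end LaggedConditional

/-! ### Measurability and the conditional law of the treatments -/

lemma measurable_count {Ω : Type*} [MeasurableSpace Ω] {B : Set Ω} (hB : MeasurableSet B) :
    Measurable (count B : PointPattern Ω → ℕ) := by
  rw [measurable_iff_comap_le]
  exact le_iSup (fun B : {B : Set Ω // MeasurableSet B} => MeasurableSpace.comap (count B.1) ⊤)
    ⟨B, hB⟩

lemma count_le_count_univ {Ω : Type*} (B : Set Ω) (y : PointPattern Ω) :
    count B y ≤ count Set.univ y := by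
  refine Set.ncard_le_ncard (fun s hs => ⟨hs.1, trivial⟩) ?_
  exact (Finset.finite_toSet (show Finset Ω from y)).subset fun s hs => hs.1

lemma measurable_snoc {α : Type*} [MeasurableSpace α] (n : ℕ) :
    Measurable fun q : (Fin n → α) × α => (Fin.snoc q.1 q.2 : Fin (n + 1) → α) := by
  refine measurable_pi_iff.2 fun i => ?_
  induction i using Fin.lastCases with
  | last => simpa using measurable_snd
  | cast i => simpa [Function.comp_def] using (measurable_pi_apply i).comp measurable_fst

lemma measurable_append {α : Type*} [MeasurableSpace α] (m n : ℕ) :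
    Measurable fun q : (Fin m → α) × (Fin n → α) => (Fin.append q.1 q.2 : Fin (m + n) → α) := by
  refine measurable_pi_iff.2 fun i => ?_
  induction i using Fin.addCases with
  | left i => simpa [Function.comp_def] using (measurable_pi_apply i).comp measurable_fst
  | right i => simpa [Function.comp_def] using (measurable_pi_apply i).comp measurable_snd

/-- Tonelli with the last coordinate innermost, the order in which the induction over periods
removes treatments. -/
lemma lintegral_pi_succ {α : Type*} [MeasurableSpace α] (μ : Measure α) [SigmaFinite μ]
    (k : ℕ) {g : (Fin (k + 1) → α) → ENNReal} (hg : Measurable g) :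
    ∫⁻ w, g w ∂(Measure.pi fun _ : Fin (k + 1) => μ) =
      ∫⁻ w, ∫⁻ x, g (Fin.snoc w x) ∂μ ∂(Measure.pi fun _ : Fin k => μ) := by
  have h1 := (measurePreserving_piFinSuccAbove (fun _ : Fin (k + 1) => μ) (Fin.last k)).symm
  rw [← h1.lintegral_comp_emb (MeasurableEquiv.measurableEmbedding _)]
  refine (lintegral_prod_symm _ (hg.comp (MeasurableEquiv.measurable _)).aemeasurable).trans ?_
  simp only [MeasurableEquiv.piFinSuccAbove_symm_apply, Fin.insertNthEquiv, Equiv.coe_fn_mk,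
    Fin.insertNth_last', Function.comp_def]

instance Intervention.isProbabilityMeasure_dist {Ω : Type*} [MeasurableSpace Ω]
    {ν : Measure (PointPattern Ω)} (h : Intervention Ω ν) : IsProbabilityMeasure h.dist :=
  ⟨by rw [Intervention.dist, withDensity_apply _ MeasurableSet.univ, Measure.restrict_univ,
    h.lintegral_f]⟩

namespace Model

variable {Ω 𝒰 𝒳 ℛ Ξ : Type*} [MeasurableSpace Ω] [MeasurableSpace 𝒰] [MeasurableSpace 𝒳]
  [MeasurableSpace ℛ] [MeasurableSpace Ξ] {p L K : ℕ} (D : Model Ω 𝒰 𝒳 ℛ Ξ p L K)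

/-- The complete history: all potential values and the treatment path up to time `n`. -/
def full (n : ℕ) (ξ : Ξ) : 𝒰 × (Fin n → PointPattern Ω) := (D.U ξ, D.path n ξ)

lemma measurable_path (n : ℕ) : Measurable (D.path n) :=
  measurable_pi_iff.2 fun j => D.measurable_W (j + 1)

lemma measurable_full (n : ℕ) : Measurable (D.full n) :=
  D.measurable_U.prodMk (D.measurable_path n)

lemma measurable_full_fullSigma (n : ℕ) : Measurable[D.fullSigma n] (D.full n) :=
  comap_measurable _

lemma fullSigma_le (n : ℕ) : D.fullSigma n ≤ ‹MeasurableSpace Ξ› :=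
  (D.measurable_full n).comap_le

lemma measurable_full_of_le {n t : ℕ} (h : n ≤ t) : Measurable[D.fullSigma t] (D.full n) := by
  have h1 : D.full n = (fun q : 𝒰 × (Fin t → PointPattern Ω) =>
      (q.1, fun j : Fin n => q.2 (Fin.castLE h j))) ∘ D.full t := rfl
  rw [h1]
  refine Measurable.comp ?_ (D.measurable_full_fullSigma t)
  exact measurable_fst.prodMk (measurable_pi_iff.2 fun j =>
    (measurable_pi_apply _).comp measurable_snd)

lemma fullSigma_mono : Monotone D.fullSigma := fun _ _ h =>
  (D.measurable_full_of_le h).comap_le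

lemma measurable_W_fullSigma {n t : ℕ} (h : n < t) : Measurable[D.fullSigma t] (D.W (n + 1)) := by
  have h1 : D.W (n + 1) = (fun q : 𝒰 × (Fin t → PointPattern Ω) => q.2 ⟨n, h⟩) ∘ D.full t := rfl
  rw [h1]
  exact Measurable.comp ((measurable_pi_apply _).comp measurable_snd)
    (D.measurable_full_fullSigma t)

/-- The observed history as a function of the complete history. -/
def histOf (n : ℕ) (q : 𝒰 × (Fin n → PointPattern Ω)) : ObsHist Ω 𝒳 n :=
  (q.2, fun j => D.Y (j + 1) q.1 fun i => q.2 (Fin.castLE j.2 i),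
    fun j => D.X j q.1 fun i => q.2 (Fin.castLE (Nat.lt_succ_iff.1 j.2) i))

lemma obsHist_eq (n : ℕ) (ξ : Ξ) : D.obsHist n ξ = D.histOf n (D.full n ξ) := rfl

lemma measurable_histOf (n : ℕ) : Measurable (D.histOf n) := by
  refine measurable_snd.prodMk (Measurable.prodMk ?_ ?_)
  · refine measurable_pi_iff.2 fun j => ?_
    exact (D.measurable_Y (j + 1)).comp (measurable_fst.prodMk (measurable_pi_iff.2 fun i =>
      (measurable_pi_apply _).comp measurable_snd))
  · refine measurable_pi_iff.2 fun j => ?_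
    exact (D.measurable_X j).comp (measurable_fst.prodMk (measurable_pi_iff.2 fun i =>
      (measurable_pi_apply _).comp measurable_snd))

lemma measurable_obsHist_fullSigma {n t : ℕ} (h : n ≤ t) :
    Measurable[D.fullSigma t] (D.obsHist n) :=
  (D.measurable_histOf n).comp (D.measurable_full_of_le h)

lemma measurable_obsY_fullSigma {t : ℕ} : Measurable[D.fullSigma t] (D.obsY t) :=
  (D.measurable_Y t).comp (D.measurable_full_fullSigma t)

lemma measurable_obsX_fullSigma {n t : ℕ} (h : n ≤ t) : Measurable[D.fullSigma t] (D.obsX n) :=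
  (D.measurable_X n).comp (D.measurable_full_of_le h)

lemma path_succ (n : ℕ) (ξ : Ξ) :
    D.path (n + 1) ξ = Fin.snoc (D.path n ξ) (D.W (n + 1) ξ) := by
  ext1 i
  induction i using Fin.lastCases with
  | last => simp [path]
  | cast i => simp [path]

lemma measurable_e_hist {γ : Param K} (hγ : γ ∈ D.Γ) (n : ℕ) :
    Measurable fun q : (𝒰 × (Fin n → PointPattern Ω)) × PointPattern Ω =>
      D.e n (D.histOf n q.1) q.2 γ :=
  (D.measurable_e n γ hγ).comp
    (((D.measurable_histOf n).comp measurable_fst).prodMk measurable_snd)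

variable {D} {P : Measure Ξ} [IsProbabilityMeasure P] {γstar : Param K}

/-- The conditional law of the treatment given the complete history has the model density. -/
lemma lintegral_full_treatment (h_unconf : D.Unconfounded P)
    (h_spec : D.CorrectlySpecified P γstar) (n : ℕ)
    {g : (𝒰 × (Fin n → PointPattern Ω)) × PointPattern Ω → ENNReal} (hg : Measurable g) :
    ∫⁻ ξ, g (D.full n ξ, D.W (n + 1) ξ) ∂P =
      ∫⁻ ξ, ∫⁻ w, ENNReal.ofReal (D.e n (D.obsHist n ξ) w γstar) * g (D.full n ξ, w) ∂D.ν ∂P := by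
  have := D.sigmaFinite_ν
  obtain ⟨hγ, hspec⟩ := h_spec
  set k : (𝒰 × (Fin n → PointPattern Ω)) × PointPattern Ω → ENNReal := fun q =>
    ENNReal.ofReal (D.e n (D.histOf n q.1) q.2 γstar) with hk
  have hkm : Measurable k := (D.measurable_e_hist hγ n).ennreal_ofReal
  have hpair : Measurable fun ξ => (D.full n ξ, D.W (n + 1) ξ) :=
    (D.measurable_full n).prodMk (D.measurable_W (n + 1))
  -- The joint law of complete history and next treatment has density e with respect to the law of
  -- the history times ν. Since it is finite, equality on measurable rectangles suffices.
  have heq : P.map (fun ξ => (D.full n ξ, D.W (n + 1) ξ)) =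
      ((P.map (D.full n)).prod D.ν).withDensity k := by
    have : IsFiniteMeasure (P.map (fun ξ => (D.full n ξ, D.W (n + 1) ξ))) :=
      Measure.isFiniteMeasure_map _ _
    refine Measure.ext_prod fun {s t} hs ht => ?_
    set A := D.full n ⁻¹' s with hA
    have hAm : MeasurableSet[D.fullSigma n] A := D.measurable_full_fullSigma n hs
    have hAm0 : MeasurableSet A := D.fullSigma_le n _ hAm
    set B := D.W (n + 1) ⁻¹' t with hB
    have hBm : MeasurableSet B := D.measurable_W (n + 1) ht
    have hlhs : P.map (fun ξ => (D.full n ξ, D.W (n + 1) ξ)) (s ×ˢ t) = P (A ∩ B) := by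
      rw [Measure.map_apply hpair (hs.prod ht)]
      rfl
    have hein : ∀ ξ, Integrable (fun w => D.e n (D.obsHist n ξ) w γstar) D.ν := by
      intro ξ
      refine ⟨?_, ?_⟩
      · exact ((D.measurable_e n γstar hγ).comp measurable_prodMk_left).aestronglyMeasurable
      · rw [hasFiniteIntegral_iff_ofReal
          (Eventually.of_forall fun w => D.nonneg_e n _ w γstar hγ), D.lintegral_e n _ γstar hγ]
        exact ENNReal.one_lt_top
    have hrhs : ((P.map (D.full n)).prod D.ν).withDensity k (s ×ˢ t) =
        ∫⁻ ξ in A, ∫⁻ w in t, ENNReal.ofReal (D.e n (D.obsHist n ξ) w γstar) ∂D.ν ∂P := by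
      rw [withDensity_apply _ (hs.prod ht), ← Measure.prod_restrict,
        lintegral_prod _ hkm.aemeasurable, Measure.restrict_map (D.measurable_full n) hs,
        lintegral_map hkm.lintegral_prod_right' (D.measurable_full n)]
      rfl
    have hind : Integrable (B.indicator fun _ => (1 : ℝ)) P := (integrable_const 1).indicator hBm
    -- Unconfoundedness passes from the complete to the observed history, where correct
    -- specification supplies the density.
    have hcond : P[B.indicator (fun _ => (1 : ℝ)) | D.fullSigma n] =ᵐ[P]
        fun ξ => ∫ w in t, D.e n (D.obsHist n ξ) w γstar ∂D.ν :=
      (h_unconf n t ht).trans (hspec n t ht)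
    have hreal : ∫ ξ in A, (∫ w in t, D.e n (D.obsHist n ξ) w γstar ∂D.ν) ∂P = P.real (A ∩ B) := by
      rw [← setIntegral_congr_ae hAm0 (hcond.mono fun ξ h _ => h),
        setIntegral_condExp (D.fullSigma_le n) hind hAm, setIntegral_indicator hBm]
      simp
    have hintegrable : IntegrableOn (fun ξ => ∫ w in t, D.e n (D.obsHist n ξ) w γstar ∂D.ν) A P :=
      (integrable_condExp.congr hcond).integrableOn
    rw [hlhs, hrhs, ← ENNReal.ofReal_toReal (measure_ne_top P (A ∩ B)), ← measureReal_def, ← hreal,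
      ofReal_integral_eq_lintegral_ofReal hintegrable
        (Eventually.of_forall fun ξ => integral_nonneg fun w => D.nonneg_e n _ w γstar hγ)]
    refine lintegral_congr fun ξ => ?_
    exact ofReal_integral_eq_lintegral_ofReal (hein ξ).integrableOn
      (Eventually.of_forall fun w => D.nonneg_e n _ w γstar hγ)
  calc ∫⁻ ξ, g (D.full n ξ, D.W (n + 1) ξ) ∂P
      = ∫⁻ q, g q ∂(P.map fun ξ => (D.full n ξ, D.W (n + 1) ξ)) := (lintegral_map hg hpair).symm
    _ = ∫⁻ q, (k * g) q ∂((P.map (D.full n)).prod D.ν) := by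
        rw [heq, lintegral_withDensity_eq_lintegral_mul _ hkm hg]
    _ = _ := by
        rw [lintegral_prod _ (hkm.mul hg).aemeasurable,
          lintegral_map (hkm.mul hg).lintegral_prod_right' (D.measurable_full n)]
        rfl

/-- A law with density e gives no mass to the zero set of e. Hence smoothness of the model, assumed
only where the true density is positive, is available almost surely along the data. -/
lemma ae_e_pos (h_unconf : D.Unconfounded P) (h_spec : D.CorrectlySpecified P γstar) :
    ∀ᵐ ξ ∂P, ∀ n, 0 < D.e n (D.obsHist n ξ) (D.W (n + 1) ξ) γstar := by
  refine ae_all_iff.2 fun n => ?_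
  have hm := D.measurable_e_hist h_spec.1 n
  set N : Set ((𝒰 × (Fin n → PointPattern Ω)) × PointPattern Ω) :=
    {q | D.e n (D.histOf n q.1) q.2 γstar = 0} with hN
  have hNm : MeasurableSet N := hm (measurableSet_singleton 0)
  have h1 := lintegral_full_treatment h_unconf h_spec n
    (g := N.indicator fun _ => 1) (measurable_const.indicator hNm)
  have h2 : ∫⁻ ξ, N.indicator (fun _ => (1 : ENNReal)) (D.full n ξ, D.W (n + 1) ξ) ∂P = 0 := by
    rw [h1]
    refine (lintegral_congr fun ξ => ?_).trans lintegral_zero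
    refine (lintegral_congr fun w => ?_).trans lintegral_zero
    by_cases h : (D.full n ξ, w) ∈ N
    · rw [obsHist_eq, show D.e n (D.histOf n (D.full n ξ)) w γstar = 0 from h]
      simp
    · simp [h]
  have h3 := (lintegral_eq_zero_iff (((measurable_const (a := (1 : ENNReal))).indicator hNm).comp
    ((D.measurable_full n).prodMk (D.measurable_W (n + 1))))).1 h2
  filter_upwards [h3] with ξ hξ
  refine lt_of_le_of_ne (D.nonneg_e n _ _ γstar h_spec.1) fun h => ?_
  rw [Function.comp_apply, Set.indicator_of_mem (show (D.full n ξ, D.W (n + 1) ξ) ∈ N from h.symm)]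
    at hξ
  exact one_ne_zero hξ

end Model

namespace Model

/-! ### Inverse probability weights -/

variable {Ω 𝒰 𝒳 ℛ Ξ : Type*} [MeasurableSpace Ω] [MeasurableSpace 𝒰] [MeasurableSpace 𝒳]
  [MeasurableSpace ℛ] [MeasurableSpace Ξ] {p L K : ℕ} {D : Model Ω 𝒰 𝒳 ℛ Ξ p L K}
  {γstar : Param K} {h : Intervention Ω D.ν} {M : ℕ}

lemma measurable_ratio {γ : Param K} (hγ : γ ∈ D.Γ) (h : Intervention Ω D.ν) {n t : ℕ}
    (hn : n < t) : Measurable[D.fullSigma t] fun ξ =>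
      h.f (D.W (n + 1) ξ) / D.e n (D.obsHist n ξ) (D.W (n + 1) ξ) γ := by
  refine Measurable.div (h.measurable_f.comp (D.measurable_W_fullSigma hn)) ?_
  exact (D.measurable_e n γ hγ).comp
    ((D.measurable_obsHist_fullSigma hn.le).prodMk (D.measurable_W_fullSigma hn))

lemma measurable_rho {γ : Param K} (hγ : γ ∈ D.Γ) (h : Intervention Ω D.ν) (M t : ℕ) :
    Measurable[D.fullSigma t] fun ξ => D.rho M h t ξ γ :=
  Finset.measurable_prod _ fun _ hn => measurable_ratio hγ h (Finset.mem_Ico.1 hn).2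

lemma ratio_nonneg {γ : Param K} (hγ : γ ∈ D.Γ) (h : Intervention Ω D.ν) (n : ℕ) (ξ : Ξ) :
    0 ≤ h.f (D.W (n + 1) ξ) / D.e n (D.obsHist n ξ) (D.W (n + 1) ξ) γ :=
  div_nonneg (h.nonneg_f _) (D.nonneg_e _ _ _ _ hγ)

lemma rho_nonneg {γ : Param K} (hγ : γ ∈ D.Γ) (h : Intervention Ω D.ν) (M t : ℕ) (ξ : Ξ) :
    0 ≤ D.rho M h t ξ γ := Finset.prod_nonneg fun n _ => ratio_nonneg hγ h n ξ

/-- Each factor is zero or at most δ⁻¹ by overlap, and for t ≥ M the product has exactly M factors.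
-/
lemma exists_rho_le (hγ : γstar ∈ D.Γ) (ho : D.Overlap γstar h) (M : ℕ) :
    ∃ C : ℝ, 0 ≤ C ∧ ∀ t, M ≤ t → ∀ ξ, D.rho M h t ξ γstar ≤ C := by
  obtain ⟨δ, hδ, hover⟩ := ho
  refine ⟨δ⁻¹ ^ M, by positivity, fun t ht ξ => ?_⟩
  have hcard : (Finset.Ico (t - M) t).card = M := by rw [Nat.card_Ico]; omega
  calc D.rho M h t ξ γstar ≤ ∏ _n ∈ Finset.Ico (t - M) t, δ⁻¹ := by
        refine Finset.prod_le_prod (fun n _ => ratio_nonneg hγ h n ξ) fun n _ => ?_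
        rcases (h.nonneg_f (D.W (n + 1) ξ)).eq_or_lt with h0 | h0
        · rw [← h0, zero_div]
          positivity
        · have h1 := hover n ξ _ h0
          have h2 : 0 < D.e n (D.obsHist n ξ) (D.W (n + 1) ξ) γstar := lt_trans (by positivity) h1
          rw [div_le_iff₀ h2, ← div_eq_inv_mul, le_div_iff₀ hδ, mul_comm]
          exact h1.le
    _ = δ⁻¹ ^ M := by rw [Finset.prod_const, hcard]

variable {P : Measure Ξ} [IsProbabilityMeasure P]

/-- Weighting by the inverse propensity scores over `k` periods amounts to replacing the treatments
of these periods by independent draws from the intervention. -/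
lemma lintegral_prod_ratio_mul (h_unconf : D.Unconfounded P)
    (h_spec : D.CorrectlySpecified P γstar) (ho : D.Overlap γstar h) (m k : ℕ)
    {g : 𝒰 × (Fin (m + k) → PointPattern Ω) → ENNReal} (hg : Measurable g) :
    ∫⁻ ξ, (∏ n ∈ Finset.Ico m (m + k), ENNReal.ofReal
        (h.f (D.W (n + 1) ξ) / D.e n (D.obsHist n ξ) (D.W (n + 1) ξ) γstar)) *
          g (D.full (m + k) ξ) ∂P =
      ∫⁻ ξ, ∫⁻ w, g (D.U ξ, Fin.append (D.path m ξ) w)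
        ∂(Measure.pi fun _ : Fin k => h.dist) ∂P := by
  induction k with
  | zero =>
    refine lintegral_congr fun ξ => ?_
    have : ∀ w : Fin 0 → PointPattern Ω, Fin.append (D.path m ξ) w = D.path (m + 0) ξ := by
      intro w
      rw [Subsingleton.elim w Fin.elim0, Fin.append_elim0]
      rfl
    simp only [this]
    simp [full]
  | succ k ih =>
    have hγ := h_spec.1
    have := D.sigmaFinite_ν
    set wt : ℕ → Ξ → ENNReal := fun n ξ => ENNReal.ofReal
      (h.f (D.W (n + 1) ξ) / D.e n (D.obsHist n ξ) (D.W (n + 1) ξ) γstar) with hwt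
    have hprod : Measurable[D.fullSigma (m + k)] fun ξ => ∏ n ∈ Finset.Ico m (m + k), wt n ξ :=
      Finset.measurable_prod _ fun n hn =>
        (measurable_ratio hγ h (Finset.mem_Ico.1 hn).2).ennreal_ofReal
    -- The earlier weights are determined by the complete history before the last treatment, so they
    -- are constant while that treatment is integrated out.
    obtain ⟨R, hR, hReq⟩ := hprod.exists_eq_measurable_comp
    have hReq' : ∀ ξ, ∏ n ∈ Finset.Ico m (m + k), wt n ξ = R (D.full (m + k) ξ) :=
      fun ξ => congrFun hReq ξ
    have hsn : Measurable fun q : (𝒰 × (Fin (m + k) → PointPattern Ω)) × PointPattern Ω =>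
        ((q.1.1, Fin.snoc q.1.2 q.2) : 𝒰 × (Fin (m + (k + 1)) → PointPattern Ω)) :=
      (measurable_fst.comp measurable_fst).prodMk
        ((measurable_snoc (m + k)).comp ((measurable_snd.comp measurable_fst).prodMk
          measurable_snd))
    set gs : (𝒰 × (Fin (m + k) → PointPattern Ω)) × PointPattern Ω → ENNReal :=
      fun q => g (q.1.1, Fin.snoc q.1.2 q.2) with hgs
    have hgsm : Measurable gs := hg.comp hsn
    set gt : 𝒰 × (Fin (m + k) → PointPattern Ω) → ENNReal :=
      fun q => ∫⁻ x, gs (q, x) ∂h.dist with hgt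
    have hgtm : Measurable gt := hgsm.lintegral_prod_right'
    set G : (𝒰 × (Fin (m + k) → PointPattern Ω)) × PointPattern Ω → ENNReal := fun q =>
      R q.1 * (ENNReal.ofReal (h.f q.2 / D.e (m + k) (D.histOf (m + k) q.1) q.2 γstar) * gs q)
      with hG
    have hGm : Measurable G := (hR.comp measurable_fst).mul
      ((((h.measurable_f.comp measurable_snd).div
        (D.measurable_e_hist hγ (m + k))).ennreal_ofReal).mul hgsm)
    have hfull : ∀ ξ, D.full (m + (k + 1)) ξ =
        (D.U ξ, Fin.snoc (D.path (m + k) ξ) (D.W (m + k + 1) ξ)) :=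
      fun ξ => Prod.ext rfl (D.path_succ (m + k) ξ)
    calc ∫⁻ ξ, (∏ n ∈ Finset.Ico m (m + (k + 1)), wt n ξ) * g (D.full (m + (k + 1)) ξ) ∂P
        = ∫⁻ ξ, G (D.full (m + k) ξ, D.W (m + k + 1) ξ) ∂P := by
          refine lintegral_congr fun ξ => ?_
          have h1 : ∏ n ∈ Finset.Ico m (m + (k + 1)), wt n ξ =
              R (D.full (m + k) ξ) * wt (m + k) ξ := by
            rw [← add_assoc, Finset.prod_Ico_succ_top (Nat.le_add_right m k), hReq']
          rw [h1, mul_assoc, hfull]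
          rfl
      _ = ∫⁻ ξ, R (D.full (m + k) ξ) * gt (D.full (m + k) ξ) ∂P := by
          rw [lintegral_full_treatment h_unconf h_spec (m + k) hGm]
          refine lintegral_congr fun ξ => ?_
          have h1 : ∀ w, ENNReal.ofReal (D.e (m + k) (D.obsHist (m + k) ξ) w γstar) *
              G (D.full (m + k) ξ, w) = R (D.full (m + k) ξ) *
                (ENNReal.ofReal (h.f w) * gs (D.full (m + k) ξ, w)) := by
            intro w
            simp only [hG]
            rw [mul_left_comm, ← mul_assoc (ENNReal.ofReal (D.e _ _ _ _)),
              ← ENNReal.ofReal_mul (D.nonneg_e _ _ _ _ hγ), obsHist_eq]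
            congr 3
            -- The cancellation e · (f / e) = f needs e ≠ 0. Where f vanishes both sides are zero,
            -- and where f is positive overlap makes e positive.
            rcases (h.nonneg_f w).eq_or_lt with h0 | h0
            · rw [← h0]
              simp
            · obtain ⟨δ, hδ, hover⟩ := ho
              have h2 : 0 < D.e (m + k) (D.histOf (m + k) (D.full (m + k) ξ)) w γstar :=
                lt_trans (by positivity) (hover (m + k) ξ w h0)
              rw [mul_div_cancel₀ _ h2.ne']
          simp only [h1]
          refine (lintegral_const_mul _ (h.measurable_f.ennreal_ofReal.mul
            (hgsm.comp measurable_prodMk_left))).trans ?_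
          congr 1
          simp only [hgt, Intervention.dist]
          exact (lintegral_withDensity_eq_lintegral_mul _ h.measurable_f.ennreal_ofReal
            (hgsm.comp measurable_prodMk_left)).symm
      _ = ∫⁻ ξ, ∫⁻ w, gt (D.U ξ, Fin.append (D.path m ξ) w)
            ∂(Measure.pi fun _ : Fin k => h.dist) ∂P := by
          -- After the last treatment is replaced by a draw from the intervention, the induction
          -- hypothesis applies to the integrated functional `gt`.
          rw [← ih hgtm]
          exact lintegral_congr fun ξ => by rw [hReq']
      _ = _ := by
          refine lintegral_congr fun ξ => ?_
          rw [lintegral_pi_succ h.dist k (g := fun w => g (D.U ξ, Fin.append (D.path m ξ) w))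
            (hg.comp (measurable_const.prodMk ((measurable_append m (k + 1)).comp
              measurable_prodMk_left)))]
          simp only [hgt, hgs, Fin.append_snoc]

/-- Conditional expectation of an inverse-probability weighted functional. -/
lemma condExp_rho_mul (h_unconf : D.Unconfounded P) (h_spec : D.CorrectlySpecified P γstar)
    (ho : D.Overlap γstar h) (m M : ℕ) {G : 𝒰 × (Fin (m + M) → PointPattern Ω) → ℝ}
    (hG : Measurable G) {C : ℝ} (hG0 : ∀ q, 0 ≤ G q) (hGC : ∀ q, G q ≤ C) :
    P[fun ξ => D.rho M h (m + M) ξ γstar * G (D.full (m + M) ξ) | D.fullSigma m] =ᵐ[P]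
      fun ξ => ∫ w, G (D.U ξ, Fin.append (D.path m ξ) w)
        ∂(Measure.pi fun _ : Fin M => h.dist) := by
  have hγ := h_spec.1
  obtain ⟨Cρ, hCρ0, hCρ⟩ := exists_rho_le hγ ho M
  set I : Ξ → ℝ := fun ξ => ∫ w, G (D.U ξ, Fin.append (D.path m ξ) w)
    ∂(Measure.pi fun _ : Fin M => h.dist) with hI
  have happ : Measurable fun q : (𝒰 × (Fin m → PointPattern Ω)) × (Fin M → PointPattern Ω) =>
      ((q.1.1, Fin.append q.1.2 q.2) : 𝒰 × (Fin (m + M) → PointPattern Ω)) :=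
    (measurable_fst.comp measurable_fst).prodMk ((measurable_append m M).comp
      ((measurable_snd.comp measurable_fst).prodMk measurable_snd))
  have hIm : StronglyMeasurable[D.fullSigma m] I := by
    have h1 : StronglyMeasurable fun q : 𝒰 × (Fin m → PointPattern Ω) =>
        ∫ w, G (q.1, Fin.append q.2 w) ∂(Measure.pi fun _ : Fin M => h.dist) :=
      (hG.comp happ).stronglyMeasurable.integral_prod_right'
    exact h1.comp_measurable (D.measurable_full_fullSigma m)
  have hGi : ∀ ξ, Integrable (fun w => G (D.U ξ, Fin.append (D.path m ξ) w))
      (Measure.pi fun _ : Fin M => h.dist) := by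
    intro ξ
    refine Integrable.of_bound ((hG.comp (measurable_const.prodMk ((measurable_append m M).comp
      measurable_prodMk_left))).aestronglyMeasurable) C (Eventually.of_forall fun w => ?_)
    rw [Real.norm_of_nonneg (hG0 _)]
    exact hGC _
  have hI0 : ∀ ξ, 0 ≤ I ξ := fun ξ => integral_nonneg fun w => hG0 _
  have hIC : ∀ ξ, I ξ ≤ C := by
    intro ξ
    calc I ξ ≤ ∫ _, C ∂(Measure.pi fun _ : Fin M => h.dist) :=
          integral_mono (hGi ξ) (integrable_const _) fun w => hGC _
      _ = C := by simp
  have hIi : Integrable I P :=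
    Integrable.of_bound (hIm.mono (D.fullSigma_le m)).aestronglyMeasurable C
      (Eventually.of_forall fun ξ => by rw [Real.norm_of_nonneg (hI0 ξ)]; exact hIC ξ)
  have hfm : Measurable fun ξ => D.rho M h (m + M) ξ γstar * G (D.full (m + M) ξ) :=
    ((measurable_rho hγ h M (m + M)).mono (D.fullSigma_le _) le_rfl).mul
      (hG.comp (D.measurable_full _))
  have hf0 : ∀ ξ, 0 ≤ D.rho M h (m + M) ξ γstar * G (D.full (m + M) ξ) := fun ξ =>
    mul_nonneg (rho_nonneg hγ h M _ ξ) (hG0 _)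
  have hfi : Integrable (fun ξ => D.rho M h (m + M) ξ γstar * G (D.full (m + M) ξ)) P := by
    refine Integrable.of_bound hfm.aestronglyMeasurable (Cρ * C)
      (Eventually.of_forall fun ξ => ?_)
    rw [Real.norm_of_nonneg (hf0 ξ)]
    exact mul_le_mul (hCρ _ (by omega) ξ) (hGC _) (hG0 _) hCρ0
  refine (ae_eq_condExp_of_forall_setIntegral_eq (D.fullSigma_le m) hfi
    (fun _ _ _ => hIi.integrableOn) (fun A hA _ => ?_) hIm.aestronglyMeasurable).symm
  have hA0 : MeasurableSet A := D.fullSigma_le m _ hA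
  obtain ⟨s, hs, rfl⟩ := hA
  replace hA0 : MeasurableSet (D.full m ⁻¹' s) := hA0
  change ∫ ξ in D.full m ⁻¹' s, I ξ ∂P = ∫ ξ in D.full m ⁻¹' s,
    D.rho M h (m + M) ξ γstar * G (D.full (m + M) ξ) ∂P
  -- The test event depends on the first m treatments only, so its indicator joins the functional
  -- and is unaffected when the last M treatments are replaced.
  set g : 𝒰 × (Fin (m + M) → PointPattern Ω) → ENNReal := fun q =>
    s.indicator (fun _ => 1) (q.1, fun j : Fin m => q.2 (Fin.castAdd M j)) *
      ENNReal.ofReal (G q) with hg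
  have hgm : Measurable g := by
    refine Measurable.mul (Measurable.comp (measurable_const.indicator hs) ?_) hG.ennreal_ofReal
    exact measurable_fst.prodMk (measurable_pi_iff.2 fun j =>
      (measurable_pi_apply _).comp measurable_snd)
  have key := lintegral_prod_ratio_mul h_unconf h_spec ho m M hgm
  have hl : ∫⁻ ξ, (∏ n ∈ Finset.Ico m (m + M), ENNReal.ofReal
        (h.f (D.W (n + 1) ξ) / D.e n (D.obsHist n ξ) (D.W (n + 1) ξ) γstar)) *
          g (D.full (m + M) ξ) ∂P =
      ∫⁻ ξ in D.full m ⁻¹' s,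
        ENNReal.ofReal (D.rho M h (m + M) ξ γstar * G (D.full (m + M) ξ)) ∂P := by
    rw [← lintegral_indicator hA0]
    refine lintegral_congr fun ξ => ?_
    rw [← ENNReal.ofReal_prod_of_nonneg fun n _ => ratio_nonneg hγ h n ξ]
    have hρ : ∏ n ∈ Finset.Ico m (m + M),
        h.f (D.W (n + 1) ξ) / D.e n (D.obsHist n ξ) (D.W (n + 1) ξ) γstar =
        D.rho M h (m + M) ξ γstar := by
      rw [rho, Nat.add_sub_cancel]
    rw [hρ]
    by_cases hξ : D.full m ξ ∈ s
    · have h1 : g (D.full (m + M) ξ) = ENNReal.ofReal (G (D.full (m + M) ξ)) := by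
        change s.indicator (fun _ => 1) (D.full m ξ) * _ = _
        rw [Set.indicator_of_mem hξ, one_mul]
      rw [h1, Set.indicator_of_mem (show ξ ∈ D.full m ⁻¹' s from hξ),
        ENNReal.ofReal_mul (rho_nonneg hγ h M _ ξ)]
    · have h1 : g (D.full (m + M) ξ) = 0 := by
        change s.indicator (fun _ => 1) (D.full m ξ) * _ = _
        rw [Set.indicator_of_notMem hξ, zero_mul]
      rw [h1, Set.indicator_of_notMem (show ξ ∉ D.full m ⁻¹' s from hξ), mul_zero]
  have hr : ∫⁻ ξ, ∫⁻ w, g (D.U ξ, Fin.append (D.path m ξ) w)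
        ∂(Measure.pi fun _ : Fin M => h.dist) ∂P =
      ∫⁻ ξ in D.full m ⁻¹' s, ENNReal.ofReal (I ξ) ∂P := by
    rw [← lintegral_indicator hA0]
    refine lintegral_congr fun ξ => ?_
    have h0 : ∀ w : Fin M → PointPattern Ω, g (D.U ξ, Fin.append (D.path m ξ) w) =
        s.indicator (fun _ => 1) (D.full m ξ) *
          ENNReal.ofReal (G (D.U ξ, Fin.append (D.path m ξ) w)) := by
      intro w
      simp only [hg, Fin.append_left]
      rfl
    simp only [h0]
    by_cases hξ : D.full m ξ ∈ s
    · rw [Set.indicator_of_mem (show ξ ∈ D.full m ⁻¹' s from hξ)]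
      simp only [Set.indicator_of_mem hξ, one_mul]
      exact (ofReal_integral_eq_lintegral_ofReal (hGi ξ)
        (Eventually.of_forall fun w => hG0 _)).symm
    · rw [Set.indicator_of_notMem (show ξ ∉ D.full m ⁻¹' s from hξ)]
      simp only [Set.indicator_of_notMem hξ, zero_mul, lintegral_zero]
  rw [hl, hr] at key
  rw [integral_eq_lintegral_of_nonneg_ae (Eventually.of_forall hI0)
      (hIm.mono (D.fullSigma_le m)).aestronglyMeasurable,
    integral_eq_lintegral_of_nonneg_ae (Eventually.of_forall hf0) hfm.aestronglyMeasurable, key]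

end Model

/-! ### Entrywise bounds and measurability for matrix inverses -/

section MatrixBounds

variable {Ξ : Type*} {m : MeasurableSpace Ξ} {n : Type*} [Fintype n]

lemma abs_mul_apply_le {l o : Type*} {A : Matrix l n ℝ} {B : Matrix n o ℝ} {a b : ℝ}
    (hA : ∀ i j, |A i j| ≤ a) (hB : ∀ i j, |B i j| ≤ b) (i : l) (j : o) :
    |(A * B) i j| ≤ Fintype.card n * (a * b) := by
  rw [Matrix.mul_apply]
  refine (Finset.abs_sum_le_sum_abs _ _).trans ?_
  refine (Finset.sum_le_card_nsmul _ _ (a * b) fun k _ => ?_).trans (by simp)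
  rw [abs_mul]
  exact mul_le_mul (hA _ _) (hB _ _) (abs_nonneg _) ((abs_nonneg _).trans (hA i k))

lemma abs_mulVec_apply_le {l : Type*} {A : Matrix l n ℝ} {v : n → ℝ} {a b : ℝ}
    (hA : ∀ i j, |A i j| ≤ a) (hv : ∀ i, |v i| ≤ b) (i : l) :
    |A.mulVec v i| ≤ Fintype.card n * (a * b) := by
  rw [Matrix.mulVec, dotProduct]
  refine (Finset.abs_sum_le_sum_abs _ _).trans ?_
  refine (Finset.sum_le_card_nsmul _ _ (a * b) fun k _ => ?_).trans (by simp)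
  rw [abs_mul]
  exact mul_le_mul (hA _ _) (hv _) (abs_nonneg _) ((abs_nonneg _).trans (hA i k))

variable [DecidableEq n]

lemma measurable_det {f : Ξ → Matrix n n ℝ} (hf : ∀ i j, Measurable fun ξ => f ξ i j) :
    Measurable fun ξ => (f ξ).det := by
  simp only [Matrix.det_apply]
  refine Finset.measurable_sum _ fun σ _ => ?_
  exact (Finset.measurable_prod _ fun i _ => hf _ _).const_smul _

/-- By Cramer's rule every entry of the inverse is a quotient of determinants, also for singular
matrices under the convention 0⁻¹ = 0. -/
lemma measurable_inv_apply {f : Ξ → Matrix n n ℝ} (hf : ∀ i j, Measurable fun ξ => f ξ i j)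
    (i j : n) : Measurable fun ξ => (f ξ)⁻¹ i j := by
  simp only [Matrix.inv_def, Ring.inverse_eq_inv', Matrix.smul_apply, smul_eq_mul,
    Matrix.adjugate_apply]
  refine (measurable_det hf).inv.mul (measurable_det fun i' j' => ?_)
  simp only [Matrix.updateRow_apply]
  split_ifs
  · exact measurable_const
  · exact hf _ _

/-- Cramer's rule together with the Leibniz bound on the cofactor determinant. The maximum with 1
accounts for the row replaced by a unit vector. -/
lemma abs_inv_apply_le {A : Matrix n n ℝ} {B c : ℝ} (hB : ∀ i j, |A i j| ≤ B) (hc : 0 < c)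
    (hdet : c ≤ A.det) (i j : n) :
    |A⁻¹ i j| ≤ c⁻¹ * ((Fintype.card n).factorial * (max B 1) ^ Fintype.card n) := by
  rw [Matrix.inv_def, Ring.inverse_eq_inv', Matrix.smul_apply, smul_eq_mul, abs_mul,
    Matrix.adjugate_apply]
  have h1 : |(A.updateRow j (Pi.single i 1)).det| ≤
      (Fintype.card n).factorial • (max B 1) ^ Fintype.card n := by
    refine Matrix.det_le (abv := AbsoluteValue.abs) fun i' j' => ?_
    rw [Matrix.updateRow_apply]
    split_ifs
    · rcases eq_or_ne j' i with h | h
      · subst h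
        simp
      · simp [Pi.single_eq_of_ne h]
    · exact (hB _ _).trans (le_max_left _ _)
  rw [nsmul_eq_mul] at h1
  have h2 : |A.det⁻¹| ≤ c⁻¹ := by
    rw [abs_of_pos (inv_pos.2 (hc.trans_le hdet))]
    exact inv_anti₀ hc hdet
  exact mul_le_mul h2 h1 (abs_nonneg _) (by positivity)

end MatrixBounds

/-! ### Boundedness and conditional mean of the weighted outcomes -/

namespace Model

variable {Ω 𝒰 𝒳 ℛ Ξ : Type*} [MeasurableSpace Ω] [MeasurableSpace 𝒰] [MeasurableSpace 𝒳]
  [MeasurableSpace ℛ] [MeasurableSpace Ξ] {p L K : ℕ} {D : Model Ω 𝒰 𝒳 ℛ Ξ p L K}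
  {γstar : Param K} {h h' h'' : Intervention Ω D.ν} {M : ℕ}

/-- The moderators belong to period t - M + 1, and its covariates are determined by the treatments
up to t - M. The regression operator is therefore known before the M intervention periods and can be
pulled out of the conditional expectation. -/
lemma measurable_proj (M t : ℕ) (l : Fin L) (i : Fin p) :
    Measurable[D.fullSigma (t - M)] fun ξ => D.proj M t ξ l i := by
  have hZ : ∀ i l, Measurable[D.fullSigma (t - M)] fun ξ => D.Z M t ξ i l := fun i l =>
    (D.measurable_z l).comp ((D.measurable_moderator i).comp (D.measurable_obsX_fullSigma le_rfl))
  simp only [proj, Matrix.mul_apply, Matrix.transpose_apply]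
  refine Finset.measurable_sum _ fun k _ => Measurable.mul ?_ (hZ _ _)
  refine measurable_inv_apply (fun a b => ?_) _ _
  simp only [Matrix.mul_apply, Matrix.transpose_apply]
  exact Finset.measurable_sum _ fun k _ => (hZ _ _).mul (hZ _ _)

lemma measurable_obsCount (t : ℕ) (i : Fin p) :
    Measurable[D.fullSigma t] fun ξ => D.obsCount t ξ i :=
  (measurable_from_top (f := fun n : ℕ => (n : ℝ))).comp
    ((measurable_count (D.measurableSet_pixel i)).comp D.measurable_obsY_fullSigma)

variable {P : Measure Ξ}

lemma exists_abs_proj_le (hipw : D.IPWRegular P M h' h'' γstar) :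
    ∃ C : ℝ, 0 ≤ C ∧ ∀ t, M ≤ t → ∀ ξ l i, |D.proj M t ξ l i| ≤ C := by
  obtain ⟨-, ⟨δz, hδz⟩, ⟨c, hc, hdet⟩, -⟩ := hipw
  set z : ℝ := max δz 0 with hz
  have hz0 : 0 ≤ z := le_max_right _ _
  have hZ : ∀ t ξ i l, |D.Z M t ξ i l| ≤ z := fun t ξ i l =>
    (hδz (t - M) _ _ i l).le.trans (le_max_left _ _)
  have hZt : ∀ t ξ l i, |(D.Z M t ξ).transpose l i| ≤ z := fun t ξ l i => hZ t ξ i l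
  refine ⟨_, ?_, fun t ht ξ l i => abs_mul_apply_le
    (abs_inv_apply_le (abs_mul_apply_le (hZt t ξ) (hZ t ξ)) hc (hdet t ht ξ))
    (hZt t ξ) l i⟩
  positivity

lemma exists_count_le (hipw : D.IPWRegular P M h' h'' γstar) :
    ∃ C : ℝ, 0 ≤ C ∧ ∀ t, 1 ≤ t → ∀ u w i, (count (D.pixel i) (D.Y t u w) : ℝ) ≤ C := by
  obtain ⟨⟨δ, hδ⟩, -⟩ := hipw
  refine ⟨max δ 0, le_max_right _ _, fun t ht u w i => ?_⟩
  refine le_trans ?_ ((hδ t ht u w).le.trans (le_max_left _ _))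
  exact_mod_cast count_le_count_univ _ _

/-- The conditional mean `(β', β'', 1, 1)` of `A_t`. -/
noncomputable def meanVec (D : Model Ω 𝒰 𝒳 ℛ Ξ p L K) (M : ℕ) (h' h'' : Intervention Ω D.ν)
    (t : ℕ) (ξ : Ξ) : AIdx L → ℝ :=
  Sum.elim (Sum.elim (D.beta M h' t ξ) (D.beta M h'' t ξ)) ![1, 1]

lemma measurable_A {γ : Param K} (hγ : γ ∈ D.Γ) (h' h'' : Intervention Ω D.ν) (M t : ℕ)
    (i : AIdx L) : Measurable[D.fullSigma t] fun ξ => D.A M h' h'' t γ ξ i := by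
  have hmul : ∀ (h : Intervention Ω D.ν) (l : Fin L), Measurable[D.fullSigma t]
      fun ξ => (D.proj M t ξ).mulVec (D.pseudo M h t ξ γ) l := by
    intro h l
    simp only [Matrix.mulVec, dotProduct, pseudo, Pi.smul_apply, smul_eq_mul]
    refine Finset.measurable_sum _ fun i _ => Measurable.mul ?_
      ((measurable_rho hγ h M t).mul (measurable_obsCount t i))
    exact (measurable_proj M t l i).mono (D.fullSigma_mono (Nat.sub_le _ _)) le_rfl
  rcases i with (l | l) | b
  · exact hmul h' l
  · exact hmul h'' l
  · fin_cases b
    · exact measurable_rho hγ h' M t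
    · exact measurable_rho hγ h'' M t

lemma exists_abs_A_le (hM : 1 ≤ M) (hγ : γstar ∈ D.Γ) (ho' : D.Overlap γstar h')
    (ho'' : D.Overlap γstar h'') (hipw : D.IPWRegular P M h' h'' γstar) :
    ∃ C : ℝ, 0 ≤ C ∧ ∀ t, M ≤ t → ∀ ξ i, |D.A M h' h'' t γstar ξ i| ≤ C := by
  obtain ⟨B, hB0, hB⟩ := exists_abs_proj_le hipw
  obtain ⟨N, hN0, hN⟩ := exists_count_le hipw
  obtain ⟨R', hR'0, hR'⟩ := exists_rho_le hγ ho' M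
  obtain ⟨R'', hR''0, hR''⟩ := exists_rho_le hγ ho'' M
  set R := max R' R'' with hR
  have hR0 : 0 ≤ R := hR'0.trans (le_max_left _ _)
  have hmul : ∀ h : Intervention Ω D.ν, (∀ t, M ≤ t → ∀ ξ, D.rho M h t ξ γstar ≤ R) →
      ∀ t, M ≤ t → ∀ ξ l,
        |(D.proj M t ξ).mulVec (D.pseudo M h t ξ γstar) l| ≤ (Fintype.card (Fin p)) *
          (B * (R * N)) := by
    intro h hh t ht ξ l
    refine abs_mulVec_apply_le (hB t ht ξ) (fun i => ?_) l
    simp only [pseudo, Pi.smul_apply, smul_eq_mul, obsCount]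
    rw [abs_mul, abs_of_nonneg (rho_nonneg hγ h M t ξ), Nat.abs_cast]
    exact mul_le_mul (hh t ht ξ) (hN t (hM.trans ht) _ _ i) (Nat.cast_nonneg _) hR0
  have h1 : ∀ t, M ≤ t → ∀ ξ, D.rho M h' t ξ γstar ≤ R := fun t ht ξ =>
    (hR' t ht ξ).trans (le_max_left _ _)
  have h2 : ∀ t, M ≤ t → ∀ ξ, D.rho M h'' t ξ γstar ≤ R := fun t ht ξ =>
    (hR'' t ht ξ).trans (le_max_right _ _)
  refine ⟨(Fintype.card (Fin p)) * (B * (R * N)) + R, by positivity, fun t ht ξ i => ?_⟩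
  have h3 : (0 : ℝ) ≤ (Fintype.card (Fin p)) * (B * (R * N)) := by positivity
  rcases i with (l | l) | b
  · exact (hmul h' h1 t ht ξ l).trans (by linarith)
  · exact (hmul h'' h2 t ht ξ l).trans (by linarith)
  · fin_cases b
    · exact (abs_of_nonneg (rho_nonneg hγ h' M t ξ)).le.trans (by linarith [h1 t ht ξ])
    · exact (abs_of_nonneg (rho_nonneg hγ h'' M t ξ)).le.trans (by linarith [h2 t ht ξ])

/-- Expected counts average bounded counts under a probability measure, so one constant serves all
interventions. -/
lemma exists_abs_beta_le (hM : 1 ≤ M) (hipw : D.IPWRegular P M h' h'' γstar) :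
    ∃ C : ℝ, 0 ≤ C ∧ ∀ (h : Intervention Ω D.ν) t, M ≤ t → ∀ ξ l, |D.beta M h t ξ l| ≤ C := by
  obtain ⟨B, hB0, hB⟩ := exists_abs_proj_le hipw
  obtain ⟨N, hN0, hN⟩ := exists_count_le hipw
  refine ⟨(Fintype.card (Fin p)) * (B * N), by positivity, fun h t ht ξ l =>
    abs_mulVec_apply_le (hB t ht ξ) (fun i => ?_) l⟩
  have h1 : ‖D.expCount M h t ξ i‖ ≤ N * (Measure.pi fun _ : Fin M => h.dist).real Set.univ :=
    norm_integral_le_of_norm_le_const (Eventually.of_forall fun w => by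
      rw [Real.norm_of_nonneg (Nat.cast_nonneg _)]
      exact hN t (hM.trans ht) _ _ i)
  simpa using h1

variable [IsProbabilityMeasure P]

lemma pathWith_eq_append (m M : ℕ) (ξ : Ξ) (w : Fin M → PointPattern Ω) :
    D.pathWith M (m + M) ξ w = Fin.append (D.path m ξ) w := by
  ext1 j
  induction j using Fin.addCases with
  | left j => simp [pathWith, path]
  | right j => simp [pathWith]

/-- The weighted outcomes are conditionally unbiased. -/
lemma condExp_A (hM : 1 ≤ M) (h_unconf : D.Unconfounded P) (h_spec : D.CorrectlySpecified P γstar)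
    (ho' : D.Overlap γstar h') (ho'' : D.Overlap γstar h'')
    (hipw : D.IPWRegular P M h' h'' γstar) {t : ℕ} (ht : M ≤ t) (i : AIdx L) :
    P[fun ξ => D.A M h' h'' t γstar ξ i | D.fullSigma (t - M)] =ᵐ[P]
      fun ξ => D.meanVec M h' h'' t ξ i := by
  -- Writing t = m + M removes the truncated subtraction, so that the path splits exactly into m
  -- observed and M replaced treatments.
  obtain ⟨m, rfl⟩ : ∃ m, t = m + M := ⟨t - M, by omega⟩
  have hγ := h_spec.1
  obtain ⟨N, hN0, hN⟩ := exists_count_le hipw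
  obtain ⟨B, hB0, hB⟩ := exists_abs_proj_le hipw
  have hρ : ∀ h : Intervention Ω D.ν, D.Overlap γstar h →
      P[fun ξ => D.rho M h (m + M) ξ γstar | D.fullSigma (m + M - M)] =ᵐ[P] fun _ => 1 := by
    intro h ho
    have h1 := condExp_rho_mul h_unconf h_spec ho m M (G := fun _ => 1) measurable_const (C := 1)
      (fun _ => zero_le_one) (fun _ => le_rfl)
    rw [Nat.add_sub_cancel]
    simpa using h1
  have hy : ∀ h : Intervention Ω D.ν, D.Overlap γstar h → ∀ i : Fin p,
      P[fun ξ => D.rho M h (m + M) ξ γstar * D.obsCount (m + M) ξ i | D.fullSigma (m + M - M)]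
        =ᵐ[P] fun ξ => D.expCount M h (m + M) ξ i := by
    intro h ho i
    have h1 := condExp_rho_mul h_unconf h_spec ho m M
      (G := fun q => (count (D.pixel i) (D.Y (m + M) q.1 q.2) : ℝ))
      ((measurable_from_top (f := fun n : ℕ => (n : ℝ))).comp
        ((measurable_count (D.measurableSet_pixel i)).comp (D.measurable_Y (m + M)))) (C := N)
      (fun _ => Nat.cast_nonneg _) (fun q => hN (m + M) (by omega) _ _ i)
    rw [Nat.add_sub_cancel]
    refine h1.trans (Eventually.of_forall fun ξ => ?_)
    simp only [expCount, pathWith_eq_append]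
  have hmul : ∀ h : Intervention Ω D.ν, D.Overlap γstar h → ∀ l : Fin L,
      P[fun ξ => (D.proj M (m + M) ξ).mulVec (D.pseudo M h (m + M) ξ γstar) l |
        D.fullSigma (m + M - M)] =ᵐ[P] fun ξ => D.beta M h (m + M) ξ l := by
    intro h ho l
    obtain ⟨R, hR0, hR⟩ := exists_rho_le hγ ho M
    have hfi : ∀ i : Fin p, Integrable
        (fun ξ => D.rho M h (m + M) ξ γstar * D.obsCount (m + M) ξ i) P := by
      intro i
      refine Integrable.of_bound ((((measurable_rho hγ h M (m + M)).mul
        (measurable_obsCount (m + M) i)).mono (D.fullSigma_le _) le_rfl).aestronglyMeasurable)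
        (R * N) (Eventually.of_forall fun ξ => ?_)
      rw [norm_mul, Real.norm_of_nonneg (rho_nonneg hγ h M _ ξ),
        Real.norm_of_nonneg (show 0 ≤ D.obsCount (m + M) ξ i from Nat.cast_nonneg _)]
      exact mul_le_mul (hR _ (by omega) ξ) (hN _ (by omega) _ _ i) (Nat.cast_nonneg _) hR0
    have hpm : ∀ i, StronglyMeasurable[D.fullSigma (m + M - M)]
        fun ξ => D.proj M (m + M) ξ l i := fun i =>
      (measurable_proj M (m + M) l i).stronglyMeasurable
    have hgi : ∀ i : Fin p, Integrable ((fun ξ => D.proj M (m + M) ξ l i) *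
        (fun ξ => D.rho M h (m + M) ξ γstar * D.obsCount (m + M) ξ i)) P := fun i =>
      (hfi i).bdd_mul ((hpm i).mono (D.fullSigma_le _)).aestronglyMeasurable (c := B)
        (Eventually.of_forall fun ξ => hB _ (by omega) ξ l i)
    have h1 : (fun ξ => (D.proj M (m + M) ξ).mulVec (D.pseudo M h (m + M) ξ γstar) l) =
        ∑ i, (fun ξ => D.proj M (m + M) ξ l i) *
          (fun ξ => D.rho M h (m + M) ξ γstar * D.obsCount (m + M) ξ i) := by
      ext ξ
      simp [Matrix.mulVec, dotProduct, pseudo]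
    rw [h1]
    have h2 := condExp_finsetSum (s := Finset.univ) (fun i _ => hgi i) (D.fullSigma (m + M - M))
    -- The coefficients are known at time t - M and bounded, so they factor out and only the
    -- weighted counts are averaged.
    have h3 : ∀ᵐ ξ ∂P, ∀ i, (P[(fun ξ => D.proj M (m + M) ξ l i) *
          (fun ξ => D.rho M h (m + M) ξ γstar * D.obsCount (m + M) ξ i) |
            D.fullSigma (m + M - M)]) ξ =
        D.proj M (m + M) ξ l i * D.expCount M h (m + M) ξ i := by
      refine ae_all_iff.2 fun i => ?_
      filter_upwards [condExp_mul_of_stronglyMeasurable_left (hpm i) (hgi i) (hfi i), hy h ho i]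
        with ξ h4 h5
      rw [h4, Pi.mul_apply, h5]
    filter_upwards [h2, h3] with ξ h4 h5
    rw [h4, Finset.sum_apply]
    simp only [h5]
    rfl
  rcases i with (l | l) | b
  · exact hmul h' ho' l
  · exact hmul h'' ho'' l
  · fin_cases b
    · exact hρ h' ho'
    · exact hρ h'' ho''

end Model

/-! ### Taylor expansion of the log-likelihood -/

section Taylor

/-- The mean value inequality is applied successively to `φ₂`, to `φ₁` minus its linear part and to
`φ` minus its quadratic part. On the unit interval each integration preserves the bound B; sharper
constants are not needed. -/
lemma taylor_unit_interval {φ φ₁ φ₂ φ₃ : ℝ → ℝ} {B : ℝ}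
    (h0 : ∀ s ∈ Set.Icc (0 : ℝ) 1, HasDerivAt φ (φ₁ s) s)
    (h1 : ∀ s ∈ Set.Icc (0 : ℝ) 1, HasDerivAt φ₁ (φ₂ s) s)
    (h2 : ∀ s ∈ Set.Icc (0 : ℝ) 1, HasDerivAt φ₂ (φ₃ s) s)
    (h3 : ∀ s ∈ Set.Icc (0 : ℝ) 1, |φ₃ s| ≤ B) :
    |φ₁ 1 - φ₁ 0 - φ₂ 0| ≤ B ∧ |φ 1 - φ 0 - φ₁ 0 - φ₂ 0 / 2| ≤ B := by
  have hB : 0 ≤ B := (abs_nonneg _).trans (h3 0 (by simp))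
  have mv : ∀ {f f' : ℝ → ℝ}, (∀ s ∈ Set.Icc (0 : ℝ) 1, HasDerivAt f (f' s) s) →
      (∀ s ∈ Set.Icc (0 : ℝ) 1, |f' s| ≤ B) → ∀ s ∈ Set.Icc (0 : ℝ) 1, |f s - f 0| ≤ B := by
    intro f f' hf hf' s hs
    have h := (convex_Icc (0 : ℝ) 1).norm_image_sub_le_of_norm_hasDerivWithin_le
      (fun x hx => (hf x hx).hasDerivWithinAt) hf' (x := 0) (y := s) (by simp) hs
    rw [sub_zero, Real.norm_eq_abs, Real.norm_of_nonneg hs.1] at h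
    exact h.trans (mul_le_of_le_one_right hB hs.2)
  have e2 := mv h2 h3
  have e1 : ∀ s ∈ Set.Icc (0 : ℝ) 1, |φ₁ s - φ₁ 0 - s * φ₂ 0| ≤ B := by
    intro s hs
    have h := mv (f := fun s => φ₁ s - s * φ₂ 0) (f' := fun s => φ₂ s - φ₂ 0)
      (fun s hs => by
        simpa using (h1 s hs).fun_sub ((hasDerivAt_id' s).mul_const (φ₂ 0))) e2 s hs
    simpa [sub_right_comm] using h
  have e0 := mv (f := fun s => φ s - s * φ₁ 0 - s ^ 2 * (φ₂ 0 / 2))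
    (f' := fun s => φ₁ s - φ₁ 0 - s * φ₂ 0) (fun s hs => by
      have hd := ((h0 s hs).fun_sub ((hasDerivAt_id' s).mul_const (φ₁ 0))).fun_sub
        ((hasDerivAt_pow 2 s).mul_const (φ₂ 0 / 2))
      refine hd.congr_deriv ?_
      norm_num
      ring) e1 1 (by simp)
  refine ⟨by simpa using e1 1 (by simp), ?_⟩
  convert e0 using 2
  ring

variable {K : ℕ}

lemma fderiv_apply_eq_sum_partialDeriv (F : Param K → ℝ) (γ v : Param K) :
    fderiv ℝ F γ v = ∑ k, v k * partialDeriv k F γ := by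
  have hv : v = ∑ k, v k • (EuclideanSpace.single k (1 : ℝ) : Param K) := by
    ext i
    simp [Finset.sum_apply, Pi.single_apply]
  conv_lhs => rw [hv]
  simp [partialDeriv, map_sum]

lemma hasDerivAt_line {F : Param K → ℝ} {γ v : Param K} {s : ℝ}
    (hF : DifferentiableAt ℝ F (γ + s • v)) :
    HasDerivAt (fun s : ℝ => F (γ + s • v)) (∑ k, v k * partialDeriv k F (γ + s • v)) s := by
  rw [← fderiv_apply_eq_sum_partialDeriv]
  have h1 : HasDerivAt (fun s : ℝ => γ + s • v) v s := by
    simpa using ((hasDerivAt_id s).smul_const v).const_add γ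
  exact hF.hasFDerivAt.comp_hasDerivAt s h1

/-- The linear form `v ↦ ∑ v_k a_k`. -/
def linForm (a : Fin K → ℝ) (v : Param K) : ℝ := ∑ k, v k * a k

/-- The quadratic form `v ↦ ∑ v_k v_j Q_kj`. -/
def quadForm (Q : Fin K → Fin K → ℝ) (v : Param K) : ℝ := ∑ k, ∑ j, v k * (v j * Q k j)

/-- The `ℓ¹` norm. -/
def l1Norm (v : Param K) : ℝ := ∑ k, |v k|

lemma l1Norm_nonneg (v : Param K) : 0 ≤ l1Norm v := Finset.sum_nonneg fun _ _ => abs_nonneg _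

lemma l1Norm_le (v : Param K) : l1Norm v ≤ K * ‖v‖ := by
  refine (Finset.sum_le_card_nsmul _ _ ‖v‖ fun k _ => ?_).trans (by simp)
  exact PiLp.norm_apply_le v k

lemma linForm_smul (a : Fin K → ℝ) (c : ℝ) (v : Param K) :
    linForm a (c • v) = c * linForm a v := by
  simp [linForm, Finset.mul_sum, mul_assoc]

lemma quadForm_smul (Q : Fin K → Fin K → ℝ) (c : ℝ) (v : Param K) :
    quadForm Q (c • v) = c ^ 2 * quadForm Q v := by
  simp only [quadForm, Finset.mul_sum, PiLp.smul_apply, smul_eq_mul]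
  exact Finset.sum_congr rfl fun k _ => Finset.sum_congr rfl fun j _ => by ring

lemma l1Norm_smul (c : ℝ) (v : Param K) : l1Norm (c • v) = |c| * l1Norm v := by
  simp [l1Norm, Finset.mul_sum, abs_mul]

lemma abs_quadForm_le {Q : Fin K → Fin K → ℝ} {B : ℝ} (hQ : ∀ k j, |Q k j| ≤ B) (v : Param K) :
    |quadForm Q v| ≤ B * l1Norm v ^ 2 := by
  calc |quadForm Q v| ≤ ∑ k, ∑ j, |v k| * (|v j| * B) := by
        refine (Finset.abs_sum_le_sum_abs _ _).trans (Finset.sum_le_sum fun k _ => ?_)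
        refine (Finset.abs_sum_le_sum_abs _ _).trans (Finset.sum_le_sum fun j _ => ?_)
        rw [abs_mul, abs_mul]
        exact mul_le_mul_of_nonneg_left (mul_le_mul_of_nonneg_left (hQ k j) (abs_nonneg _))
          (abs_nonneg _)
    _ = B * l1Norm v ^ 2 := by
        simp_rw [← Finset.mul_sum, ← Finset.sum_mul]
        rw [l1Norm]
        ring

/-- Third-order expansion of a function whose gradient `ψ` has second derivatives bounded by
`B` on a convex open set. -/
lemma taylor_of_gradient {S : Set (Param K)} (hS : IsOpen S) (hSc : Convex ℝ S)
    {ℓ : Param K → ℝ} {ψ : Param K → Fin K → ℝ}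
    (hℓ : ∀ γ ∈ S, DifferentiableAt ℝ ℓ γ) (hψ : ∀ γ ∈ S, ∀ k, partialDeriv k ℓ γ = ψ γ k)
    (hψ2 : ∀ k, ContDiffOn ℝ 2 (fun γ => ψ γ k) S) {B : ℝ}
    (hB : ∀ γ ∈ S, ∀ k j l, |partialDeriv l (partialDeriv j fun γ' => ψ γ' k) γ| ≤ B)
    {γ₀ v : Param K} (hγ₀ : γ₀ ∈ S) (hv : γ₀ + v ∈ S) :
    |linForm (ψ (γ₀ + v)) v - linForm (ψ γ₀) v -
        quadForm (fun k j => partialDeriv j (fun γ' => ψ γ' k) γ₀) v| ≤ B * l1Norm v ^ 3 ∧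
    |ℓ (γ₀ + v) - ℓ γ₀ - linForm (ψ γ₀) v -
        quadForm (fun k j => partialDeriv j (fun γ' => ψ γ' k) γ₀) v / 2| ≤ B * l1Norm v ^ 3 := by
  have hseg : ∀ s ∈ Set.Icc (0 : ℝ) 1, γ₀ + s • v ∈ S := by
    intro s hs
    have := hSc.add_smul_mem hγ₀ hv hs
    exact this
  have hψd : ∀ γ ∈ S, ∀ k, DifferentiableAt ℝ (fun γ => ψ γ k) γ := fun γ hγ k =>
    ((hψ2 k).contDiffAt (hS.mem_nhds hγ)).differentiableAt (by norm_num)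
  have hψdd : ∀ γ ∈ S, ∀ k j, DifferentiableAt ℝ (partialDeriv j fun γ => ψ γ k) γ := by
    intro γ hγ k j
    have h1 : ContDiffAt ℝ 1 (fderiv ℝ fun γ => ψ γ k) γ :=
      ((hψ2 k).contDiffAt (hS.mem_nhds hγ)).fderiv_right (by norm_num)
    exact (h1.differentiableAt (by norm_num)).clm_apply (differentiableAt_const _)
  -- Restriction to the segment reduces to one variable: the directional derivative of ℓ is the
  -- linear form of ψ. The expansion of ψ serves the estimating equation, that of ℓ the
  -- log-propensity ratio.
  have h := taylor_unit_interval (φ := fun s => ℓ (γ₀ + s • v))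
    (φ₁ := fun s => linForm (ψ (γ₀ + s • v)) v)
    (φ₂ := fun s => quadForm (fun k j => partialDeriv j (fun γ' => ψ γ' k) (γ₀ + s • v)) v)
    (φ₃ := fun s => ∑ k, ∑ j, v k * (v j * ∑ l, v l *
      partialDeriv l (partialDeriv j fun γ' => ψ γ' k) (γ₀ + s • v)))
    (B := B * l1Norm v ^ 3) (fun s hs => ?_) (fun s hs => ?_) (fun s hs => ?_) (fun s hs => ?_)
  · simpa using h
  · have h1 := hasDerivAt_line (hℓ _ (hseg s hs))
    simp only [hψ _ (hseg s hs)] at h1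
    exact h1
  · have h1 := HasDerivAt.fun_sum fun k (_ : k ∈ Finset.univ) =>
      (hasDerivAt_line (hψd _ (hseg s hs) k)).const_mul (v k)
    simp only [Finset.mul_sum] at h1
    exact h1
  · exact HasDerivAt.fun_sum fun k _ => HasDerivAt.fun_sum fun j _ =>
      ((hasDerivAt_line (hψdd _ (hseg s hs) k j)).const_mul (v j)).const_mul (v k)
  · calc |∑ k, ∑ j, v k * (v j * ∑ l, v l *
          partialDeriv l (partialDeriv j fun γ' => ψ γ' k) (γ₀ + s • v))|
        ≤ ∑ k, ∑ j, |v k| * (|v j| * ∑ l, |v l| * B) := by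
          refine (Finset.abs_sum_le_sum_abs _ _).trans (Finset.sum_le_sum fun k _ => ?_)
          refine (Finset.abs_sum_le_sum_abs _ _).trans (Finset.sum_le_sum fun j _ => ?_)
          rw [abs_mul, abs_mul]
          refine mul_le_mul_of_nonneg_left (mul_le_mul_of_nonneg_left ?_ (abs_nonneg _))
            (abs_nonneg _)
          refine (Finset.abs_sum_le_sum_abs _ _).trans (Finset.sum_le_sum fun l _ => ?_)
          rw [abs_mul]
          exact mul_le_mul_of_nonneg_left (hB _ (hseg s hs) k j l) (abs_nonneg _)
      _ = B * l1Norm v ^ 3 := by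
          simp_rw [← Finset.sum_mul, ← Finset.mul_sum, ← Finset.sum_mul]
          rw [l1Norm]
          ring

end Taylor

/-! ### The score along the observed history -/

lemma tendsto_slope_seq {f : ℝ → ℝ} {f' : ℝ} (hf : HasDerivAt f f' 0) {s : ℕ → ℝ}
    (hs : Tendsto s atTop (𝓝 0)) (hs0 : ∀ n, s n ≠ 0) :
    Tendsto (fun n => (s n)⁻¹ * (f (s n) - f 0)) atTop (𝓝 f') := by
  have h1 := hasDerivAt_iff_tendsto_slope_zero.1 hf
  have h2 : Tendsto s atTop (𝓝[≠] 0) :=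
    tendsto_nhdsWithin_iff.2 ⟨hs, Eventually.of_forall fun n => hs0 n⟩
  simpa [Function.comp_def] using h1.comp h2

/-- Measurability is known only for each fixed parameter, so the derivative is realized as a limit
of difference quotients along one fixed sequence. The indicator discards points where
differentiability is unknown. -/
lemma measurable_indicator_partialDeriv {X : Type*} [MeasurableSpace X] {K : ℕ}
    {F : X → Param K → ℝ} {S : Set X} {G : Set (Param K)} (hG : IsOpen G)
    (hF : ∀ γ ∈ G, Measurable (S.indicator fun x => F x γ))
    (hd : ∀ x ∈ S, ∀ γ ∈ G, DifferentiableAt ℝ (F x) γ) {γ : Param K} (hγ : γ ∈ G) (k : Fin K) :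
    Measurable (S.indicator fun x => partialDeriv k (F x) γ) := by
  set e : Param K := EuclideanSpace.single k 1 with he
  have hcont : Tendsto (fun s : ℝ => γ + s • e) (𝓝 0) (𝓝 γ) := by
    have : Continuous fun s : ℝ => γ + s • e := by fun_prop
    simpa using this.tendsto 0
  obtain ⟨δ, hδ, hδG⟩ := Metric.eventually_nhds_iff.1 (hcont.eventually (hG.mem_nhds hγ))
  -- Step sizes stay below δ, so that all evaluation points remain in the open set G.
  set s : ℕ → ℝ := fun n => δ / 2 * (1 / ((n : ℝ) + 1)) with hs
  have hspos : ∀ n, 0 < s n := fun n => by positivity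
  have hsδ : ∀ n, s n < δ := fun n => by
    have h1 : (1 : ℝ) / ((n : ℝ) + 1) ≤ 1 := by
      rw [div_le_one (by positivity)]
      linarith [(Nat.cast_nonneg n : (0 : ℝ) ≤ n)]
    have : s n ≤ δ / 2 * 1 := mul_le_mul_of_nonneg_left h1 (by positivity)
    linarith
  have hslim : Tendsto s atTop (𝓝 0) := by
    have := (tendsto_one_div_add_atTop_nhds_zero_nat (𝕜 := ℝ)).const_mul (δ / 2)
    rwa [mul_zero] at this
  have hsG : ∀ n, γ + s n • e ∈ G := fun n => hδG (by
    rw [dist_zero_right, Real.norm_of_nonneg (hspos n).le]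
    exact hsδ n)
  refine measurable_of_tendsto_metrizable (f := fun n x => (s n)⁻¹ *
    (S.indicator (fun x => F x (γ + s n • e)) x - S.indicator (fun x => F x γ) x))
    (fun n => ((hF _ (hsG n)).sub (hF _ hγ)).const_mul _) ?_
  rw [tendsto_pi_nhds]
  intro x
  by_cases hx : x ∈ S
  · simp only [Set.indicator_of_mem hx]
    have h1 : HasDerivAt (fun r : ℝ => F x (γ + r • e)) (partialDeriv k (F x) γ) 0 := by
      have h2 : HasDerivAt (fun r : ℝ => γ + r • e) e 0 := by
        simpa using ((hasDerivAt_id (0 : ℝ)).smul_const e).const_add γ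
      have h3 : HasFDerivAt (F x) (fderiv ℝ (F x) γ) (γ + (0 : ℝ) • e) := by
        simpa using (hd x hx γ hγ).hasFDerivAt
      exact h3.comp_hasDerivAt 0 h2
    simpa using tendsto_slope_seq h1 hslim fun n => (hspos n).ne'
  · simp only [Set.indicator_of_notMem hx, sub_self, mul_zero]
    exact tendsto_const_nhds

namespace Model

variable {Ω 𝒰 𝒳 ℛ Ξ : Type*} [MeasurableSpace Ω] [MeasurableSpace 𝒰] [MeasurableSpace 𝒳]
  [MeasurableSpace ℛ] [MeasurableSpace Ξ] {p L K : ℕ} {D : Model Ω 𝒰 𝒳 ℛ Ξ p L K}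
  {γstar : Param K} {M : ℕ} {P : Measure Ξ} {Vps : Matrix (Fin K) (Fin K) ℝ}

/-- The propensity score of the treatment received at time `t ≥ 1`. -/
def obsE (D : Model Ω 𝒰 𝒳 ℛ Ξ p L K) (t : ℕ) (γ : Param K) (ξ : Ξ) : ℝ :=
  D.e (t - 1) (D.obsHist (t - 1) ξ) (D.W t ξ) γ

/-- The log-propensity of the treatment received at time `t ≥ 1`. -/
noncomputable def logE (D : Model Ω 𝒰 𝒳 ℛ Ξ p L K) (t : ℕ) (γ : Param K) (ξ : Ξ) : ℝ :=
  Real.log (D.obsE t γ ξ)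

lemma measurable_obsE_fullSigma {γ : Param K} (hγ : γ ∈ D.Γ) {t : ℕ} (ht : 1 ≤ t) :
    Measurable[D.fullSigma t] (D.obsE t γ) := by
  obtain ⟨n, rfl⟩ : ∃ n, t = n + 1 := ⟨t - 1, by omega⟩
  exact (D.measurable_e n γ hγ).comp
    ((D.measurable_obsHist_fullSigma (Nat.le_succ n)).prodMk
      (D.measurable_W_fullSigma (Nat.lt_succ_self n)))

lemma ae_obsE_pos [IsProbabilityMeasure P] (h_unconf : D.Unconfounded P)
    (h_spec : D.CorrectlySpecified P γstar) :
    ∀ᵐ ξ ∂P, ∀ t, 1 ≤ t → 0 < D.obsE t γstar ξ := by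
  filter_upwards [ae_e_pos h_unconf h_spec] with ξ hξ t ht
  obtain ⟨n, rfl⟩ : ∃ n, t = n + 1 := ⟨t - 1, by omega⟩
  exact hξ n

lemma differentiableAt_log_e (h_ps : D.PropensityRegular P M γstar Vps)
    {n : ℕ} {hh : ObsHist Ω 𝒳 n} {w : PointPattern Ω}
    (hpos : 0 < D.e n hh w γstar) {γ : Param K} (hγ : γ ∈ D.Γ) :
    DifferentiableAt ℝ (fun γ' => Real.log (D.e n hh w γ')) γ := by
  obtain ⟨h1, h2, -⟩ := h_ps.smooth n hh w hpos
  exact (h2.differentiableAt (D.isOpen_Γ.mem_nhds hγ)).log (h1 γ hγ).ne'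

lemma contDiffOn_scoreFn_apply (h_ps : D.PropensityRegular P M γstar Vps)
    {n : ℕ} {hh : ObsHist Ω 𝒳 n} {w : PointPattern Ω}
    (hpos : 0 < D.e n hh w γstar) (k : Fin K) :
    ContDiffOn ℝ 2 (fun γ => D.scoreFn n hh w γ k) D.Γ :=
  contDiffOn_euclidean.1 (h_ps.smooth n hh w hpos).2.2 k

lemma differentiableAt_scoreFn_apply (h_ps : D.PropensityRegular P M γstar Vps)
    {n : ℕ} {hh : ObsHist Ω 𝒳 n} {w : PointPattern Ω}
    (hpos : 0 < D.e n hh w γstar) {γ : Param K} (hγ : γ ∈ D.Γ) (k : Fin K) :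
    DifferentiableAt ℝ (fun γ => D.scoreFn n hh w γ k) γ :=
  ((contDiffOn_scoreFn_apply h_ps hpos k).contDiffAt (D.isOpen_Γ.mem_nhds hγ)).differentiableAt
    (by norm_num)

lemma measurable_indicator_scoreFn (h_ps : D.PropensityRegular P M γstar Vps)
    (hγs : γstar ∈ D.Γ) (n : ℕ) {γ : Param K} (hγ : γ ∈ D.Γ)
    (k : Fin K) :
    Measurable ({q : ObsHist Ω 𝒳 n × PointPattern Ω | 0 < D.e n q.1 q.2 γstar}.indicator
      fun q => D.scoreFn n q.1 q.2 γ k) := by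
  have hS : MeasurableSet {q : ObsHist Ω 𝒳 n × PointPattern Ω | 0 < D.e n q.1 q.2 γstar} :=
    measurableSet_lt measurable_const (D.measurable_e n γstar hγs)
  exact measurable_indicator_partialDeriv
    (F := fun q : ObsHist Ω 𝒳 n × PointPattern Ω => fun γ' => Real.log (D.e n q.1 q.2 γ'))
    D.isOpen_Γ (fun γ hγ => ((D.measurable_e n γ hγ).log).indicator hS)
    (fun q hq γ hγ => differentiableAt_log_e h_ps hq hγ) hγ k

lemma measurable_indicator_scoreFn_deriv (h_ps : D.PropensityRegular P M γstar Vps)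
    (hγs : γstar ∈ D.Γ) (n : ℕ) (k j : Fin K) :
    Measurable ({q : ObsHist Ω 𝒳 n × PointPattern Ω | 0 < D.e n q.1 q.2 γstar}.indicator
      fun q => partialDeriv j (fun γ' => D.scoreFn n q.1 q.2 γ' k) γstar) :=
  measurable_indicator_partialDeriv
    (F := fun q : ObsHist Ω 𝒳 n × PointPattern Ω => fun γ' => D.scoreFn n q.1 q.2 γ' k)
    D.isOpen_Γ (fun _ hγ => measurable_indicator_scoreFn h_ps hγs n hγ k)
    (fun _ hq _ hγ => differentiableAt_scoreFn_apply h_ps hq hγ k) hγs j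

variable [IsProbabilityMeasure P]

/-- Where the true density vanishes the score is uncontrolled, so measurability holds only up to the
null set excluded by `ae_e_pos`. -/
lemma aestronglyMeasurable_score (h_ps : D.PropensityRegular P M γstar Vps)
    (h_unconf : D.Unconfounded P) (h_spec : D.CorrectlySpecified P γstar)
    {t : ℕ} (ht : 1 ≤ t) (k : Fin K) :
    AEStronglyMeasurable[D.fullSigma t] (fun ξ => D.score t γstar ξ k) P := by
  obtain ⟨n, rfl⟩ : ∃ n, t = n + 1 := ⟨t - 1, by omega⟩
  refine ⟨_, ((measurable_indicator_scoreFn h_ps h_spec.1 n h_spec.1 k).comp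
    ((D.measurable_obsHist_fullSigma (Nat.le_succ n)).prodMk
      (D.measurable_W_fullSigma (Nat.lt_succ_self n)))).stronglyMeasurable, ?_⟩
  filter_upwards [ae_e_pos h_unconf h_spec] with ξ hξ
  have hmem : (D.obsHist n ξ, D.W (n + 1) ξ) ∈
    {q : ObsHist Ω 𝒳 n × PointPattern Ω | 0 < D.e n q.1 q.2 γstar} := hξ n
  rw [Function.comp_apply, Set.indicator_of_mem hmem]
  rfl

lemma aestronglyMeasurable_scoreDeriv (h_ps : D.PropensityRegular P M γstar Vps)
    (h_unconf : D.Unconfounded P) (h_spec : D.CorrectlySpecified P γstar)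
    {t : ℕ} (ht : 1 ≤ t) (k j : Fin K) :
    AEStronglyMeasurable[D.fullSigma t] (D.scoreDeriv k j t γstar) P := by
  obtain ⟨n, rfl⟩ : ∃ n, t = n + 1 := ⟨t - 1, by omega⟩
  refine ⟨_, ((measurable_indicator_scoreFn_deriv h_ps h_spec.1 n k j).comp
    ((D.measurable_obsHist_fullSigma (Nat.le_succ n)).prodMk
      (D.measurable_W_fullSigma (Nat.lt_succ_self n)))).stronglyMeasurable, ?_⟩
  filter_upwards [ae_e_pos h_unconf h_spec] with ξ hξ
  have hmem : (D.obsHist n ξ, D.W (n + 1) ξ) ∈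
    {q : ObsHist Ω 𝒳 n × PointPattern Ω | 0 < D.e n q.1 q.2 γstar} := hξ n
  rw [Function.comp_apply, Set.indicator_of_mem hmem]
  rfl

lemma ae_hasDerivAt_logE (h_ps : D.PropensityRegular P M γstar Vps)
    (h_unconf : D.Unconfounded P) (h_spec : D.CorrectlySpecified P γstar)
    (u : Param K) :
    ∀ᵐ ξ ∂P, ∀ t, 1 ≤ t → HasDerivAt (fun s : ℝ => D.logE t (γstar + s • u) ξ)
      (linForm (fun k => D.score t γstar ξ k) u) 0 := by
  filter_upwards [ae_obsE_pos h_unconf h_spec] with ξ hξ t ht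
  have h1 := hasDerivAt_line (F := fun γ => D.logE t γ ξ) (γ := γstar) (v := u) (s := 0)
    (by
      rw [zero_smul, add_zero]
      exact differentiableAt_log_e h_ps (hξ t ht) h_spec.1)
  rw [zero_smul, add_zero] at h1
  exact h1

/-- Local expansions of the log-propensity and its gradient, with remainder terms that have
bounded expectations. -/
lemma exists_taylor_logE (h_ps : D.PropensityRegular P M γstar Vps)
    (h_unconf : D.Unconfounded P) (h_spec : D.CorrectlySpecified P γstar) :
    ∃ ε₀ : ℝ, 0 < ε₀ ∧ Metric.ball γstar ε₀ ⊆ D.Γ ∧ ∃ dm : ℕ → Ξ → ℝ,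
      (∀ t, 1 ≤ t → Integrable (dm t) P) ∧ (∃ C : ℝ, ∀ t, 1 ≤ t → ∫ ξ, dm t ξ ∂P ≤ C) ∧
      ∀ᵐ ξ ∂P, ∀ t, 1 ≤ t → 0 ≤ dm t ξ ∧ ∀ v : Param K, ‖v‖ < ε₀ →
        0 < D.obsE t (γstar + v) ξ ∧
        |linForm (fun k => D.score t (γstar + v) ξ k) v -
            linForm (fun k => D.score t γstar ξ k) v -
            quadForm (fun k j => D.scoreDeriv k j t γstar ξ) v| ≤ dm t ξ * l1Norm v ^ 3 ∧
        |D.logE t (γstar + v) ξ - D.logE t γstar ξ -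
            linForm (fun k => D.score t γstar ξ k) v -
            quadForm (fun k j => D.scoreDeriv k j t γstar ξ) v / 2| ≤ dm t ξ * l1Norm v ^ 3 := by
  obtain ⟨N, hN, dom, -, hdi, ⟨C, hC⟩, hdom⟩ := h_ps.second_deriv_dominated
  obtain ⟨ε₀, hε₀, hball⟩ := Metric.mem_nhds_iff.1 (inter_mem hN (D.isOpen_Γ.mem_nhds h_spec.1))
  have hpt : ∀ ξ, ∀ t, 1 ≤ t → 0 < D.obsE t γstar ξ → ∀ v : Param K, ‖v‖ < ε₀ →
        0 < D.obsE t (γstar + v) ξ ∧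
        |linForm (fun k => D.score t (γstar + v) ξ k) v -
            linForm (fun k => D.score t γstar ξ k) v -
            quadForm (fun k j => D.scoreDeriv k j t γstar ξ) v| ≤
              dom (t - 1) (D.obsHist (t - 1) ξ) (D.W t ξ) * l1Norm v ^ 3 ∧
        |D.logE t (γstar + v) ξ - D.logE t γstar ξ -
            linForm (fun k => D.score t γstar ξ k) v -
            quadForm (fun k j => D.scoreDeriv k j t γstar ξ) v / 2| ≤
              dom (t - 1) (D.obsHist (t - 1) ξ) (D.W t ξ) * l1Norm v ^ 3 := by
    intro ξ t ht hpos v hv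
    have hmem : γstar + v ∈ Metric.ball γstar ε₀ := by simpa using hv
    refine ⟨(h_ps.smooth _ _ _ hpos).1 _ (hball hmem).2, ?_⟩
    exact taylor_of_gradient (S := Metric.ball γstar ε₀) Metric.isOpen_ball (convex_ball _ _)
      (ℓ := fun γ => D.logE t γ ξ) (ψ := fun γ k => D.score t γ ξ k)
      (fun γ hγ => differentiableAt_log_e h_ps hpos (hball hγ).2) (fun γ _ k => rfl)
      (fun k => (contDiffOn_scoreFn_apply h_ps hpos k).mono fun γ hγ => (hball hγ).2)
      (fun γ hγ k j l => hdom _ _ _ hpos γ (hball hγ).1 k j l) (Metric.mem_ball_self hε₀) hmem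
  refine ⟨ε₀, hε₀, fun γ hγ => (hball hγ).2, ?_⟩
  -- Nonnegativity of the dominating function is read off from its bound on some second derivative
  -- of the score. For K = 0 there is none, and the zero function is used instead.
  rcases isEmpty_or_nonempty (Fin K) with hK | ⟨⟨k⟩⟩
  · refine ⟨fun _ _ => 0, fun t _ => integrable_zero _ _ _, ⟨0, fun t _ => by simp⟩, ?_⟩
    filter_upwards [ae_obsE_pos h_unconf h_spec] with ξ hξ t ht
    refine ⟨le_rfl, fun v hv => ?_⟩
    have h1 := hpt ξ t ht (hξ t ht) v hv
    have h2 : l1Norm v = 0 := by simp [l1Norm]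
    rw [h2] at h1 ⊢
    simpa using h1
  · refine ⟨fun t ξ => dom (t - 1) (D.obsHist (t - 1) ξ) (D.W t ξ), fun t ht => ?_,
      ⟨C, fun t ht => ?_⟩, ?_⟩
    · obtain ⟨n, rfl⟩ : ∃ n, t = n + 1 := ⟨t - 1, by omega⟩
      exact hdi n
    · obtain ⟨n, rfl⟩ : ∃ n, t = n + 1 := ⟨t - 1, by omega⟩
      exact hC n
    · filter_upwards [ae_obsE_pos h_unconf h_spec] with ξ hξ t ht
      refine ⟨?_, hpt ξ t ht (hξ t ht)⟩
      exact (abs_nonneg _).trans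
        (hdom _ _ _ (hξ t ht) γstar (hball (Metric.mem_ball_self hε₀)).1 k k k)

end Model

/-! ### The information inequality -/

section InformationCore

variable {Ξ : Type*} {m0 : MeasurableSpace Ξ} {μ : Measure Ξ} [IsFiniteMeasure μ]
  {x : ℝ → Ξ → ℝ} {a b B : Ξ → ℝ} {ε : ℝ}

/-- From 1 + x ≤ exp x and the fact that likelihood ratios integrate to at most the total mass.
Together with the Taylor lower bound on x, this stands in for differentiation under the integral
sign. -/
lemma integral_expansion_le (ha : Integrable a μ) (hb : Integrable b μ) (hB : Integrable B μ)
    (hxi : ∀ s, |s| < ε → Integrable (fun ξ => Real.exp (x s ξ)) μ)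
    (hx1 : ∀ s, |s| < ε → ∫ ξ, Real.exp (x s ξ) ∂μ ≤ μ.real Set.univ)
    (hT : ∀ᵐ ξ ∂μ, ∀ s, |s| < ε → |x s ξ - s * a ξ - s ^ 2 * b ξ / 2| ≤ |s| ^ 3 * B ξ)
    {s : ℝ} (hs : |s| < ε) :
    s * ∫ ξ, a ξ ∂μ + s ^ 2 / 2 * ∫ ξ, b ξ ∂μ - |s| ^ 3 * ∫ ξ, B ξ ∂μ ≤ 0 := by
  have hi : Integrable (fun ξ => s * a ξ + s ^ 2 / 2 * b ξ) μ :=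
    (ha.const_mul _).add (hb.const_mul _)
  have hi2 : Integrable (fun ξ => s * a ξ + s ^ 2 / 2 * b ξ - |s| ^ 3 * B ξ) μ :=
    hi.sub (hB.const_mul _)
  have hi3 : Integrable (fun ξ => 1 + (s * a ξ + s ^ 2 / 2 * b ξ - |s| ^ 3 * B ξ)) μ :=
    (integrable_const _).add hi2
  have h1 : ∫ ξ, (1 + (s * a ξ + s ^ 2 / 2 * b ξ - |s| ^ 3 * B ξ)) ∂μ ≤ μ.real Set.univ := by
    refine le_trans (integral_mono_ae hi3 (hxi s hs) ?_) (hx1 s hs)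
    filter_upwards [hT] with ξ hξ
    have h2 := (abs_le.1 (hξ s hs)).1
    have h3 := Real.add_one_le_exp (x s ξ)
    linarith
  rw [integral_add (integrable_const _) hi2, integral_sub hi (hB.const_mul _),
    integral_add (ha.const_mul _) (hb.const_mul _), integral_const_mul, integral_const_mul,
    integral_const_mul, integral_const] at h1
  simp only [smul_eq_mul, mul_one] at h1
  linarith

/-- Dividing the inequality of `integral_expansion_le` by |s| and letting s tend to zero from either
side gives both signs. -/
lemma integral_gradient_eq_zero (hε : 0 < ε) (ha : Integrable a μ) (hb : Integrable b μ)
    (hB : Integrable B μ)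
    (hxi : ∀ s, |s| < ε → Integrable (fun ξ => Real.exp (x s ξ)) μ)
    (hx1 : ∀ s, |s| < ε → ∫ ξ, Real.exp (x s ξ) ∂μ ≤ μ.real Set.univ)
    (hT : ∀ᵐ ξ ∂μ, ∀ s, |s| < ε → |x s ξ - s * a ξ - s ^ 2 * b ξ / 2| ≤ |s| ^ 3 * B ξ) :
    ∫ ξ, a ξ ∂μ = 0 := by
  have key := fun s (hs : |s| < ε) => integral_expansion_le ha hb hB hxi hx1 hT hs
  set α := ∫ ξ, a ξ ∂μ
  set β := ∫ ξ, b ξ ∂μ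
  set κ := ∫ ξ, B ξ ∂μ
  have hev : ∀ᶠ s : ℝ in 𝓝[>] 0, 0 < s ∧ |s| < ε := by
    filter_upwards [self_mem_nhdsWithin, nhdsWithin_le_nhds (Iio_mem_nhds hε)] with s hs hs'
    have hs0 : (0 : ℝ) < s := hs
    exact ⟨hs0, by rw [abs_of_pos hs0]; exact hs'⟩
  have hlim : Tendsto (fun s : ℝ => -(s / 2 * β) + s ^ 2 * κ) (𝓝[>] 0) (𝓝 0) := by
    have : Continuous fun s : ℝ => -(s / 2 * β) + s ^ 2 * κ := by fun_prop
    simpa using (this.tendsto 0).mono_left nhdsWithin_le_nhds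
  refine le_antisymm (ge_of_tendsto hlim ?_) (neg_nonpos.1 (ge_of_tendsto hlim ?_))
  · filter_upwards [hev] with s hs
    have h := key s hs.2
    rw [abs_of_pos hs.1] at h
    have h' : s * (α - (-(s / 2 * β) + s ^ 2 * κ)) ≤ 0 := by linarith
    nlinarith [nonpos_of_mul_nonpos_right h' hs.1]
  · filter_upwards [hev] with s hs
    have h := key (-s) (by rw [abs_neg]; exact hs.2)
    rw [abs_neg, abs_of_pos hs.1] at h
    have h' : s * (-α - (-(s / 2 * β) + s ^ 2 * κ)) ≤ 0 := by linarith
    nlinarith [nonpos_of_mul_nonpos_right h' hs.1]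

/-- The symmetric difference quotients Z of the square root of the likelihood ratio converge to the
derivative a. Expanding the square produces two likelihood ratios, of mass at most the total, and a
cross term bounded below by 2 exp x ≥ 2 + 2x and the Taylor bound. Hence ∫ Z² ≤ -∫ b + O(s), and
Fatou yields the inequality. Equality, which would require interchanging limit and integral, is not
needed. -/
lemma integral_gradient_sq_le (hε : 0 < ε) (hb : Integrable b μ)
    (hB : Integrable B μ) (ha2 : Integrable (fun ξ => a ξ ^ 2) μ)
    (hxm : ∀ s, |s| < ε → AEMeasurable (x s) μ)
    (hxi : ∀ s, |s| < ε → Integrable (fun ξ => Real.exp (x s ξ)) μ)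
    (hx1 : ∀ s, |s| < ε → ∫ ξ, Real.exp (x s ξ) ∂μ ≤ μ.real Set.univ)
    (hT : ∀ᵐ ξ ∂μ, ∀ s, |s| < ε → |x s ξ - s * a ξ - s ^ 2 * b ξ / 2| ≤ |s| ^ 3 * B ξ)
    (hd : ∀ᵐ ξ ∂μ, HasDerivAt (fun s => x s ξ) (a ξ) 0) :
    ∫ ξ, a ξ ^ 2 ∂μ ≤ -∫ ξ, b ξ ∂μ := by
  set s : ℕ → ℝ := fun n => ε / 2 * (1 / ((n : ℝ) + 1)) with hs
  have hspos : ∀ n, 0 < s n := fun n => by positivity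
  have hsε : ∀ n, |s n| < ε := fun n => by
    rw [abs_of_pos (hspos n)]
    have h1 : (1 : ℝ) / ((n : ℝ) + 1) ≤ 1 := by
      rw [div_le_one (by positivity)]
      linarith [(Nat.cast_nonneg n : (0 : ℝ) ≤ n)]
    have : s n ≤ ε / 2 * 1 := mul_le_mul_of_nonneg_left h1 (by positivity)
    linarith
  have hsε' : ∀ n, |-s n| < ε := fun n => by rw [abs_neg]; exact hsε n
  have hslim : Tendsto s atTop (𝓝 0) := by
    have := (tendsto_one_div_add_atTop_nhds_zero_nat (𝕜 := ℝ)).const_mul (ε / 2)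
    rwa [mul_zero] at this
  set Z : ℕ → Ξ → ℝ := fun n ξ =>
    (s n)⁻¹ * (Real.exp (x (s n) ξ / 2) - Real.exp (x (-s n) ξ / 2)) with hZ
  set up : ℕ → Ξ → ℝ := fun n ξ =>
    ((s n) ^ 2)⁻¹ * (Real.exp (x (s n) ξ) + Real.exp (x (-s n) ξ) - 2) - b ξ + 2 * s n * B ξ
    with hup
  have hZup : ∀ n, ∀ᵐ ξ ∂μ, Z n ξ ^ 2 ≤ up n ξ := by
    intro n
    filter_upwards [hT] with ξ hξ
    have hsn := hspos n
    have h1 := (abs_le.1 (hξ (s n) (hsε n))).1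
    have h2 := (abs_le.1 (hξ (-s n) (hsε' n))).1
    rw [abs_neg] at h2
    rw [abs_of_pos hsn] at h1 h2
    set y := x (s n) ξ
    set z := x (-s n) ξ
    -- The first-order terms at s and -s cancel, leaving the second derivative and twice the cubic
    -- remainder.
    have hyz : s n ^ 2 * b ξ - 2 * s n ^ 3 * B ξ ≤ y + z := by nlinarith
    have hexp : Real.exp (y / 2) * Real.exp (z / 2) = Real.exp ((y + z) / 2) := by
      rw [← Real.exp_add]; ring_nf
    have hy : Real.exp (y / 2) ^ 2 = Real.exp y := by
      rw [← Real.exp_nat_mul]; ring_nf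
    have hz : Real.exp (z / 2) ^ 2 = Real.exp z := by
      rw [← Real.exp_nat_mul]; ring_nf
    have h3 := Real.add_one_le_exp ((y + z) / 2)
    have h4 : (Real.exp (y / 2) - Real.exp (z / 2)) ^ 2 =
        Real.exp y + Real.exp z - 2 * Real.exp ((y + z) / 2) := by
      rw [← hexp, ← hy, ← hz]; ring
    have h5 : (Real.exp (y / 2) - Real.exp (z / 2)) ^ 2 ≤
        Real.exp y + Real.exp z - 2 - (s n ^ 2 * b ξ - 2 * s n ^ 3 * B ξ) := by
      rw [h4]; linarith
    calc Z n ξ ^ 2 = ((s n) ^ 2)⁻¹ * (Real.exp (y / 2) - Real.exp (z / 2)) ^ 2 := by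
          simp only [hZ, mul_pow, inv_pow]; rfl
      _ ≤ ((s n) ^ 2)⁻¹ * (Real.exp y + Real.exp z - 2 -
            (s n ^ 2 * b ξ - 2 * s n ^ 3 * B ξ)) :=
          mul_le_mul_of_nonneg_left h5 (by positivity)
      _ = up n ξ := by
          simp only [hup]
          field_simp
          ring
  have hupi0 : ∀ n, Integrable (fun ξ => Real.exp (x (s n) ξ) + Real.exp (x (-s n) ξ) - 2) μ :=
    fun n => ((hxi _ (hsε n)).add (hxi _ (hsε' n))).sub (integrable_const 2)
  have hupi1 : ∀ n, Integrable (fun ξ => ((s n) ^ 2)⁻¹ *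
      (Real.exp (x (s n) ξ) + Real.exp (x (-s n) ξ) - 2) - b ξ) μ := fun n =>
    ((hupi0 n).const_mul _).sub hb
  have hupi : ∀ n, Integrable (up n) μ := fun n => (hupi1 n).add (hB.const_mul _)
  have hupint : ∀ n, ∫ ξ, up n ξ ∂μ ≤ -∫ ξ, b ξ ∂μ + 2 * s n * ∫ ξ, B ξ ∂μ := by
    intro n
    have hadd : Integrable (fun ξ => Real.exp (x (s n) ξ) + Real.exp (x (-s n) ξ)) μ :=
      (hxi _ (hsε n)).add (hxi _ (hsε' n))
    have h1 : ∫ ξ, (Real.exp (x (s n) ξ) + Real.exp (x (-s n) ξ) - 2) ∂μ ≤ 0 := by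
      rw [integral_sub hadd (integrable_const 2), integral_add (hxi _ (hsε n)) (hxi _ (hsε' n)),
        integral_const, smul_eq_mul]
      linarith [hx1 _ (hsε n), hx1 _ (hsε' n)]
    simp only [hup]
    rw [integral_add (hupi1 n) (hB.const_mul _), integral_sub ((hupi0 n).const_mul _) hb,
      integral_const_mul, integral_const_mul]
    have h2 : ((s n) ^ 2)⁻¹ *
        ∫ ξ, (Real.exp (x (s n) ξ) + Real.exp (x (-s n) ξ) - 2) ∂μ ≤ 0 :=
      mul_nonpos_of_nonneg_of_nonpos (by positivity) h1
    linarith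
  have hclim : Tendsto (fun n => -∫ ξ, b ξ ∂μ + 2 * s n * ∫ ξ, B ξ ∂μ) atTop
      (𝓝 (-∫ ξ, b ξ ∂μ)) := by
    simpa using ((hslim.const_mul 2).mul_const (∫ ξ, B ξ ∂μ)).const_add (-∫ ξ, b ξ ∂μ)
  -- Nonnegativity is needed to return from extended nonnegative reals at the end.
  have hb0 : 0 ≤ -∫ ξ, b ξ ∂μ := by
    refine ge_of_tendsto hclim (Eventually.of_forall fun n => ?_)
    refine le_trans ?_ (hupint n)
    refine integral_nonneg_of_ae ?_
    filter_upwards [hZup n] with ξ hξ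
    exact (sq_nonneg _).trans hξ
  have hZlim : ∀ᵐ ξ ∂μ, Tendsto (fun n => ENNReal.ofReal (Z n ξ ^ 2)) atTop
      (𝓝 (ENNReal.ofReal (a ξ ^ 2))) := by
    filter_upwards [hd, hT] with ξ hξ hTξ
    have h0 : x 0 ξ = 0 := by
      have := hTξ 0 (by simpa using hε)
      simpa using this
    have hy : HasDerivAt (fun r => Real.exp (x r ξ / 2)) (a ξ / 2) 0 := by
      have := (hξ.div_const 2).exp
      simpa [h0] using this
    have h1 := tendsto_slope_seq hy hslim fun n => (hspos n).ne'
    have h2 := tendsto_slope_seq hy (s := fun n => -s n) (by simpa using hslim.neg)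
      fun n => neg_ne_zero.2 (hspos n).ne'
    have h3 := h1.add h2
    rw [add_halves] at h3
    refine ENNReal.tendsto_ofReal (Tendsto.pow (h3.congr fun n => ?_) 2)
    simp only [hZ, inv_neg]
    ring
  have hfatou : ∫⁻ ξ, ENNReal.ofReal (a ξ ^ 2) ∂μ ≤ ENNReal.ofReal (-∫ ξ, b ξ ∂μ) := by
    calc ∫⁻ ξ, ENNReal.ofReal (a ξ ^ 2) ∂μ
        = ∫⁻ ξ, liminf (fun n => ENNReal.ofReal (Z n ξ ^ 2)) atTop ∂μ :=
          lintegral_congr_ae (hZlim.mono fun ξ h => h.liminf_eq.symm)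
      _ ≤ liminf (fun n => ∫⁻ ξ, ENNReal.ofReal (Z n ξ ^ 2) ∂μ) atTop := by
          refine lintegral_liminf_le' fun n => ?_
          refine AEMeasurable.ennreal_ofReal
            (AEMeasurable.pow_const (AEMeasurable.const_mul ?_ _) 2)
          exact ((hxm _ (hsε n)).div_const 2).exp.sub ((hxm _ (hsε' n)).div_const 2).exp
      _ ≤ liminf (fun n => ENNReal.ofReal (-∫ ξ, b ξ ∂μ + 2 * s n * ∫ ξ, B ξ ∂μ)) atTop := by
          refine liminf_le_liminf (Eventually.of_forall fun n => ?_)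
          calc ∫⁻ ξ, ENNReal.ofReal (Z n ξ ^ 2) ∂μ ≤ ∫⁻ ξ, ENNReal.ofReal (up n ξ) ∂μ :=
                lintegral_mono_ae ((hZup n).mono fun ξ h => ENNReal.ofReal_le_ofReal h)
            _ = ENNReal.ofReal (∫ ξ, up n ξ ∂μ) :=
                (ofReal_integral_eq_lintegral_ofReal (hupi n)
                  ((hZup n).mono fun ξ h => (sq_nonneg _).trans h)).symm
            _ ≤ _ := ENNReal.ofReal_le_ofReal (hupint n)
      _ = ENNReal.ofReal (-∫ ξ, b ξ ∂μ) := (ENNReal.tendsto_ofReal hclim).liminf_eq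
  rw [← ofReal_integral_eq_lintegral_ofReal ha2
    (Eventually.of_forall fun ξ => sq_nonneg _)] at hfatou
  exact (ENNReal.ofReal_le_ofReal_iff hb0).1 hfatou

end InformationCore

/-! ### Conditional expectations of quadratic forms -/

section CondExpTools

variable {Ξ : Type*} {m m0 : MeasurableSpace Ξ} {P : Measure Ξ} {K : ℕ}

lemma condExp_ae_le_of_setIntegral_le [IsProbabilityMeasure P] (hm : m ≤ m0) {f g : Ξ → ℝ}
    (hf : Integrable f P) (hg : Integrable g P)
    (h : ∀ A, MeasurableSet[m] A → ∫ ξ in A, f ξ ∂P ≤ ∫ ξ in A, g ξ ∂P) :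
    P[f | m] ≤ᵐ[P] P[g | m] := by
  have h1 : 0 ≤ᵐ[P.trim hm] P[g - f | m] := by
    refine ae_nonneg_of_forall_setIntegral_nonneg
      (integrable_condExp.trim hm stronglyMeasurable_condExp) fun A hA _ => ?_
    rw [← setIntegral_trim hm stronglyMeasurable_condExp hA, setIntegral_condExp hm (hg.sub hf) hA]
    have h2 := integral_sub hg.integrableOn (hf.integrableOn (s := A))
    have h3 : ∫ ξ in A, (g - f) ξ ∂P = ∫ ξ in A, (g ξ - f ξ) ∂P := rfl
    rw [h3, h2]
    exact sub_nonneg.2 (h A hA)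
  filter_upwards [ae_of_ae_trim hm h1, condExp_sub hg hf m] with ξ h4 h5
  have h6 : 0 ≤ (P[g - f | m]) ξ := h4
  rw [h5, Pi.sub_apply] at h6
  linarith

lemma condExp_quadForm {f : Fin K → Fin K → Ξ → ℝ} (hf : ∀ k j, Integrable (f k j) P)
    (m : MeasurableSpace Ξ) (u : Param K) :
    P[fun ξ => quadForm (fun k j => f k j ξ) u | m] =ᵐ[P]
      fun ξ => quadForm (fun k j => (P[f k j | m]) ξ) u := by
  have h1 : (fun ξ => quadForm (fun k j => f k j ξ) u) =
      ∑ q : Fin K × Fin K, (u q.1 * u q.2) • f q.1 q.2 := by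
    ext ξ
    simp only [quadForm, Finset.sum_apply, Pi.smul_apply, smul_eq_mul,
      Fintype.sum_prod_type, mul_assoc]
  rw [h1]
  have h2 := condExp_finsetSum (s := Finset.univ) (μ := P)
    (f := fun q : Fin K × Fin K => (u q.1 * u q.2) • f q.1 q.2)
    (fun q _ => (hf q.1 q.2).smul _) m
  have h3 : ∀ᵐ ξ ∂P, ∀ q : Fin K × Fin K, (P[(u q.1 * u q.2) • f q.1 q.2 | m]) ξ =
      (u q.1 * u q.2) * (P[f q.1 q.2 | m]) ξ := by
    refine ae_all_iff.2 fun q => ?_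
    filter_upwards [condExp_smul (μ := P) (u q.1 * u q.2) (f q.1 q.2) m] with ξ h
    simpa using h
  filter_upwards [h2, h3] with ξ h4 h5
  rw [h4, Finset.sum_apply]
  simp only [h5, quadForm, Fintype.sum_prod_type, mul_assoc]

lemma linForm_sq (a : Fin K → ℝ) (u : Param K) :
    linForm a u ^ 2 = quadForm (fun k j => a k * a j) u := by
  simp only [linForm, quadForm, sq, Finset.sum_mul_sum]
  exact Finset.sum_congr rfl fun k _ => Finset.sum_congr rfl fun j _ => by ring

lemma continuous_quadForm (Q : Fin K → Fin K → ℝ) : Continuous (quadForm Q) := by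
  unfold quadForm
  fun_prop

end CondExpTools

/-! ### Centred score and information inequality for the treatment model -/

namespace Model

variable {Ω 𝒰 𝒳 ℛ Ξ : Type*} [MeasurableSpace Ω] [MeasurableSpace 𝒰] [MeasurableSpace 𝒳]
  [MeasurableSpace ℛ] [MeasurableSpace Ξ] {p L K : ℕ} {D : Model Ω 𝒰 𝒳 ℛ Ξ p L K}
  {γstar : Param K} {M : ℕ} {P : Measure Ξ} {Vps : Matrix (Fin K) (Fin K) ℝ}
  [IsProbabilityMeasure P]

/-- Likelihood ratios integrate to at most one. -/
lemma setIntegral_likelihood_ratio_le (h_unconf : D.Unconfounded P)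
    (h_spec : D.CorrectlySpecified P γstar) {γ : Param K} (hγ : γ ∈ D.Γ) {t : ℕ} (ht : 1 ≤ t) :
    Integrable (fun ξ => D.obsE t γ ξ / D.obsE t γstar ξ) P ∧
    ∀ A, MeasurableSet[D.fullSigma (t - 1)] A →
      ∫ ξ in A, D.obsE t γ ξ / D.obsE t γstar ξ ∂P ≤ P.real A := by
  obtain ⟨n, rfl⟩ : ∃ n, t = n + 1 := ⟨t - 1, by omega⟩
  have hγs := h_spec.1
  set r : Ξ → ℝ := fun ξ => D.obsE (n + 1) γ ξ / D.obsE (n + 1) γstar ξ with hr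
  have hr0 : ∀ ξ, 0 ≤ r ξ := fun ξ =>
    div_nonneg (D.nonneg_e _ _ _ _ hγ) (D.nonneg_e _ _ _ _ hγs)
  have hrm : Measurable r :=
    (((measurable_obsE_fullSigma hγ ht).div (measurable_obsE_fullSigma hγs ht))).mono
      (D.fullSigma_le _) le_rfl
  have key : ∀ s : Set (𝒰 × (Fin n → PointPattern Ω)), MeasurableSet s →
      ∫⁻ ξ in D.full n ⁻¹' s, ENNReal.ofReal (r ξ) ∂P ≤ P (D.full n ⁻¹' s) := by
    intro s hs
    have hA : MeasurableSet (D.full n ⁻¹' s) := D.measurable_full n hs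
    set g : (𝒰 × (Fin n → PointPattern Ω)) × PointPattern Ω → ENNReal := fun q =>
      s.indicator (fun _ => 1) q.1 * ENNReal.ofReal
        (D.e n (D.histOf n q.1) q.2 γ / D.e n (D.histOf n q.1) q.2 γstar) with hg
    have hgm : Measurable g := ((measurable_const.indicator hs).comp measurable_fst).mul
      ((D.measurable_e_hist hγ n).div (D.measurable_e_hist hγs n)).ennreal_ofReal
    have h1 := lintegral_full_treatment h_unconf h_spec n hgm
    have h2 : ∫⁻ ξ in D.full n ⁻¹' s, ENNReal.ofReal (r ξ) ∂P =
        ∫⁻ ξ, g (D.full n ξ, D.W (n + 1) ξ) ∂P := by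
      rw [← lintegral_indicator hA]
      refine lintegral_congr fun ξ => ?_
      by_cases hξ : D.full n ξ ∈ s
      · rw [Set.indicator_of_mem (show ξ ∈ D.full n ⁻¹' s from hξ)]
        simp only [hg, Set.indicator_of_mem hξ, one_mul]
        rfl
      · rw [Set.indicator_of_notMem (show ξ ∉ D.full n ⁻¹' s from hξ)]
        simp only [hg, Set.indicator_of_notMem hξ, zero_mul]
    rw [h2, h1, ← lintegral_indicator_one hA]
    refine lintegral_mono fun ξ => ?_
    have h3 : ∀ w, ENNReal.ofReal (D.e n (D.obsHist n ξ) w γstar) * g (D.full n ξ, w) ≤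
        s.indicator (fun _ => 1) (D.full n ξ) * ENNReal.ofReal (D.e n (D.obsHist n ξ) w γ) := by
      intro w
      simp only [hg]
      rw [mul_left_comm, ← ENNReal.ofReal_mul (D.nonneg_e _ _ _ _ hγs), obsHist_eq]
      refine mul_le_mul_right (ENNReal.ofReal_le_ofReal ?_) _
      -- Where the true density vanishes the product is zero while the model density at γ may be
      -- positive. This is why only an inequality results; it suffices for both consequences.
      rcases eq_or_ne (D.e n (D.histOf n (D.full n ξ)) w γstar) 0 with h0 | h0
      · rw [h0, zero_mul]
        exact D.nonneg_e _ _ _ _ hγ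
      · rw [mul_div_cancel₀ _ h0]
    calc ∫⁻ w, ENNReal.ofReal (D.e n (D.obsHist n ξ) w γstar) * g (D.full n ξ, w) ∂D.ν
        ≤ ∫⁻ w, s.indicator (fun _ => 1) (D.full n ξ) *
            ENNReal.ofReal (D.e n (D.obsHist n ξ) w γ) ∂D.ν := lintegral_mono h3
      _ = s.indicator (fun _ => 1) (D.full n ξ) := by
          refine (lintegral_const_mul _ ((D.measurable_e n γ hγ).comp
            measurable_prodMk_left).ennreal_ofReal).trans ?_
          exact (congrArg _ (D.lintegral_e n (D.obsHist n ξ) γ hγ)).trans (mul_one _)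
      _ = (D.full n ⁻¹' s).indicator 1 ξ := rfl
  have hintegrable : Integrable r P := by
    refine ⟨hrm.aestronglyMeasurable, ?_⟩
    rw [hasFiniteIntegral_iff_ofReal (Eventually.of_forall hr0)]
    have h1 := key Set.univ MeasurableSet.univ
    rw [Set.preimage_univ, Measure.restrict_univ] at h1
    exact h1.trans_lt (measure_lt_top _ _)
  refine ⟨hintegrable, fun A hA => ?_⟩
  obtain ⟨s, hs, rfl⟩ := hA
  rw [integral_eq_lintegral_of_nonneg_ae (Eventually.of_forall hr0) hrm.aestronglyMeasurable]
  exact ENNReal.toReal_mono (measure_ne_top _ _) (key s hs)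

/-- The score is centred, and the expected negative Hessian of the log-likelihood dominates the
expected outer product of the score. -/
lemma setIntegral_score (h_ps : D.PropensityRegular P M γstar Vps)
    (h_unconf : D.Unconfounded P) (h_spec : D.CorrectlySpecified P γstar) {t : ℕ} (ht : 1 ≤ t)
    (u : Param K) {A : Set Ξ} (hA : MeasurableSet[D.fullSigma (t - 1)] A) :
    ∫ ξ in A, linForm (fun k => D.score t γstar ξ k) u ∂P = 0 ∧
    ∫ ξ in A, quadForm (fun k j => D.score t γstar ξ k * D.score t γstar ξ j) u ∂P ≤
      ∫ ξ in A, -quadForm (fun k j => D.scoreDeriv k j t γstar ξ) u ∂P := by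
  obtain ⟨ε₀, hε₀, hball, dm, hdi, -, hdm⟩ := exists_taylor_logE h_ps h_unconf h_spec
  -- For |s| < ε the point `γstar + s • u` lies in the ball of validity; the added one covers u = 0.
  set ε : ℝ := ε₀ / (‖u‖ + 1) with hεdef
  have hε : 0 < ε := by positivity
  have hsu : ∀ s : ℝ, |s| < ε → ‖s • u‖ < ε₀ := by
    intro s hs
    rw [norm_smul, Real.norm_eq_abs]
    rw [hεdef, lt_div_iff₀ (by positivity)] at hs
    nlinarith [abs_nonneg s]
  have hmem : ∀ s : ℝ, |s| < ε → γstar + s • u ∈ D.Γ := fun s hs =>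
    hball (by simpa using hsu s hs)
  set x : ℝ → Ξ → ℝ := fun s ξ => D.logE t (γstar + s • u) ξ - D.logE t γstar ξ with hx
  -- Working under P restricted to an arbitrary event of the past turns the unconditional
  -- inequalities into conditional ones.
  set μ := P.restrict A with hμ
  have hpos := ae_obsE_pos h_unconf h_spec
  have hexp : ∀ s, |s| < ε → (fun ξ => Real.exp (x s ξ)) =ᵐ[P]
      fun ξ => D.obsE t (γstar + s • u) ξ / D.obsE t γstar ξ := by
    intro s hs
    filter_upwards [hdm, hpos] with ξ h1 h2
    simp only [hx, logE]
    rw [Real.exp_sub, Real.exp_log ((h1 t ht).2 _ (hsu s hs)).1, Real.exp_log (h2 t ht)]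
  have hxi : ∀ s, |s| < ε → Integrable (fun ξ => Real.exp (x s ξ)) μ := fun s hs =>
    ((setIntegral_likelihood_ratio_le h_unconf h_spec (hmem s hs) ht).1.congr
      (hexp s hs).symm).integrableOn
  have hx1 : ∀ s, |s| < ε → ∫ ξ, Real.exp (x s ξ) ∂μ ≤ μ.real Set.univ := by
    intro s hs
    rw [integral_congr_ae (ae_restrict_of_ae (hexp s hs))]
    simpa [hμ] using
      (setIntegral_likelihood_ratio_le h_unconf h_spec (hmem s hs) ht).2 A hA
  have hxm : ∀ s, |s| < ε → AEMeasurable (x s) μ := fun s hs =>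
    ((((measurable_obsE_fullSigma (hmem s hs) ht).log).sub
      ((measurable_obsE_fullSigma h_spec.1 ht).log)).mono (D.fullSigma_le _) le_rfl).aemeasurable
  have hscore : ∀ k, MemLp (fun ξ => D.score t γstar ξ k) 2 P := fun k =>
    (h_ps.square_integrable t ht).eval_piLp k
  have ha : Integrable (fun ξ => linForm (fun k => D.score t γstar ξ k) u) P :=
    integrable_finsetSum _ fun k _ => ((hscore k).integrable (by norm_num)).const_mul _
  have hb : Integrable (fun ξ => quadForm (fun k j => D.scoreDeriv k j t γstar ξ) u) P :=
    integrable_finsetSum _ fun k _ => integrable_finsetSum _ fun j _ =>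
      ((h_ps.deriv_integrable k j t ht).const_mul _).const_mul _
  have hB : Integrable (fun ξ => dm t ξ * l1Norm u ^ 3) P := (hdi t ht).mul_const _
  have ha2 : Integrable (fun ξ => linForm (fun k => D.score t γstar ξ k) u ^ 2) P :=
    (memLp_finsetSum _ fun k _ => (hscore k).const_mul (u k)).integrable_sq
  have hT : ∀ᵐ ξ ∂μ, ∀ s, |s| < ε →
      |x s ξ - s * linForm (fun k => D.score t γstar ξ k) u -
        s ^ 2 * quadForm (fun k j => D.scoreDeriv k j t γstar ξ) u / 2| ≤
          |s| ^ 3 * (dm t ξ * l1Norm u ^ 3) := by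
    refine ae_restrict_of_ae ?_
    filter_upwards [hdm] with ξ hξ s hs
    have h1 := ((hξ t ht).2 _ (hsu s hs)).2.2
    rw [linForm_smul, quadForm_smul, l1Norm_smul] at h1
    refine h1.trans (le_of_eq ?_)
    ring
  have hd : ∀ᵐ ξ ∂μ, HasDerivAt (fun s => x s ξ)
      (linForm (fun k => D.score t γstar ξ k) u) 0 := by
    refine ae_restrict_of_ae ?_
    filter_upwards [ae_hasDerivAt_logE h_ps h_unconf h_spec u] with ξ hξ
    exact (hξ t ht).sub_const _
  refine ⟨integral_gradient_eq_zero hε ha.integrableOn hb.integrableOn hB.integrableOn hxi hx1 hT,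
    ?_⟩
  have h1 := integral_gradient_sq_le hε hb.integrableOn hB.integrableOn ha2.integrableOn hxm hxi
    hx1 hT hd
  simp only [linForm_sq] at h1
  rw [integral_neg]
  exact h1

lemma condExp_score_eq_zero (h_ps : D.PropensityRegular P M γstar Vps) (hM : 1 ≤ M)
    (h_unconf : D.Unconfounded P) (h_spec : D.CorrectlySpecified P γstar) {t : ℕ} (ht : 1 ≤ t)
    (k : Fin K) :
    P[fun ξ => D.score t γstar ξ k | D.fullSigma (t - M)] =ᵐ[P] 0 := by
  refine (ae_eq_condExp_of_forall_setIntegral_eq (D.fullSigma_le _)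
    (((h_ps.square_integrable t ht).eval_piLp k).integrable (by norm_num))
    (fun _ _ _ => (integrable_zero _ _ _).integrableOn) (fun A hA _ => ?_)
    stronglyMeasurable_zero.aestronglyMeasurable).symm
  have h1 := (setIntegral_score h_ps h_unconf h_spec ht (EuclideanSpace.single k 1)
    (D.fullSigma_mono (show t - M ≤ t - 1 by omega) _ hA)).1
  have h2 : ∀ ξ, linForm (fun k => D.score t γstar ξ k) (EuclideanSpace.single k 1) =
      D.score t γstar ξ k := by
    intro ξ
    simp [linForm]
  simp only [h2] at h1
  rw [h1]
  simp

/-- The information inequality, conditionally on the complete history. -/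
lemma ae_information_le (h_ps : D.PropensityRegular P M γstar Vps) (hM : 1 ≤ M)
    (h_unconf : D.Unconfounded P) (h_spec : D.CorrectlySpecified P γstar) :
    ∀ᵐ ξ ∂P, ∀ t, 1 ≤ t → ∀ u : Param K,
      quadForm (fun k j => (P[fun ξ' => D.score t γstar ξ' k * D.score t γstar ξ' j |
        D.fullSigma (t - M)]) ξ) u ≤
      -quadForm (fun k j => (P[D.scoreDeriv k j t γstar | D.fullSigma (t - M)]) ξ) u := by
  have h1 : ∀ t, 1 ≤ t → ∀ u : Param K, ∀ᵐ ξ ∂P,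
      quadForm (fun k j => (P[fun ξ' => D.score t γstar ξ' k * D.score t γstar ξ' j |
        D.fullSigma (t - M)]) ξ) u ≤
      -quadForm (fun k j => (P[D.scoreDeriv k j t γstar | D.fullSigma (t - M)]) ξ) u := by
    intro t ht u
    have hscore : ∀ k, MemLp (fun ξ => D.score t γstar ξ k) 2 P := fun k =>
      (h_ps.square_integrable t ht).eval_piLp k
    have hi1 : ∀ k j, Integrable (fun ξ => D.score t γstar ξ k * D.score t γstar ξ j) P :=
      fun k j => (hscore k).integrable_mul (hscore j)
    have hi2 := fun k j => h_ps.deriv_integrable k j t ht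
    have hq1 : Integrable
        (fun ξ => quadForm (fun k j => D.score t γstar ξ k * D.score t γstar ξ j) u) P :=
      integrable_finsetSum _ fun k _ => integrable_finsetSum _ fun j _ =>
        ((hi1 k j).const_mul _).const_mul _
    have hq2 : Integrable (fun ξ => quadForm (fun k j => D.scoreDeriv k j t γstar ξ) u) P :=
      integrable_finsetSum _ fun k _ => integrable_finsetSum _ fun j _ =>
        ((hi2 k j).const_mul _).const_mul _
    have hle := condExp_ae_le_of_setIntegral_le (D.fullSigma_le (t - M)) hq1 hq2.neg fun A hA =>
      (setIntegral_score h_ps h_unconf h_spec ht u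
        (D.fullSigma_mono (show t - M ≤ t - 1 by omega) _ hA)).2
    filter_upwards [hle, condExp_quadForm hi1 (D.fullSigma (t - M)) u,
      condExp_quadForm hi2 (D.fullSigma (t - M)) u,
      condExp_neg (μ := P) (fun ξ => quadForm (fun k j => D.scoreDeriv k j t γstar ξ) u)
        (D.fullSigma (t - M))] with ξ h2 h3 h4 h5
    rw [h3, h5, Pi.neg_apply, h4] at h2
    exact h2
  -- The exceptional null set depends on u. A countable dense set of directions and continuity of
  -- quadratic forms give one null set for all u, as needed for the random direction of the
  -- estimation error.
  have h2 : ∀ᵐ ξ ∂P, ∀ t, 1 ≤ t → ∀ n : ℕ,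
      quadForm (fun k j => (P[fun ξ' => D.score t γstar ξ' k * D.score t γstar ξ' j |
        D.fullSigma (t - M)]) ξ) (TopologicalSpace.denseSeq (Param K) n) ≤
      -quadForm (fun k j => (P[D.scoreDeriv k j t γstar | D.fullSigma (t - M)]) ξ)
        (TopologicalSpace.denseSeq (Param K) n) := by
    rw [ae_all_iff]
    intro t
    by_cases ht : 1 ≤ t
    · filter_upwards [ae_all_iff.2 fun n => h1 t ht (TopologicalSpace.denseSeq (Param K) n)]
        with ξ hξ _ n using hξ n
    · exact Eventually.of_forall fun ξ h => absurd h ht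
  filter_upwards [h2] with ξ hξ t ht u
  exact (TopologicalSpace.denseRange_denseSeq (Param K)).induction_on u
    (isClosed_le (continuous_quadForm _) (continuous_quadForm _).neg) (hξ t ht)

end Model

/-! ### Rate of the estimator and expansion of the log-propensities -/

section Rate

variable {K : ℕ}

lemma abs_linForm_le {a : Fin K → ℝ} {B : ℝ} (ha : ∀ k, |a k| ≤ B) (v : Param K) :
    |linForm a v| ≤ K * ‖v‖ * B := by
  have h : |linForm a v| ≤ ∑ _k : Fin K, ‖v‖ * B := by
    refine (Finset.abs_sum_le_sum_abs _ _).trans (Finset.sum_le_sum fun k _ => ?_)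
    rw [abs_mul]
    exact mul_le_mul (PiLp.norm_apply_le v k) (ha k) (abs_nonneg _) (norm_nonneg _)
  refine h.trans (le_of_eq ?_)
  simp [mul_assoc]

lemma sum_linForm (s : Finset ℕ) (a : ℕ → Fin K → ℝ) (v : Param K) :
    ∑ t ∈ s, linForm (a t) v = linForm (fun k => ∑ t ∈ s, a t k) v := by
  simp only [linForm, Finset.mul_sum]
  exact Finset.sum_comm

lemma sum_quadForm (s : Finset ℕ) (Q : ℕ → Fin K → Fin K → ℝ) (v : Param K) :
    ∑ t ∈ s, quadForm (Q t) v = quadForm (fun k j => ∑ t ∈ s, Q t k j) v := by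
  simp only [quadForm, Finset.mul_sum]
  rw [Finset.sum_comm]
  exact Finset.sum_congr rfl fun k _ => Finset.sum_comm

lemma quadForm_sub (Q R : Fin K → Fin K → ℝ) (v : Param K) :
    quadForm (fun k j => Q k j - R k j) v = quadForm Q v - quadForm R v := by
  simp only [quadForm, ← Finset.sum_sub_distrib, mul_sub]

set_option maxHeartbeats 1000000 in
/-- Deterministic consequence of the estimating equation: the estimation error `v` is of order
`T ^ (-1/2)`, and the log-propensity ratios `x` are bounded and small on average. -/
lemma rate_and_expansion {M T : ℕ} (hM : 1 ≤ M) (hT : 1 ≤ T) {v : Param K} {ψ : ℕ → Fin K → ℝ}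
    {H H' I : ℕ → Fin K → Fin K → ℝ} {dm x g : ℕ → ℝ} {lam C η : ℝ} (hlam : 0 < lam)
    (hC : 0 ≤ C) (hη1 : η ≤ 1) (hηlam : K ^ 2 * η + C * K ^ 3 * η ≤ lam / 2)
    (hv : ‖v‖ ≤ η)
    (hroot : ∑ t ∈ Finset.Icc M T, g t = 0)
    (hg : ∀ t ∈ Finset.Icc 1 T,
      |g t - linForm (ψ t) v - quadForm (H t) v| ≤ dm t * l1Norm v ^ 3)
    (hx : ∀ t ∈ Finset.Icc 1 T,
      |x t - linForm (ψ t) v - quadForm (H t) v / 2| ≤ dm t * l1Norm v ^ 3)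
    (hI0 : ∀ t ∈ Finset.Icc 1 T, 0 ≤ quadForm (I t) v)
    (hIH : ∀ t ∈ Finset.Icc 1 T, quadForm (I t) v ≤ -quadForm (H' t) v)
    (hIlam : lam * (T * ‖v‖ ^ 2) ≤ ∑ t ∈ Finset.Icc M T, quadForm (I t) v)
    (hdm0 : ∀ t ∈ Finset.Icc 1 T, 0 ≤ dm t) (hdm : ∑ t ∈ Finset.Icc 1 T, dm t ≤ C * T)
    (hψ2 : ∀ k, ∑ t ∈ Finset.Icc 1 T, ψ t k ^ 2 ≤ C ^ 2 * T)
    (hψ1 : ∀ k, (∑ t ∈ Finset.Icc M T, ψ t k) ^ 2 ≤ C ^ 2 * T)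
    (hHs : ∀ k j, |∑ t ∈ Finset.Icc M T, (H t k j - H' t k j)| ≤ η * T)
    (hHm : ∀ k j, ∀ t ∈ Finset.Icc M T, |H t k j - H' t k j| ≤ η * T)
    (hH0 : ∀ k j, ∀ t ∈ Finset.Icc 1 T, t < M → |H t k j| ≤ C)
    {c Q Y : ℝ} (hc : c = 2 * K * C / lam) (hQ : Q = K * C * c + lam / 2 * c ^ 2)
    (hY : Y = K * C * c + Q + K ^ 2 * c ^ 2 + M * (C * K ^ 2 * c ^ 2) + C * K ^ 3 * c ^ 3) :
    (∀ t ∈ Finset.Icc 1 T, |x t| ≤ Y) ∧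
      ∑ t ∈ Finset.Icc 1 T, |x t| ≤ Y * √T + Y * (η * T) := by
  have hTr : (1 : ℝ) ≤ T := by exact_mod_cast hT
  have hsub : Finset.Icc M T ⊆ Finset.Icc 1 T := Finset.Icc_subset_Icc_left hM
  set r : ℝ := √T with hr
  have hr1 : 1 ≤ r := Real.one_le_sqrt.2 hTr
  have hr2 : r ^ 2 = T := Real.sq_sqrt (by linarith)
  have hn0 : 0 ≤ ‖v‖ := norm_nonneg v
  have hη0 : 0 ≤ η := hn0.trans hv
  have hc0 : 0 ≤ c := by rw [hc]; positivity
  have hQ0 : 0 ≤ Q := by rw [hQ]; positivity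
  set n1 : ℝ := ‖v‖ with hn1
  -- The error normalized by √T; the aim is the bound y ≤ c.
  set y : ℝ := r * n1 with hy
  have hy0 : 0 ≤ y := by positivity
  have hKr : (0 : ℝ) ≤ K := Nat.cast_nonneg K
  have hl : l1Norm v ≤ K * n1 := l1Norm_le v
  have hl0 := l1Norm_nonneg v
  have hl2 : l1Norm v ^ 2 ≤ K ^ 2 * n1 ^ 2 := by
    rw [← mul_pow]; exact pow_le_pow_left₀ hl0 hl 2
  have hl3 : l1Norm v ^ 3 ≤ K ^ 3 * n1 ^ 3 := by
    rw [← mul_pow]; exact pow_le_pow_left₀ hl0 hl 3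
  have hTn2 : T * n1 ^ 2 = y ^ 2 := by rw [hy, mul_pow, hr2]
  have hn1y : n1 ≤ y := by rw [hy]; nlinarith
  have hn2y : n1 ^ 2 ≤ y ^ 2 := pow_le_pow_left₀ hn0 hn1y 2
  have hTn3 : T * n1 ^ 3 ≤ y ^ 3 := by
    have : y ^ 3 = r * (T * n1 ^ 3) := by rw [hy, mul_pow, ← hr2]; ring
    rw [this]
    have h0 : (0 : ℝ) ≤ T * n1 ^ 3 := by positivity
    nlinarith
  -- remainder terms
  have hR : ∑ t ∈ Finset.Icc 1 T, dm t * l1Norm v ^ 3 ≤ C * K ^ 3 * (T * n1 ^ 3) := by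
    rw [← Finset.sum_mul]
    calc (∑ t ∈ Finset.Icc 1 T, dm t) * l1Norm v ^ 3 ≤ C * T * (K ^ 3 * n1 ^ 3) :=
          mul_le_mul hdm hl3 (by positivity) (by positivity)
      _ = C * K ^ 3 * (T * n1 ^ 3) := by ring
  have hRM : ∑ t ∈ Finset.Icc M T, dm t * l1Norm v ^ 3 ≤ C * K ^ 3 * (T * n1 ^ 3) :=
    (Finset.sum_le_sum_of_subset_of_nonneg hsub fun t ht _ =>
      mul_nonneg (hdm0 t ht) (by positivity)).trans hR
  have hRt : ∀ t ∈ Finset.Icc 1 T, dm t * l1Norm v ^ 3 ≤ C * K ^ 3 * (T * n1 ^ 3) :=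
    fun t ht => (Finset.single_le_sum (f := fun t => dm t * l1Norm v ^ 3)
      (fun t ht => mul_nonneg (hdm0 t ht) (by positivity)) ht).trans hR
  -- the estimating equation
  have hlinsum : |∑ t ∈ Finset.Icc M T, linForm (ψ t) v| ≤ K * C * y := by
    rw [sum_linForm]
    refine (abs_linForm_le (B := C * r) (fun k => ?_) v).trans (le_of_eq (by rw [hy]; ring))
    refine abs_le_of_sq_le_sq ?_ (by positivity)
    rw [mul_pow, hr2]
    exact hψ1 k
  have hquadsum : |∑ t ∈ Finset.Icc M T, quadForm (fun k j => H t k j - H' t k j) v| ≤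
      K ^ 2 * η * y ^ 2 := by
    rw [sum_quadForm]
    refine (abs_quadForm_le hHs v).trans ?_
    calc η * T * l1Norm v ^ 2 ≤ η * T * (K ^ 2 * n1 ^ 2) :=
          mul_le_mul_of_nonneg_left hl2 (by positivity)
      _ = K ^ 2 * η * y ^ 2 := by rw [← hTn2]; ring
  -- The estimating equation is solved for the compensated quadratic part. The deviations H - H' and
  -- the cubic remainder contribute at most (K²η + CK³η) y², which the smallness of η turns into
  -- half of the information term.
  have hqsum : ∑ t ∈ Finset.Icc M T, -quadForm (H' t) v ≤ K * C * y + lam / 2 * y ^ 2 := by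
    have h1 : ∑ t ∈ Finset.Icc M T, -quadForm (H' t) v =
        ∑ t ∈ Finset.Icc M T, linForm (ψ t) v +
          ∑ t ∈ Finset.Icc M T, quadForm (fun k j => H t k j - H' t k j) v +
          ∑ t ∈ Finset.Icc M T, (g t - linForm (ψ t) v - quadForm (H t) v) -
          ∑ t ∈ Finset.Icc M T, g t := by
      rw [← Finset.sum_add_distrib, ← Finset.sum_add_distrib, ← Finset.sum_sub_distrib]
      refine Finset.sum_congr rfl fun t _ => ?_
      rw [quadForm_sub]
      ring
    have h2 : ∑ t ∈ Finset.Icc M T, (g t - linForm (ψ t) v - quadForm (H t) v) ≤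
        C * K ^ 3 * η * y ^ 2 := by
      calc _ ≤ ∑ t ∈ Finset.Icc M T, dm t * l1Norm v ^ 3 :=
            Finset.sum_le_sum fun t ht => (le_abs_self _).trans (hg t (hsub ht))
        _ ≤ C * K ^ 3 * (T * n1 ^ 3) := hRM
        _ = C * K ^ 3 * n1 * (T * n1 ^ 2) := by ring
        _ ≤ C * K ^ 3 * η * y ^ 2 := by
            rw [hTn2]
            gcongr
    have h3 : K ^ 2 * η * y ^ 2 + C * K ^ 3 * η * y ^ 2 ≤ lam / 2 * y ^ 2 := by
      rw [← add_mul]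
      exact mul_le_mul_of_nonneg_right hηlam (by positivity)
    rw [h1, hroot]
    linarith [(abs_le.1 hlinsum).2, (abs_le.1 hquadsum).2]
  -- Information is at least λy², so λy² ≤ KCy + λy²/2 and y ≤ 2KC/λ = c.
  have hyc : y ≤ c := by
    have h1 : lam * y ^ 2 ≤ K * C * y + lam / 2 * y ^ 2 := by
      rw [← hTn2]
      refine (hIlam.trans ((Finset.sum_le_sum fun t ht => hIH t (hsub ht)).trans hqsum)).trans ?_
      rw [hTn2]
    rcases hy0.eq_or_lt with h0 | h0
    · rw [← h0]; exact hc0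
    · have h2 : lam / 2 * y ≤ K * C := by
        have : y * (lam / 2 * y) ≤ y * (K * C) := by linarith
        exact le_of_mul_le_mul_left this h0
      rw [hc, le_div_iff₀ hlam]
      linarith
  have hy2c : y ^ 2 ≤ c ^ 2 := pow_le_pow_left₀ hy0 hyc 2
  have hy3c : y ^ 3 ≤ c ^ 3 := pow_le_pow_left₀ hy0 hyc 3
  have hqsumQ : ∑ t ∈ Finset.Icc M T, -quadForm (H' t) v ≤ Q := by
    refine hqsum.trans ?_
    rw [hQ]
    gcongr
  -- Each term dominates a nonnegative information form. Hence Q, which bounds the sum, bounds every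
  -- term, and no pointwise bound on H' is required.
  have hq0 : ∀ t ∈ Finset.Icc M T, 0 ≤ -quadForm (H' t) v := fun t ht =>
    (hI0 t (hsub ht)).trans (hIH t (hsub ht))
  have hR' : C * K ^ 3 * (T * n1 ^ 3) ≤ C * K ^ 3 * c ^ 3 :=
    mul_le_mul_of_nonneg_left (hTn3.trans hy3c) (by positivity)
  -- linear terms
  have hψt : ∀ t ∈ Finset.Icc 1 T, ∀ k, |ψ t k| ≤ C * r := by
    intro t ht k
    refine abs_le_of_sq_le_sq ?_ (by positivity)
    rw [mul_pow, hr2]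
    exact (Finset.single_le_sum (f := fun t => ψ t k ^ 2) (fun t _ => sq_nonneg _) ht).trans (hψ2 k)
  have hlint : ∀ t ∈ Finset.Icc 1 T, |linForm (ψ t) v| ≤ K * C * c := by
    intro t ht
    refine (abs_linForm_le (hψt t ht) v).trans ?_
    calc K * n1 * (C * r) = K * C * y := by rw [hy]; ring
      _ ≤ K * C * c := by gcongr
  have hlins : ∑ t ∈ Finset.Icc 1 T, |linForm (ψ t) v| ≤ K * C * c * r := by
    -- Cauchy–Schwarz on the sum of squares.
    have habs : ∀ k, ∑ t ∈ Finset.Icc 1 T, |ψ t k| ≤ C * T := by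
      intro k
      refine abs_le_of_sq_le_sq' ?_ (by positivity) |>.2
      have h1 := sq_sum_le_card_mul_sum_sq (s := Finset.Icc 1 T) (f := fun t => |ψ t k|)
      simp only [sq_abs, Nat.card_Icc, Nat.add_sub_cancel] at h1
      refine h1.trans ?_
      calc (T : ℝ) * ∑ t ∈ Finset.Icc 1 T, ψ t k ^ 2 ≤ T * (C ^ 2 * T) :=
            mul_le_mul_of_nonneg_left (hψ2 k) (by positivity)
        _ = (C * T) ^ 2 := by ring
    calc ∑ t ∈ Finset.Icc 1 T, |linForm (ψ t) v|
        ≤ ∑ t ∈ Finset.Icc 1 T, ∑ k, n1 * |ψ t k| := by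
          refine Finset.sum_le_sum fun t _ => ?_
          refine (Finset.abs_sum_le_sum_abs _ _).trans (Finset.sum_le_sum fun k _ => ?_)
          rw [abs_mul]
          exact mul_le_mul_of_nonneg_right (PiLp.norm_apply_le v k) (abs_nonneg _)
      _ = ∑ k : Fin K, n1 * ∑ t ∈ Finset.Icc 1 T, |ψ t k| := by
          rw [Finset.sum_comm]
          simp only [Finset.mul_sum]
      _ ≤ ∑ _k : Fin K, n1 * (C * T) :=
          Finset.sum_le_sum fun k _ => mul_le_mul_of_nonneg_left (habs k) hn0
      _ = K * C * y * r := by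
          rw [Finset.sum_const, Finset.card_univ, Fintype.card_fin, nsmul_eq_mul, hy, ← hr2]
          ring
      _ ≤ K * C * c * r := by gcongr
  -- quadratic terms
  set qb : ℕ → ℝ := fun t => if t < M then C * K ^ 2 * c ^ 2
    else -quadForm (H' t) v + K ^ 2 * c ^ 2 * η with hqb
  have hquadt : ∀ t ∈ Finset.Icc 1 T, |quadForm (H t) v| ≤ qb t := by
    intro t ht
    simp only [hqb]
    split_ifs with htM
    · refine (abs_quadForm_le (fun k j => hH0 k j t ht htM) v).trans ?_
      calc C * l1Norm v ^ 2 ≤ C * (K ^ 2 * n1 ^ 2) := mul_le_mul_of_nonneg_left hl2 hC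
        _ ≤ C * (K ^ 2 * c ^ 2) := by
            have := hn2y.trans hy2c
            gcongr
        _ = C * K ^ 2 * c ^ 2 := by ring
    -- For t ≥ M the form of H is that of H' up to the uniform deviation ηT, which multiplies ‖v‖²
    -- and so contributes only K²c²η. The finitely many earlier periods are not covered by the law
    -- of large numbers and use the crude bound C.
    · have htm : t ∈ Finset.Icc M T :=
        Finset.mem_Icc.2 ⟨not_lt.1 htM, (Finset.mem_Icc.1 ht).2⟩
      have h1 := (abs_quadForm_le (fun k j => hHm k j t htm) v)
      have h2 : η * T * l1Norm v ^ 2 ≤ K ^ 2 * c ^ 2 * η := by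
        calc η * T * l1Norm v ^ 2 ≤ η * T * (K ^ 2 * n1 ^ 2) :=
              mul_le_mul_of_nonneg_left hl2 (by positivity)
          _ = η * K ^ 2 * y ^ 2 := by rw [← hTn2]; ring
          _ ≤ η * K ^ 2 * c ^ 2 := by gcongr
          _ = K ^ 2 * c ^ 2 * η := by ring
      have h3 : quadForm (H t) v =
          quadForm (fun k j => H t k j - H' t k j) v - -quadForm (H' t) v := by
        rw [quadForm_sub]; ring
      have h4 := hq0 t htm
      calc |quadForm (H t) v| ≤ |quadForm (fun k j => H t k j - H' t k j) v| +
            |-quadForm (H' t) v| := by rw [h3]; exact abs_sub _ _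
        _ ≤ -quadForm (H' t) v + K ^ 2 * c ^ 2 * η := by
            rw [abs_of_nonneg h4]
            linarith
  have hqbt : ∀ t ∈ Finset.Icc 1 T, qb t ≤ Q + K ^ 2 * c ^ 2 + M * (C * K ^ 2 * c ^ 2) := by
    intro t ht
    have hMr : (1 : ℝ) ≤ M := by exact_mod_cast hM
    have h0 : (0 : ℝ) ≤ C * K ^ 2 * c ^ 2 := by positivity
    have h1 : C * K ^ 2 * c ^ 2 ≤ M * (C * K ^ 2 * c ^ 2) := by nlinarith
    have h2 : (0 : ℝ) ≤ K ^ 2 * c ^ 2 := by positivity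
    simp only [hqb]
    split_ifs with htM
    · linarith
    · have htm : t ∈ Finset.Icc M T :=
        Finset.mem_Icc.2 ⟨not_lt.1 htM, (Finset.mem_Icc.1 ht).2⟩
      have h3 : -quadForm (H' t) v ≤ Q :=
        (Finset.single_le_sum (f := fun t => -quadForm (H' t) v) hq0 htm).trans hqsumQ
      have h4 : K ^ 2 * c ^ 2 * η ≤ K ^ 2 * c ^ 2 := mul_le_of_le_one_right h2 hη1
      linarith
  have hqbs : ∑ t ∈ Finset.Icc 1 T, qb t ≤
      M * (C * K ^ 2 * c ^ 2) + Q + K ^ 2 * c ^ 2 * (η * T) := by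
    have hsplit : ∑ t ∈ Finset.Icc 1 T, qb t =
        ∑ t ∈ (Finset.Icc 1 T).filter (· < M), C * K ^ 2 * c ^ 2 +
        ∑ t ∈ (Finset.Icc 1 T).filter (fun t => ¬ t < M),
          (-quadForm (H' t) v + K ^ 2 * c ^ 2 * η) := Finset.sum_ite _ _
    have hcard1 : ((((Finset.Icc 1 T).filter (· < M)).card : ℕ) : ℝ) ≤ M := by
      have : ((Finset.Icc 1 T).filter (· < M)).card ≤ (Finset.range M).card :=
        Finset.card_le_card fun t ht => Finset.mem_range.2 (Finset.mem_filter.1 ht).2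
      rw [Finset.card_range] at this
      exact_mod_cast this
    have hfil : (Finset.Icc 1 T).filter (fun t => ¬ t < M) = Finset.Icc M T := by
      ext t
      simp only [Finset.mem_filter, Finset.mem_Icc, not_lt]
      omega
    have hcard2 : (((Finset.Icc M T).card : ℕ) : ℝ) ≤ T := by
      rw [Nat.card_Icc]
      exact_mod_cast (by omega : T + 1 - M ≤ T)
    rw [hsplit, hfil, Finset.sum_add_distrib, Finset.sum_const, Finset.sum_const, nsmul_eq_mul,
      nsmul_eq_mul]
    have h1 : ((((Finset.Icc 1 T).filter (· < M)).card : ℕ) : ℝ) * (C * K ^ 2 * c ^ 2) ≤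
        M * (C * K ^ 2 * c ^ 2) := mul_le_mul_of_nonneg_right hcard1 (by positivity)
    have h2 : (((Finset.Icc M T).card : ℕ) : ℝ) * (K ^ 2 * c ^ 2 * η) ≤
        T * (K ^ 2 * c ^ 2 * η) := mul_le_mul_of_nonneg_right hcard2 (by positivity)
    linarith
  have hxt : ∀ t ∈ Finset.Icc 1 T,
      |x t| ≤ |linForm (ψ t) v| + qb t + dm t * l1Norm v ^ 3 := by
    intro t ht
    have h1 := hx t ht
    have h2 := hquadt t ht
    have h3 : x t = (x t - linForm (ψ t) v - quadForm (H t) v / 2) +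
        (linForm (ψ t) v + quadForm (H t) v / 2) := by ring
    have h4 : |quadForm (H t) v / 2| ≤ |quadForm (H t) v| := by
      rw [abs_div, abs_two]
      linarith [abs_nonneg (quadForm (H t) v)]
    calc |x t| ≤ |x t - linForm (ψ t) v - quadForm (H t) v / 2| +
          |linForm (ψ t) v + quadForm (H t) v / 2| := by
            conv_lhs => rw [h3]
            exact abs_add_le _ _
      _ ≤ |x t - linForm (ψ t) v - quadForm (H t) v / 2| +
          (|linForm (ψ t) v| + |quadForm (H t) v / 2|) := by
            gcongr
            exact abs_add_le _ _
      _ ≤ _ := by linarith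
  constructor
  · intro t ht
    refine (hxt t ht).trans ?_
    rw [hY]
    linarith [hlint t ht, hqbt t ht, hRt t ht]
  · refine (Finset.sum_le_sum hxt).trans ?_
    rw [Finset.sum_add_distrib, Finset.sum_add_distrib]
    have hA : ∑ t ∈ Finset.Icc 1 T, |linForm (ψ t) v| + ∑ t ∈ Finset.Icc 1 T, qb t +
        ∑ t ∈ Finset.Icc 1 T, dm t * l1Norm v ^ 3 ≤
        K * C * c * r + (M * (C * K ^ 2 * c ^ 2) + Q + K ^ 2 * c ^ 2 * (η * T)) +
          C * K ^ 3 * c ^ 3 := by linarith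
    refine hA.trans ?_
    have h1 : (0 : ℝ) ≤ M * (C * K ^ 2 * c ^ 2) := by positivity
    have h2 : (0 : ℝ) ≤ C * K ^ 3 * c ^ 3 := by positivity
    have h3 : (0 : ℝ) ≤ K ^ 2 * c ^ 2 := by positivity
    have h4 : (0 : ℝ) ≤ K * C * c := by positivity
    have h5 : (0 : ℝ) ≤ η * T := by positivity
    -- Bounded terms are absorbed into Y√T because √T ≥ 1; only the deviation term grows linearly,
    -- with the small factor η.
    have h6 : K * C * c * r + (M * (C * K ^ 2 * c ^ 2) + Q) + C * K ^ 3 * c ^ 3 ≤ Y * r := by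
      rw [hY]
      nlinarith
    have h7 : K ^ 2 * c ^ 2 * (η * T) ≤ Y * (η * T) := by
      refine mul_le_mul_of_nonneg_right ?_ h5
      rw [hY]
      linarith
    linarith

end Rate

/-! ### Boundedness in probability of finite families and averages -/

section Tightness

variable {Ξ : Type*} {m0 : MeasurableSpace Ξ} {P : Measure Ξ}

lemma BddInProb.exists_common {ι : Type*} [Finite ι] {f : ι → ℕ → Ξ → ℝ}
    (h : ∀ i, BddInProb P (f i)) {η : ENNReal} (hη : 0 < η) :
    ∃ C : ℝ, 1 ≤ C ∧ ∀ᶠ T in atTop, P {ξ | ¬ ∀ i, f i T ξ ≤ C} ≤ η := by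
  cases nonempty_fintype ι
  -- Each index receives an equal share of η; the added one keeps the denominator nonzero for an
  -- empty family.
  have hη' : 0 < η / (Fintype.card ι + 1 : ℕ) :=
    ENNReal.div_pos hη.ne' (ENNReal.natCast_ne_top _)
  choose C hC1 hC using fun i => (h i).exists_ge hη' 1
  refine ⟨1 + ∑ i, C i, ?_, ?_⟩
  · linarith [Finset.sum_nonneg fun i (_ : i ∈ Finset.univ) => zero_le_one.trans (hC1 i)]
  · filter_upwards [eventually_all.2 hC] with T hT
    have hsub : {ξ | ¬ ∀ i, f i T ξ ≤ 1 + ∑ i, C i} ⊆ ⋃ i, {ξ | ¬ f i T ξ ≤ C i} := by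
      intro ξ hξ
      simp only [Set.mem_ofPred_eq, not_forall, Set.mem_iUnion] at hξ ⊢
      obtain ⟨i, hi⟩ := hξ
      refine ⟨i, fun hle => hi (hle.trans ?_)⟩
      have := Finset.single_le_sum (f := C) (fun i _ => zero_le_one.trans (hC1 i))
        (Finset.mem_univ i)
      linarith
    calc P {ξ | ¬ ∀ i, f i T ξ ≤ 1 + ∑ i, C i}
        ≤ ∑ i, P {ξ | ¬ f i T ξ ≤ C i} :=
          (measure_mono hsub).trans (measure_iUnion_fintype_le _ _)
      _ ≤ ∑ _i : ι, η / (Fintype.card ι + 1 : ℕ) := Finset.sum_le_sum fun i _ => hT i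
      _ = Fintype.card ι * (η / (Fintype.card ι + 1 : ℕ)) := by simp
      _ ≤ (Fintype.card ι + 1 : ℕ) * (η / (Fintype.card ι + 1 : ℕ)) := by
          gcongr; exact Nat.le_succ _
      _ ≤ η := ENNReal.mul_div_le

lemma tendsto_inv_mul_inProb [IsProbabilityMeasure P] {f : Ξ → ℝ} (hf : Integrable f P) :
    Tendsto (fun q : ℕ × Ξ => (q.1 : ℝ)⁻¹ * f q.2) (inProb P) (𝓝 0) := by
  refine tendsto_inProb_of_integral_abs (f := fun T ξ => (T : ℝ)⁻¹ * f ξ)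
    (fun T => hf.const_mul _) ?_
  have h : ∀ T : ℕ, ∫ ξ, |(T : ℝ)⁻¹ * f ξ| ∂P = (T : ℝ)⁻¹ * ∫ ξ, |f ξ| ∂P := by
    intro T
    rw [← integral_const_mul]
    refine integral_congr_ae (ae_of_all _ fun ξ => ?_)
    simp [abs_mul]
  simp only [h]
  simpa using (tendsto_inv_atTop_nhds_zero_nat (𝕜 := ℝ)).mul_const (∫ ξ, |f ξ| ∂P)

lemma bddInProb_avg_of_integral_le [IsProbabilityMeasure P] {dm : ℕ → Ξ → ℝ}
    (h0 : ∀ᵐ ξ ∂P, ∀ t, 1 ≤ t → 0 ≤ dm t ξ) (hi : ∀ t, 1 ≤ t → Integrable (dm t) P) {C : ℝ}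
    (hC : ∀ t, 1 ≤ t → ∫ ξ, dm t ξ ∂P ≤ C) :
    BddInProb P (fun T ξ => (T : ℝ)⁻¹ * ∑ t ∈ Finset.Icc 1 T, dm t ξ) := by
  have hi' : ∀ T : ℕ, ∀ t ∈ Finset.Icc 1 T, Integrable (dm t) P := fun T t ht =>
    hi t (Finset.mem_Icc.1 ht).1
  refine BddInProb.of_integral_le (c := C) (fun T => ?_)
    (fun T => (integrable_finsetSum _ (hi' T)).const_mul _) ?_
  · filter_upwards [h0] with ξ hξ
    exact mul_nonneg (by positivity)
      (Finset.sum_nonneg fun t ht => hξ t (Finset.mem_Icc.1 ht).1)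
  · filter_upwards [eventually_ge_atTop 1] with T hT
    have hT0 : (0 : ℝ) < T := by exact_mod_cast hT
    rw [integral_const_mul, integral_finsetSum _ (hi' T), inv_mul_le_iff₀ hT0]
    refine (Finset.sum_le_sum fun t ht => hC t (Finset.mem_Icc.1 ht).1).trans (le_of_eq ?_)
    simp

end Tightness

/-! ### Coercivity of positive definite forms -/

section PosDef

variable {K : ℕ}

lemma quadForm_eq_dotProduct (V : Matrix (Fin K) (Fin K) ℝ) (u : Param K) :
    quadForm V u = dotProduct (star (u : Fin K → ℝ)) (V.mulVec (u : Fin K → ℝ)) := by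
  simp only [quadForm, dotProduct, Matrix.mulVec, Finset.mul_sum, star_trivial]
  refine Finset.sum_congr rfl fun k _ => Finset.sum_congr rfl fun j _ => by ring

/-- The constant is the minimum of the form on the compact unit sphere, extended by homogeneity. In
dimension zero the sphere is empty and any constant works. -/
lemma exists_le_quadForm_of_posDef {V : Matrix (Fin K) (Fin K) ℝ} (hV : V.PosDef) :
    ∃ lam : ℝ, 0 < lam ∧ ∀ u : Param K, lam * ‖u‖ ^ 2 ≤ quadForm V u := by
  have hpos : ∀ u : Param K, u ≠ 0 → 0 < quadForm V u := by
    intro u hu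
    rw [quadForm_eq_dotProduct]
    refine hV.dotProduct_mulVec_pos fun h => hu ?_
    ext k
    exact congrFun h k
  rcases (Metric.sphere (0 : Param K) 1).eq_empty_or_nonempty with he | hne
  · refine ⟨1, one_pos, fun u => ?_⟩
    have hu : u = 0 := by
      by_contra hu
      have : (‖u‖⁻¹ • u) ∈ Metric.sphere (0 : Param K) 1 := by
        simp [norm_smul, hu]
      rw [he] at this
      exact this
    simp [hu, quadForm]
  · obtain ⟨u₀, hu₀, hmin⟩ := (isCompact_sphere (0 : Param K) 1).exists_isMinOn hne
      (continuous_quadForm V).continuousOn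
    have hu₀' : u₀ ≠ 0 := by
      rintro rfl
      simp at hu₀
    refine ⟨quadForm V u₀, hpos u₀ hu₀', fun u => ?_⟩
    by_cases hu : u = 0
    · simp [hu, quadForm]
    · have hn : ‖u‖ ≠ 0 := norm_ne_zero_iff.2 hu
      have hmem : (‖u‖⁻¹ • u) ∈ Metric.sphere (0 : Param K) 1 := by simp [norm_smul, hu]
      have h1 : quadForm V u₀ ≤ ‖u‖⁻¹ ^ 2 * quadForm V u :=
        (isMinOn_iff.1 hmin _ hmem).trans_eq (quadForm_smul V _ u)
      calc quadForm V u₀ * ‖u‖ ^ 2 ≤ (‖u‖⁻¹ ^ 2 * quadForm V u) * ‖u‖ ^ 2 :=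
            mul_le_mul_of_nonneg_right h1 (by positivity)
        _ = quadForm V u := by field_simp

end PosDef

/-! ### Stochastic inputs of the rate argument -/

namespace Model

variable {Ω 𝒰 𝒳 ℛ Ξ : Type*} [MeasurableSpace Ω] [MeasurableSpace 𝒰] [MeasurableSpace 𝒳]
  [MeasurableSpace ℛ] [MeasurableSpace Ξ] {p L K : ℕ} {D : Model Ω 𝒰 𝒳 ℛ Ξ p L K}
  {γstar : Param K} {M : ℕ} {P : Measure Ξ} {Vps : Matrix (Fin K) (Fin K) ℝ}

lemma ae_information_nonneg (h_ps : D.PropensityRegular P M γstar Vps) :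
    ∀ᵐ ξ ∂P, ∀ t, 1 ≤ t → ∀ u : Param K,
      0 ≤ quadForm (fun k j => (P[fun ξ' => D.score t γstar ξ' k * D.score t γstar ξ' j |
        D.fullSigma (t - M)]) ξ) u := by
  have h1 : ∀ t, 1 ≤ t → ∀ u : Param K, ∀ᵐ ξ ∂P,
      0 ≤ quadForm (fun k j => (P[fun ξ' => D.score t γstar ξ' k * D.score t γstar ξ' j |
        D.fullSigma (t - M)]) ξ) u := by
    intro t ht u
    have hscore : ∀ k, MemLp (fun ξ => D.score t γstar ξ k) 2 P := fun k =>
      (h_ps.square_integrable t ht).eval_piLp k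
    have hi1 : ∀ k j, Integrable (fun ξ => D.score t γstar ξ k * D.score t γstar ξ j) P :=
      fun k j => (hscore k).integrable_mul (hscore j)
    have h0 : 0 ≤ᵐ[P] P[fun ξ => quadForm
        (fun k j => D.score t γstar ξ k * D.score t γstar ξ j) u | D.fullSigma (t - M)] := by
      refine condExp_nonneg (ae_of_all _ fun ξ => ?_)
      exact (sq_nonneg _).trans_eq (linForm_sq (fun k => D.score t γstar ξ k) u)
    filter_upwards [h0, condExp_quadForm hi1 (D.fullSigma (t - M)) u] with ξ h2 h3
    rw [h3] at h2
    exact h2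
  have h2 : ∀ᵐ ξ ∂P, ∀ t, 1 ≤ t → ∀ n : ℕ,
      0 ≤ quadForm (fun k j => (P[fun ξ' => D.score t γstar ξ' k * D.score t γstar ξ' j |
        D.fullSigma (t - M)]) ξ) (TopologicalSpace.denseSeq (Param K) n) := by
    rw [ae_all_iff]
    intro t
    by_cases ht : 1 ≤ t
    · filter_upwards [ae_all_iff.2 fun n => h1 t ht (TopologicalSpace.denseSeq (Param K) n)]
        with ξ hξ _ n using hξ n
    · exact Eventually.of_forall fun ξ h => absurd h ht
  filter_upwards [h2] with ξ hξ t ht u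
  exact (TopologicalSpace.denseRange_denseSeq (Param K)).induction_on u
    (isClosed_le continuous_const (continuous_quadForm _)) (hξ t ht)

variable [IsProbabilityMeasure P]

/-- The diagonal of the convergent information matrix controls both the sum of squares and, as the
scores are centred given H*_{t-M}, the square of the sum. -/
lemma bddInProb_score (h_ps : D.PropensityRegular P M γstar Vps) (hM : 1 ≤ M)
    (h_unconf : D.Unconfounded P) (h_spec : D.CorrectlySpecified P γstar) (k : Fin K) :
    BddInProb P (fun T ξ => (T : ℝ)⁻¹ * ∑ t ∈ Finset.Icc 1 T, D.score t γstar ξ k ^ 2) ∧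
    BddInProb P (fun T ξ => (T : ℝ)⁻¹ * (∑ t ∈ Finset.Icc M T, D.score t γstar ξ k) ^ 2) := by
  refine bddInProb_of_condExp_sq (𝒢 := D.fullSigma) (v := Vps k k)
    (fun _ _ h => D.fullSigma_mono h) D.fullSigma_le hM
    (fun t ht => (h_ps.square_integrable t ht).eval_piLp k)
    (fun t ht => aestronglyMeasurable_score h_ps h_unconf h_spec (hM.trans ht) k)
    (fun t ht => condExp_score_eq_zero h_ps hM h_unconf h_spec (hM.trans ht) k) ?_
  refine (tendsto_inProb_iff.1 (h_ps.information k k)).congr fun q => ?_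
  simp [avg, condOuter, Matrix.sum_apply]

lemma scoreDeriv_lln (h_ps : D.PropensityRegular P M γstar Vps) (hM : 1 ≤ M)
    (h_unconf : D.Unconfounded P) (h_spec : D.CorrectlySpecified P γstar) (k j : Fin K) :
    Tendsto (fun q : ℕ × Ξ => (q.1 : ℝ)⁻¹ * ∑ t ∈ Finset.Icc M q.1,
      (D.scoreDeriv k j t γstar q.2 -
        (P[D.scoreDeriv k j t γstar | D.fullSigma (t - M)]) q.2)) (inProb P) (𝓝 0) ∧
    ∀ ε : ℝ, 0 < ε → ∀ᶠ q : ℕ × Ξ in inProb P, ∀ t ∈ Finset.Icc M q.1,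
      |D.scoreDeriv k j t γstar q.2 -
        (P[D.scoreDeriv k j t γstar | D.fullSigma (t - M)]) q.2| ≤ ε * q.1 := by
  obtain ⟨r, hr, hr2, hri, hrs⟩ := h_ps.deriv_variation k j
  have hintegrable := fun t (ht : M ≤ t) => h_ps.deriv_integrable k j t (hM.trans ht)
  refine lagged_lln_of_condExp_moments (𝒢 := D.fullSigma) (r := r)
    (D := fun t ξ => D.scoreDeriv k j t γstar ξ -
      (P[D.scoreDeriv k j t γstar | D.fullSigma (t - M)]) ξ)
    (fun _ _ h => D.fullSigma_mono h) D.fullSigma_le hr hr2 hM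
    (fun t ht => (hintegrable t ht).sub integrable_condExp)
    (fun t ht => (aestronglyMeasurable_scoreDeriv h_ps h_unconf h_spec (hM.trans ht) k j).sub
      (stronglyMeasurable_condExp.mono
        (D.fullSigma_mono (Nat.sub_le t M))).aestronglyMeasurable)
    (fun t ht => condExp_sub_condExp_ae_eq_zero (D.fullSigma_le _) (hintegrable t ht))
    (fun t ht => hri t (hM.trans ht)) ?_
  have hnn : ∀ᵐ ξ ∂P, ∀ n : ℕ, 0 ≤ (P[fun ξ' => |D.scoreDeriv k j (n + 1) γstar ξ' -
        (P[D.scoreDeriv k j (n + 1) γstar | D.fullSigma (n + 1 - M)]) ξ'| ^ r |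
          D.fullSigma (n + 1 - M)]) ξ :=
    ae_all_iff.2 fun n => condExp_nonneg (ae_of_all _ fun ξ => by positivity)
  filter_upwards [hrs, hnn] with ξ hs h0
  obtain ⟨S, hS⟩ := hs
  refine ⟨S, fun T => ?_⟩
  -- The series in the assumption is indexed by n = t - 1; as its terms are nonnegative, its total
  -- bounds all finite partial sums.
  refine le_trans ?_ (sum_le_hasSum ((Finset.Icc M T).image (· - 1))
    (fun n _ => mul_nonneg (by positivity) (h0 n)) hS)
  rw [Finset.sum_image fun a ha b hb hab => ?_]
  · refine (Finset.sum_congr rfl fun t ht => ?_).le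
    have : t - 1 + 1 = t := by have := (Finset.mem_Icc.1 ht).1; omega
    simp only [this]
  · simp only [Finset.coe_Icc, Set.mem_Icc] at ha hb
    have : a - 1 = b - 1 := hab
    omega

/-- The bound holds for all directions on one event, because it is applied to the random estimation
error. Entrywise convergence to a positive definite matrix suffices in finite dimension. -/
lemma eventually_information_ge (h_ps : D.PropensityRegular P M γstar Vps) (hM : 1 ≤ M) :
    ∃ lam : ℝ, 0 < lam ∧ ∀ᶠ q : ℕ × Ξ in inProb P, ∀ u : Param K,
      lam * (q.1 * ‖u‖ ^ 2) ≤ ∑ t ∈ Finset.Icc M q.1,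
        quadForm (fun k j => (P[fun ξ' => D.score t γstar ξ' k * D.score t γstar ξ' j |
          D.fullSigma (t - M)]) q.2) u := by
  obtain ⟨lam, hlam, hV⟩ := exists_le_quadForm_of_posDef h_ps.posDef
  set I : ℕ → Ξ → Fin K → Fin K → ℝ := fun t ξ k j =>
    (P[fun ξ' => D.score t γstar ξ' k * D.score t γstar ξ' j | D.fullSigma (t - M)]) ξ with hI
  have hlim : ∀ k j, Tendsto (fun q : ℕ × Ξ => (q.1 : ℝ)⁻¹ * ∑ t ∈ Finset.Icc M q.1, I t q.2 k j)
      (inProb P) (𝓝 (Vps k j)) := by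
    intro k j
    have h1 : Tendsto (fun q : ℕ × Ξ => (q.1 : ℝ)⁻¹ * ∑ t ∈ Finset.Icc 1 q.1, I t q.2 k j)
        (inProb P) (𝓝 (Vps k j)) := by
      refine (tendsto_inProb_iff.1 (h_ps.information k j)).congr fun q => ?_
      simp [avg, condOuter, Matrix.sum_apply, hI]
    -- The assumption averages from time 1 while the estimating equation starts at M; the fixed
    -- block in between disappears after division by T.
    have h2 := tendsto_inv_mul_inProb (P := P) (f := fun ξ => ∑ t ∈ Finset.Ico 1 M, I t ξ k j)
      (integrable_finsetSum _ fun t _ => integrable_condExp)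
    have h3 := h1.sub h2
    rw [sub_zero] at h3
    refine h3.congr' ?_
    filter_upwards [tendsto_fst_inProb.eventually (eventually_ge_atTop M)] with q hq
    rw [← mul_sub]
    congr 1
    rw [sub_eq_iff_eq_add, add_comm]
    have h4 := Finset.sum_Ico_consecutive (fun t => I t q.2 k j) hM (hq.trans (Nat.le_succ _))
    rw [← Finset.Ico_succ_right_eq_Icc, ← Finset.Ico_succ_right_eq_Icc]
    exact h4.symm
  -- The tolerance is chosen so that, by ‖u‖₁ ≤ K‖u‖, the entrywise error changes the form by at
  -- most half of λ‖u‖².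
  have hε : 0 < lam / (2 * (K ^ 2 + 1)) := by positivity
  refine ⟨lam / 2, by positivity, ?_⟩
  filter_upwards [eventually_all.2 fun k => eventually_all.2 fun j =>
    (Metric.tendsto_nhds.1 (hlim k j)) _ hε,
    tendsto_fst_inProb.eventually (eventually_ge_atTop 1)] with q hq hq1 u
  have hT : (0 : ℝ) < q.1 := by exact_mod_cast hq1
  rw [sum_quadForm]
  set S : Fin K → Fin K → ℝ := fun k j => (q.1 : ℝ)⁻¹ * ∑ t ∈ Finset.Icc M q.1, I t q.2 k j
  have h1 : quadForm (fun k j => ∑ t ∈ Finset.Icc M q.1, I t q.2 k j) u =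
      q.1 * quadForm S u := by
    simp only [quadForm, Finset.mul_sum, S]
    refine Finset.sum_congr rfl fun k _ => Finset.sum_congr rfl fun j _ => ?_
    rw [← Finset.mul_sum, ← Finset.mul_sum]
    field_simp
    rw [Finset.mul_sum]
  rw [h1]
  have h2 : |quadForm (fun k j => S k j - Vps k j) u| ≤
      lam / (2 * (K ^ 2 + 1)) * l1Norm u ^ 2 :=
    abs_quadForm_le (fun k j => (hq k j).le) u
  rw [quadForm_sub S (fun k j => Vps k j) u] at h2
  have h3 : lam / (2 * (K ^ 2 + 1)) * l1Norm u ^ 2 ≤ lam / 2 * ‖u‖ ^ 2 := by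
    calc lam / (2 * (K ^ 2 + 1)) * l1Norm u ^ 2 ≤ lam / (2 * (K ^ 2 + 1)) * (K * ‖u‖) ^ 2 :=
          mul_le_mul_of_nonneg_left (pow_le_pow_left₀ (l1Norm_nonneg u) (l1Norm_le u) 2) hε.le
      _ = (K ^ 2 / (K ^ 2 + 1)) * (lam / 2 * ‖u‖ ^ 2) := by field_simp
      _ ≤ lam / 2 * ‖u‖ ^ 2 := by
          refine mul_le_of_le_one_left (by positivity) ?_
          rw [div_le_one (by positivity)]
          linarith
  have h4 : lam / 2 * ‖u‖ ^ 2 ≤ quadForm S u := by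
    have := hV u
    have h5 : quadForm Vps u = quadForm (fun k j => Vps k j) u := rfl
    have h6 : quadForm S u = quadForm (fun k j => S k j) u := rfl
    rw [h5] at this
    rw [h6]
    linarith [(abs_le.1 h2).1]
  calc lam / 2 * (q.1 * ‖u‖ ^ 2) = q.1 * (lam / 2 * ‖u‖ ^ 2) := by ring
    _ ≤ q.1 * quadForm S u := mul_le_mul_of_nonneg_left h4 hT.le

end Model

/-! ### Log-propensity ratios at the estimator -/

namespace Model

variable {Ω 𝒰 𝒳 ℛ Ξ : Type*} [MeasurableSpace Ω] [MeasurableSpace 𝒰] [MeasurableSpace 𝒳]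
  [MeasurableSpace ℛ] [MeasurableSpace Ξ] {p L K : ℕ} {D : Model Ω 𝒰 𝒳 ℛ Ξ p L K}
  {γstar : Param K} {M : ℕ} {P : Measure Ξ} {Vps : Matrix (Fin K) (Fin K) ℝ}
  [IsProbabilityMeasure P]

/-- On events of probability close to one, the log-propensity ratios at a consistent root of the
estimating equation are positive, uniformly bounded and negligible on average. -/
lemma exists_good_logE (h_ps : D.PropensityRegular P M γstar Vps) (hM : 1 ≤ M)
    (h_unconf : D.Unconfounded P) (h_spec : D.CorrectlySpecified P γstar)
    {γhat : ℕ → Ξ → Param K} (h_root : D.ConsistentRoot P M γstar γhat)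
    {δ : ENNReal} (hδ : 0 < δ) :
    ∃ S : Set (ℕ × Ξ), (∀ᶠ T in atTop, P {ξ | (T, ξ) ∉ S} ≤ δ) ∧ ∃ Y : ℝ, 0 ≤ Y ∧
      (∀ᶠ q : ℕ × Ξ in inProb P ⊓ 𝓟 S, ∀ t ∈ Finset.Icc 1 q.1,
        0 < D.obsE t γstar q.2 ∧ 0 < D.obsE t (γhat q.1 q.2) q.2 ∧
        |D.logE t (γhat q.1 q.2) q.2 - D.logE t γstar q.2| ≤ Y) ∧
      Tendsto (fun q : ℕ × Ξ => (q.1 : ℝ)⁻¹ * ∑ t ∈ Finset.Icc 1 q.1,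
        |D.logE t (γhat q.1 q.2) q.2 - D.logE t γstar q.2|) (inProb P ⊓ 𝓟 S) (𝓝 0) := by
  obtain ⟨ε₀, hε₀, -, dm, hdmi, ⟨Cd, hCd⟩, htay⟩ := exists_taylor_logE h_ps h_unconf h_spec
  obtain ⟨lam, hlam, hinfo⟩ := eventually_information_ge (P := P) h_ps hM
  -- These are the quantities that are only bounded, not small: score squares, squared score sums,
  -- Taylor remainders and score derivatives of the first M periods. One constant for all of them
  -- defines the event S.
  have hb : ∀ i : (Fin K ⊕ Fin K) ⊕ Fin 2, BddInProb P
      (Sum.elim (Sum.elim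
        (fun k T ξ => (T : ℝ)⁻¹ * ∑ t ∈ Finset.Icc 1 T, D.score t γstar ξ k ^ 2)
        (fun k T ξ => (T : ℝ)⁻¹ * (∑ t ∈ Finset.Icc M T, D.score t γstar ξ k) ^ 2))
        ![fun T ξ => (T : ℝ)⁻¹ * ∑ t ∈ Finset.Icc 1 T, dm t ξ,
          fun _ ξ => ∑ t ∈ Finset.Icc 1 M, ∑ k, ∑ j, |D.scoreDeriv k j t γstar ξ|] i) := by
    rintro ((k | k) | i)
    · exact (bddInProb_score h_ps hM h_unconf h_spec k).1
    · exact (bddInProb_score h_ps hM h_unconf h_spec k).2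
    · fin_cases i
      · exact bddInProb_avg_of_integral_le (htay.mono fun ξ h t ht => (h t ht).1) hdmi hCd
      · exact BddInProb.of_integral_le (f := fun _ ξ => ∑ t ∈ Finset.Icc 1 M, ∑ k, ∑ j,
            |D.scoreDeriv k j t γstar ξ|)
          (fun _ => ae_of_all _ fun ξ => Finset.sum_nonneg fun t _ => Finset.sum_nonneg
            fun k _ => Finset.sum_nonneg fun j _ => abs_nonneg _)
          (fun _ => integrable_finsetSum _ fun t ht => integrable_finsetSum _ fun k _ =>
            integrable_finsetSum _ fun j _ =>
              (h_ps.deriv_integrable k j t (Finset.mem_Icc.1 ht).1).abs)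
          (Eventually.of_forall fun _ => le_rfl)
  obtain ⟨C, hC1, hC⟩ := BddInProb.exists_common hb hδ
  have hC0 : 0 ≤ C := zero_le_one.trans hC1
  -- The deterministic estimate expects C² for squares of scores and C otherwise; C ≥ 1 reconciles
  -- the two.
  have hCC : C ≤ C ^ 2 := by nlinarith
  refine ⟨{q | ∀ i : (Fin K ⊕ Fin K) ⊕ Fin 2, Sum.elim (Sum.elim
        (fun k (T : ℕ) ξ => (T : ℝ)⁻¹ * ∑ t ∈ Finset.Icc 1 T, D.score t γstar ξ k ^ 2)
        (fun k T ξ => (T : ℝ)⁻¹ * (∑ t ∈ Finset.Icc M T, D.score t γstar ξ k) ^ 2))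
        ![fun T ξ => (T : ℝ)⁻¹ * ∑ t ∈ Finset.Icc 1 T, dm t ξ,
          fun _ ξ => ∑ t ∈ Finset.Icc 1 M, ∑ k, ∑ j, |D.scoreDeriv k j t γstar ξ|] i q.1 q.2
          ≤ C}, hC, ?_⟩
  set S : Set (ℕ × Ξ) := {q | _}
  obtain ⟨c, hc⟩ : ∃ c : ℝ, c = 2 * K * C / lam := ⟨_, rfl⟩
  obtain ⟨Q, hQ⟩ : ∃ Q : ℝ, Q = K * C * c + lam / 2 * c ^ 2 := ⟨_, rfl⟩
  obtain ⟨Y, hY⟩ : ∃ Y : ℝ, Y = K * C * c + Q + K ^ 2 * c ^ 2 + M * (C * K ^ 2 * c ^ 2) +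
    C * K ^ 3 * c ^ 3 := ⟨_, rfl⟩
  have hc0 : 0 ≤ c := by rw [hc]; positivity
  have hQ0 : 0 ≤ Q := by rw [hQ]; positivity
  have hY0 : 0 ≤ Y := by rw [hY]; positivity
  have hη₀ : ∃ η₀ : ℝ, 0 < η₀ ∧ η₀ ≤ 1 ∧ η₀ < ε₀ ∧ K ^ 2 * η₀ + C * K ^ 3 * η₀ ≤ lam / 2 := by
    have hB : (0 : ℝ) < K ^ 2 + C * K ^ 3 + 1 := by positivity
    refine ⟨min (min 1 (ε₀ / 2)) (lam / 2 / (K ^ 2 + C * K ^ 3 + 1)), by positivity,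
      (min_le_left _ _).trans (min_le_left _ _),
      ((min_le_left _ _).trans (min_le_right _ _)).trans_lt (by linarith), ?_⟩
    set η₀ := min (min 1 (ε₀ / 2)) (lam / 2 / (K ^ 2 + C * K ^ 3 + 1))
    have h0 : 0 ≤ η₀ := by positivity
    have h1 : η₀ * (K ^ 2 + C * K ^ 3 + 1) ≤ lam / 2 :=
      (le_div_iff₀ hB).1 (min_le_right _ _)
    linarith
  obtain ⟨η₀, hη₀, hη₀1, hη₀ε, hη₀l⟩ := hη₀
  -- The set S and the constant Y do not depend on η. Consistency and the law of large numbers hold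
  -- at every precision η, so η may be sent to zero afterwards.
  have key : ∀ η : ℝ, 0 < η → η ≤ η₀ → ∀ᶠ q : ℕ × Ξ in inProb P ⊓ 𝓟 S,
      (∀ t ∈ Finset.Icc 1 q.1, 0 < D.obsE t γstar q.2 ∧ 0 < D.obsE t (γhat q.1 q.2) q.2 ∧
        |D.logE t (γhat q.1 q.2) q.2 - D.logE t γstar q.2| ≤ Y) ∧
      ∑ t ∈ Finset.Icc 1 q.1, |D.logE t (γhat q.1 q.2) q.2 - D.logE t γstar q.2| ≤
        Y * √q.1 + Y * (η * q.1) := by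
    intro η hη hηη
    have hlln1 : ∀ᶠ q : ℕ × Ξ in inProb P, ∀ k j, |(q.1 : ℝ)⁻¹ * ∑ t ∈ Finset.Icc M q.1,
        (D.scoreDeriv k j t γstar q.2 -
          (P[D.scoreDeriv k j t γstar | D.fullSigma (t - M)]) q.2)| < η := by
      refine eventually_all.2 fun k => eventually_all.2 fun j => ?_
      filter_upwards [Metric.tendsto_nhds.1 (scoreDeriv_lln h_ps hM h_unconf h_spec k j).1 η hη]
        with q hq
      simpa [Real.dist_eq] using hq
    have hlln2 : ∀ᶠ q : ℕ × Ξ in inProb P, ∀ k j, ∀ t ∈ Finset.Icc M q.1,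
        |D.scoreDeriv k j t γstar q.2 -
          (P[D.scoreDeriv k j t γstar | D.fullSigma (t - M)]) q.2| ≤ η * q.1 :=
      eventually_all.2 fun k => eventually_all.2 fun j =>
        (scoreDeriv_lln h_ps hM h_unconf h_spec k j).2 η hη
    have hroot : ∀ᶠ q : ℕ × Ξ in inProb P,
        ∑ t ∈ Finset.Icc M q.1, D.score t (γhat q.1 q.2) q.2 = 0 :=
      eventually_inProb.2 h_root.1
    have hcons : ∀ᶠ q : ℕ × Ξ in inProb P, ‖γhat q.1 q.2 - γstar‖ < η := by
      filter_upwards [Metric.tendsto_nhds.1 (tendsto_inProb_iff.1 h_root.2) η hη] with q hq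
      rwa [dist_eq_norm] at hq
    have hall : ∀ᶠ q : ℕ × Ξ in inProb P, q ∈ S →
        (∀ t ∈ Finset.Icc 1 q.1, 0 < D.obsE t γstar q.2 ∧
          0 < D.obsE t (γhat q.1 q.2) q.2 ∧
          |D.logE t (γhat q.1 q.2) q.2 - D.logE t γstar q.2| ≤ Y) ∧
        ∑ t ∈ Finset.Icc 1 q.1, |D.logE t (γhat q.1 q.2) q.2 - D.logE t γstar q.2| ≤
          Y * √q.1 + Y * (η * q.1) := by
      filter_upwards [hlln1, hlln2, hroot, hcons, hinfo,
        tendsto_fst_inProb.eventually (eventually_ge_atTop 1), eventually_inProb_of_ae htay,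
        eventually_inProb_of_ae (ae_obsE_pos h_unconf h_spec),
        eventually_inProb_of_ae (ae_information_nonneg h_ps),
        eventually_inProb_of_ae (ae_information_le h_ps hM h_unconf h_spec)]
        with q h1 h2 h3 h4 h5 hT h6 h7 h8 h9 hS
      have hTr : (0 : ℝ) < q.1 := by exact_mod_cast hT
      have h1le : ∀ t ∈ Finset.Icc 1 q.1, 1 ≤ t := fun t ht => (Finset.mem_Icc.1 ht).1
      obtain ⟨v, hv⟩ : ∃ v : Param K, v = γhat q.1 q.2 - γstar := ⟨_, rfl⟩
      have hγ : γhat q.1 q.2 = γstar + v := by rw [hv]; abel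
      rw [← hv] at h4
      rw [hγ] at h3 ⊢
      have htaylor := fun t ht => (h6 t (h1le t ht)).2 v (h4.trans_le (hηη.trans hη₀ε.le))
      have hscale : ∀ {a : ℝ}, (q.1 : ℝ)⁻¹ * a ≤ C → a ≤ C * q.1 := fun h => by
        rw [inv_mul_le_iff₀ hTr] at h
        linarith
      have hscale2 : ∀ {a : ℝ}, (q.1 : ℝ)⁻¹ * a ≤ C → a ≤ C ^ 2 * q.1 := fun h =>
        (hscale h).trans (mul_le_mul_of_nonneg_right hCC hTr.le)
      have hres := rate_and_expansion (x := fun t => D.logE t (γstar + v) q.2 - D.logE t γstar q.2)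
        (g := fun t => linForm (fun k => D.score t (γstar + v) q.2 k) v)
        (ψ := fun t k => D.score t γstar q.2 k)
        (H := fun t k j => D.scoreDeriv k j t γstar q.2)
        (H' := fun t k j => (P[D.scoreDeriv k j t γstar | D.fullSigma (t - M)]) q.2)
        (I := fun t k j => (P[fun ξ' => D.score t γstar ξ' k * D.score t γstar ξ' j |
          D.fullSigma (t - M)]) q.2)
        (dm := fun t => dm t q.2) (T := q.1) hM hT hlam hC0 (hηη.trans hη₀1)
        (le_trans (by gcongr) hη₀l) h4.le
        (by
          rw [sum_linForm]
          have h0 : ∀ k, ∑ t ∈ Finset.Icc M q.1, (D.score t (γstar + v) q.2 k) = 0 := by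
            intro k
            have := congrArg (fun u : Param K => u k) h3
            simpa using this
          simp [linForm, h0])
        (fun t ht => (htaylor t ht).2.1) (fun t ht => (htaylor t ht).2.2)
        (fun t ht => h8 t (h1le t ht) v) (fun t ht => h9 t (h1le t ht) v) (h5 v)
        (fun t ht => (h6 t (h1le t ht)).1) (hscale (hS (Sum.inr 0)))
        (fun k => hscale2 (hS (Sum.inl (Sum.inl k))))
        (fun k => hscale2 (hS (Sum.inl (Sum.inr k))))
        (fun k j => by
          have := (h1 k j).le
          rw [abs_mul, abs_of_pos (inv_pos.2 hTr), inv_mul_le_iff₀ hTr] at this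
          linarith)
        (fun k j t ht => h2 k j t ht)
        (fun k j t ht htM => by
          refine le_trans ?_ (hS (Sum.inr 1))
          refine le_trans ?_ (Finset.single_le_sum
            (f := fun t => ∑ k, ∑ j, |D.scoreDeriv k j t γstar q.2|)
            (fun t _ => Finset.sum_nonneg fun k _ => Finset.sum_nonneg fun j _ => abs_nonneg _)
            (Finset.mem_Icc.2 ⟨h1le t ht, htM.le⟩))
          refine le_trans ?_ (Finset.single_le_sum
            (f := fun k => ∑ j, |D.scoreDeriv k j t γstar q.2|)
            (fun k _ => Finset.sum_nonneg fun j _ => abs_nonneg _) (Finset.mem_univ k))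
          exact Finset.single_le_sum (f := fun j => |D.scoreDeriv k j t γstar q.2|)
            (fun j _ => abs_nonneg _) (Finset.mem_univ j))
        hc hQ hY
      exact ⟨fun t ht => ⟨h7 t (h1le t ht), (htaylor t ht).1, hres.1 t ht⟩, hres.2⟩
    exact eventually_inf_principal.2 hall
  refine ⟨Y, hY0, (key η₀ hη₀ le_rfl).mono fun q h => h.1, ?_⟩
  rw [Metric.tendsto_nhds]
  intro ε hε
  -- With this η and T ≥ (4(Y+1)/ε)², each of the two terms in `key` is at most εT/4.
  have hη1 : 0 < min η₀ (ε / (4 * (Y + 1))) := by positivity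
  have hfst : Tendsto (fun q : ℕ × Ξ => (q.1 : ℝ)) (inProb P ⊓ 𝓟 S) atTop :=
    (tendsto_natCast_atTop_atTop.comp tendsto_fst_inProb).mono_left inf_le_left
  filter_upwards [key _ hη1 (min_le_left _ _), hfst.eventually_gt_atTop 0,
    hfst.eventually_ge_atTop ((4 * (Y + 1) / ε) ^ 2)] with q hq hT hT2
  have hYp : 0 < Y + 1 := by linarith
  have hs : 4 * (Y + 1) / ε ≤ √q.1 := Real.le_sqrt_of_sq_le hT2
  have hs0 : 0 < √(q.1 : ℝ) := Real.sqrt_pos.2 hT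
  have hss : √(q.1 : ℝ) * √(q.1 : ℝ) = q.1 := Real.mul_self_sqrt hT.le
  rw [Real.dist_eq, sub_zero, abs_of_nonneg (by positivity), inv_mul_lt_iff₀ hT]
  refine hq.2.trans_lt ?_
  have h1 : 4 * (Y + 1) * √q.1 ≤ ε * q.1 := by
    rw [div_le_iff₀ hε] at hs
    calc 4 * (Y + 1) * √q.1 ≤ √q.1 * ε * √q.1 := mul_le_mul_of_nonneg_right hs hs0.le
      _ = ε * (√q.1 * √q.1) := by ring
      _ = ε * q.1 := by rw [hss]
  have h2 : min η₀ (ε / (4 * (Y + 1))) * (4 * (Y + 1)) ≤ ε :=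
    (le_div_iff₀ (by positivity)).1 (min_le_right _ _)
  have h3 : (min η₀ (ε / (4 * (Y + 1))) * (4 * (Y + 1))) * q.1 ≤ ε * q.1 :=
    mul_le_mul_of_nonneg_right h2 hT.le
  have h4 : 0 < min η₀ (ε / (4 * (Y + 1))) * q.1 := by positivity
  have h5 : 0 < ε * q.1 := by positivity
  nlinarith

end Model

/-! ### Consistency of averages of reweighted summands -/

section Weights

/-- Every period belongs to at most M windows. -/
lemma sum_window_le (M T : ℕ) {y : ℕ → ℝ} (hy : ∀ t, 0 ≤ y t) :
    ∑ t ∈ Finset.Icc M T, ∑ n ∈ Finset.Ico (t - M) t, y (n + 1) ≤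
      M * ∑ t ∈ Finset.Icc 1 T, y t := by
  have h1 : ∑ t ∈ Finset.Icc M T, ∑ n ∈ Finset.Ico (t - M) t, y (n + 1) =
      ∑ n ∈ Finset.range T, ∑ _t ∈ (Finset.Icc M T).filter (fun t => n ∈ Finset.Ico (t - M) t),
        y (n + 1) := by
    refine Finset.sum_comm' fun t n => ?_
    simp only [Finset.mem_Icc, Finset.mem_Ico, Finset.mem_filter, Finset.mem_range]
    omega
  have h2 : ∑ t ∈ Finset.Icc 1 T, y t = ∑ n ∈ Finset.range T, y (n + 1) := by
    rw [← Finset.Ico_succ_right_eq_Icc, Finset.sum_Ico_eq_sum_range]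
    refine Finset.sum_congr (by simp) fun n _ => by rw [add_comm]
  rw [h1, h2, Finset.mul_sum]
  refine Finset.sum_le_sum fun n _ => ?_
  rw [Finset.sum_const, nsmul_eq_mul]
  refine mul_le_mul_of_nonneg_right ?_ (hy _)
  have h3 : ((Finset.Icc M T).filter (fun t => n ∈ Finset.Ico (t - M) t)).card ≤
      (Finset.Ioc n (n + M)).card := by
    refine Finset.card_le_card fun t ht => ?_
    simp only [Finset.mem_Icc, Finset.mem_Ico, Finset.mem_filter, Finset.mem_Ioc] at ht ⊢
    omega
  rw [Nat.card_Ioc, Nat.add_sub_cancel_left] at h3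
  exact_mod_cast h3

lemma abs_exp_sub_one_le_exp_mul {s B : ℝ} (hs : |s| ≤ B) :
    |Real.exp s - 1| ≤ Real.exp B * |s| := by
  have hB : 0 ≤ B := (abs_nonneg s).trans hs
  have h1 := Real.add_one_le_exp s
  rcases le_or_gt 0 s with h0 | h0
  · have h2 := Real.add_one_le_exp (-s)
    have h3 : Real.exp s * Real.exp (-s) = 1 := by rw [← Real.exp_add]; simp
    have h4 : Real.exp s ≤ Real.exp B := Real.exp_le_exp.2 ((le_abs_self s).trans hs)
    rw [abs_of_nonneg h0, abs_of_nonneg (by linarith)]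
    have h5 := mul_le_mul_of_nonneg_left h2 (Real.exp_pos s).le
    have h6 := mul_le_mul_of_nonneg_right h4 h0
    linarith
  · have h2 : Real.exp s < 1 := Real.exp_lt_one_iff.2 h0
    have h3 := Real.one_le_exp hB
    rw [abs_of_neg h0, abs_of_neg (by linarith)]
    nlinarith

variable {Ξ : Type*} {l : Filter (ℕ × Ξ)}

/-- The uniform bound Y keeps the exponents in a compact interval, where exp s - 1 is at most a
constant times |s|. The summation over windows then returns the average of |x|, which vanishes. The
constant c is -1 for A_t and -2 for products of its entries. -/
lemma tendsto_avg_sub_of_weight {M : ℕ} (hM : 1 ≤ M) (hl : Tendsto Prod.fst l atTop)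
    {x : ℕ × Ξ → ℕ → ℝ} {Y : ℝ}
    (hb : ∀ᶠ q in l, ∀ t ∈ Finset.Icc 1 q.1, |x q t| ≤ Y)
    (h0 : Tendsto (fun q : ℕ × Ξ => (q.1 : ℝ)⁻¹ * ∑ t ∈ Finset.Icc 1 q.1, |x q t|) l (𝓝 0))
    (c : ℝ) {X Xhat : ℕ × Ξ → ℕ → ℝ} {C : ℝ} (hX : ∀ q t, M ≤ t → |X q t| ≤ C)
    (hXhat : ∀ᶠ q in l, ∀ t ∈ Finset.Icc M q.1,
      Xhat q t = Real.exp (c * ∑ n ∈ Finset.Ico (t - M) t, x q (n + 1)) * X q t) :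
    Tendsto (fun q : ℕ × Ξ => avg M q.1 fun t => Xhat q t - X q t) l (𝓝 0) := by
  set B : ℝ := |c| * (M * Y) with hB
  have hlim : Tendsto (fun q : ℕ × Ξ => M * (C * Real.exp B * |c| * M) *
      ((q.1 : ℝ)⁻¹ * ∑ t ∈ Finset.Icc 1 q.1, |x q t|)) l (𝓝 0) := by
    simpa using h0.const_mul (M * (C * Real.exp B * |c| * M))
  refine squeeze_zero_norm' ?_ hlim
  filter_upwards [hb, hXhat, hl.eventually (eventually_ge_atTop M)] with q hq hqX hqM
  have hC : 0 ≤ C := (abs_nonneg _).trans (hX q M le_rfl)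
  have hMr : (1 : ℝ) ≤ M := by exact_mod_cast hM
  have hTM : (M : ℝ) ≤ q.1 := by exact_mod_cast hqM
  have hden : (0 : ℝ) < (q.1 : ℝ) - M + 1 := by linarith
  have hT : (0 : ℝ) < q.1 := by linarith
  have hterm : ∀ t ∈ Finset.Icc M q.1, |Xhat q t - X q t| ≤
      C * Real.exp B * |c| * ∑ n ∈ Finset.Ico (t - M) t, |x q (n + 1)| := by
    intro t ht
    have htM := Finset.mem_Icc.1 ht
    have hs1 : |∑ n ∈ Finset.Ico (t - M) t, x q (n + 1)| ≤
        ∑ n ∈ Finset.Ico (t - M) t, |x q (n + 1)| := Finset.abs_sum_le_sum_abs _ _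
    have hs2 : ∑ n ∈ Finset.Ico (t - M) t, |x q (n + 1)| ≤ M * Y := by
      have h : ∑ n ∈ Finset.Ico (t - M) t, |x q (n + 1)| ≤ ∑ _n ∈ Finset.Ico (t - M) t, Y :=
        Finset.sum_le_sum fun n hn => hq (n + 1) (by
          have := Finset.mem_Ico.1 hn
          exact Finset.mem_Icc.2 (by omega))
      refine h.trans (le_of_eq ?_)
      rw [Finset.sum_const, Nat.card_Ico, nsmul_eq_mul, Nat.sub_sub_self htM.1]
    have hcs : |c * ∑ n ∈ Finset.Ico (t - M) t, x q (n + 1)| ≤ B := by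
      rw [abs_mul]
      exact mul_le_mul_of_nonneg_left (hs1.trans hs2) (abs_nonneg c)
    rw [hqX t ht, ← sub_one_mul, abs_mul]
    calc _ ≤ (Real.exp B * |c * ∑ n ∈ Finset.Ico (t - M) t, x q (n + 1)|) * C :=
          mul_le_mul (abs_exp_sub_one_le_exp_mul hcs) (hX q t htM.1) (abs_nonneg _)
            (by positivity)
      _ ≤ (Real.exp B * (|c| * ∑ n ∈ Finset.Ico (t - M) t, |x q (n + 1)|)) * C := by
          rw [abs_mul]
          gcongr
      _ = _ := by ring
  have hsum : ∑ t ∈ Finset.Icc M q.1, |Xhat q t - X q t| ≤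
      C * Real.exp B * |c| * (M * ∑ t ∈ Finset.Icc 1 q.1, |x q t|) := by
    refine (Finset.sum_le_sum hterm).trans ?_
    rw [← Finset.mul_sum]
    exact mul_le_mul_of_nonneg_left (sum_window_le M q.1 fun t => abs_nonneg (x q t))
      (by positivity)
  -- Equivalent to (M - 1)(T - M) ≥ 0.
  have hinv : ((q.1 : ℝ) - M + 1)⁻¹ ≤ M * (q.1 : ℝ)⁻¹ := by
    rw [inv_le_iff_one_le_mul₀ hden, mul_assoc, mul_comm, mul_assoc, inv_mul_eq_div,
      le_div_iff₀ hT]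
    nlinarith
  rw [avg, smul_eq_mul, Real.norm_eq_abs, abs_mul, abs_of_pos (inv_pos.2 hden)]
  calc _ ≤ (M * (q.1 : ℝ)⁻¹) * (C * Real.exp B * |c| * (M * ∑ t ∈ Finset.Icc 1 q.1, |x q t|)) :=
        mul_le_mul hinv ((Finset.abs_sum_le_sum_abs _ _).trans hsum) (abs_nonneg _)
          (by positivity)
    _ = _ := by ring

end Weights

namespace Model

variable {Ω 𝒰 𝒳 ℛ Ξ : Type*} [MeasurableSpace Ω] [MeasurableSpace 𝒰] [MeasurableSpace 𝒳]
  [MeasurableSpace ℛ] [MeasurableSpace Ξ] {p L K : ℕ} {D : Model Ω 𝒰 𝒳 ℛ Ξ p L K}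
  {γstar : Param K} {M : ℕ} {P : Measure Ξ} {Vps : Matrix (Fin K) (Fin K) ℝ}

lemma rho_eq_exp_mul (h : Intervention Ω D.ν) {t : ℕ} {ξ : Ξ} {γ : Param K}
    (hpos : ∀ n ∈ Finset.Ico (t - M) t, 0 < D.obsE (n + 1) γstar ξ ∧ 0 < D.obsE (n + 1) γ ξ) :
    D.rho M h t ξ γ = Real.exp (-1 * ∑ n ∈ Finset.Ico (t - M) t,
      (D.logE (n + 1) γ ξ - D.logE (n + 1) γstar ξ)) * D.rho M h t ξ γstar := by
  rw [Finset.mul_sum, Real.exp_sum, rho, rho, ← Finset.prod_mul_distrib]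
  refine Finset.prod_congr rfl fun n hn => ?_
  obtain ⟨h1, h2⟩ := hpos n hn
  have h3 : -1 * (D.logE (n + 1) γ ξ - D.logE (n + 1) γstar ξ) =
      Real.log (D.obsE (n + 1) γstar ξ) - Real.log (D.obsE (n + 1) γ ξ) := by
    simp only [logE]
    ring
  rw [h3, Real.exp_sub, Real.exp_log h1, Real.exp_log h2]
  have h4 : D.obsE (n + 1) γstar ξ = D.e n (D.obsHist n ξ) (D.W (n + 1) ξ) γstar := rfl
  have h5 : D.obsE (n + 1) γ ξ = D.e n (D.obsHist n ξ) (D.W (n + 1) ξ) γ := rfl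
  rw [h4] at h1 ⊢
  rw [h5] at h2 ⊢
  field_simp

/-- The factor relating the weights at the two parameters does not involve the intervention, and
every entry of A_t is linear in one weight. So the whole vector is rescaled by a single number. -/
lemma A_eq_exp_mul (h' h'' : Intervention Ω D.ν) {t : ℕ} {ξ : Ξ} {γ : Param K}
    (hpos : ∀ n ∈ Finset.Ico (t - M) t, 0 < D.obsE (n + 1) γstar ξ ∧ 0 < D.obsE (n + 1) γ ξ)
    (i : AIdx L) :
    D.A M h' h'' t γ ξ i = Real.exp (-1 * ∑ n ∈ Finset.Ico (t - M) t,
      (D.logE (n + 1) γ ξ - D.logE (n + 1) γstar ξ)) * D.A M h' h'' t γstar ξ i := by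
  rcases i with (i | i) | i
  · simp only [A, Sum.elim_inl, pseudo, Matrix.mulVec_smul, Pi.smul_apply, smul_eq_mul]
    rw [rho_eq_exp_mul h' hpos, mul_assoc]
  · simp only [A, Sum.elim_inl, Sum.elim_inr, pseudo, Matrix.mulVec_smul, Pi.smul_apply,
      smul_eq_mul]
    rw [rho_eq_exp_mul h'' hpos, mul_assoc]
  · fin_cases i
    · exact rho_eq_exp_mul h' hpos
    · exact rho_eq_exp_mul h'' hpos

variable [IsProbabilityMeasure P] {h' h'' : Intervention Ω D.ν} {γhat : ℕ → Ξ → Param K}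

lemma tendsto_avg_A_sub (h_ps : D.PropensityRegular P M γstar Vps) (hM : 1 ≤ M)
    (h_unconf : D.Unconfounded P) (h_spec : D.CorrectlySpecified P γstar)
    (ho' : D.Overlap γstar h') (ho'' : D.Overlap γstar h'')
    (h_ipw : D.IPWRegular P M h' h'' γstar)
    (h_root : D.ConsistentRoot P M γstar γhat) :
    (∀ i, Tendsto (fun q : ℕ × Ξ => avg M q.1 fun t =>
      D.A M h' h'' t (γhat q.1 q.2) q.2 i - D.A M h' h'' t γstar q.2 i) (inProb P) (𝓝 0)) ∧
    ∀ i k, Tendsto (fun q : ℕ × Ξ => avg M q.1 fun t =>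
      D.A M h' h'' t (γhat q.1 q.2) q.2 i * D.A M h' h'' t (γhat q.1 q.2) q.2 k -
        D.A M h' h'' t γstar q.2 i * D.A M h' h'' t γstar q.2 k) (inProb P) (𝓝 0) := by
  obtain ⟨C, hC0, hC⟩ := exists_abs_A_le hM h_spec.1 ho' ho'' h_ipw
  constructor
  · intro i
    refine tendsto_inProb_of_forall_good fun η hη => ?_
    obtain ⟨S, hS, Y, -, hb, h0⟩ := exists_good_logE h_ps hM h_unconf h_spec h_root hη
    refine ⟨S, hS, tendsto_avg_sub_of_weight hM (tendsto_fst_inProb.mono_left inf_le_left)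
      (hb.mono fun q hq t ht => (hq t ht).2.2) h0 (-1) (C := C)
      (fun q t ht => hC t ht q.2 i) ?_⟩
    filter_upwards [hb] with q hq t ht
    refine A_eq_exp_mul h' h'' (fun n hn => ?_) i
    have h1 := Finset.mem_Icc.1 ht
    have h2 := Finset.mem_Ico.1 hn
    have h3 := hq (n + 1) (Finset.mem_Icc.2 (by omega))
    exact ⟨h3.1, h3.2.1⟩
  · intro i k
    refine tendsto_inProb_of_forall_good fun η hη => ?_
    obtain ⟨S, hS, Y, -, hb, h0⟩ := exists_good_logE h_ps hM h_unconf h_spec h_root hη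
    refine ⟨S, hS, tendsto_avg_sub_of_weight hM (tendsto_fst_inProb.mono_left inf_le_left)
      (hb.mono fun q hq t ht => (hq t ht).2.2) h0 (-2) (C := C * C) (fun q t ht => ?_) ?_⟩
    · rw [abs_mul]
      exact mul_le_mul (hC t ht q.2 i) (hC t ht q.2 k) (abs_nonneg _) hC0
    filter_upwards [hb] with q hq t ht
    have hpos : ∀ n ∈ Finset.Ico (t - M) t, 0 < D.obsE (n + 1) γstar q.2 ∧
        0 < D.obsE (n + 1) (γhat q.1 q.2) q.2 := by
      intro n hn
      have h1 := Finset.mem_Icc.1 ht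
      have h2 := Finset.mem_Ico.1 hn
      have h3 := hq (n + 1) (Finset.mem_Icc.2 (by omega))
      exact ⟨h3.1, h3.2.1⟩
    rw [A_eq_exp_mul h' h'' hpos i, A_eq_exp_mul h' h'' hpos k, mul_mul_mul_comm, ← Real.exp_add]
    congr 2
    ring

end Model

/-! ### Limits of sandwich products -/

section Sandwich

open Asymptotics

variable {α ι κ o : Type*} [Fintype κ] {l : Filter α}

lemma isBigO_one_matrix_mul {A : α → Matrix ι κ ℝ} {B : α → Matrix κ o ℝ}
    (hA : ∀ i j, (fun q => A q i j) =O[l] fun _ => (1 : ℝ))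
    (hB : ∀ i j, (fun q => B q i j) =O[l] fun _ => (1 : ℝ)) (i : ι) (k : o) :
    (fun q => (A q * B q) i k) =O[l] fun _ => (1 : ℝ) := by
  have h : (∑ j, fun q => A q i j * B q j k) =O[l] fun _ => (1 : ℝ) :=
    IsBigO.sum fun j _ => ((hA i j).mul (hB j k)).congr_right fun _ => one_mul 1
  exact h.congr_left fun q => by simp [Finset.sum_apply, Matrix.mul_apply]

lemma isLittleO_one_matrix_mul_left {A : α → Matrix ι κ ℝ} {B : α → Matrix κ o ℝ}
    (hA : ∀ i j, (fun q => A q i j) =o[l] fun _ => (1 : ℝ))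
    (hB : ∀ i j, (fun q => B q i j) =O[l] fun _ => (1 : ℝ)) (i : ι) (k : o) :
    (fun q => (A q * B q) i k) =o[l] fun _ => (1 : ℝ) := by
  have h : (∑ j, fun q => A q i j * B q j k) =o[l] fun _ => (1 : ℝ) :=
    IsLittleO.sum fun j _ => ((hA i j).mul_isBigO (hB j k)).congr_right fun _ => one_mul 1
  exact h.congr_left fun q => by simp [Finset.sum_apply, Matrix.mul_apply]

lemma isLittleO_one_matrix_mul_right {A : α → Matrix ι κ ℝ} {B : α → Matrix κ o ℝ}
    (hA : ∀ i j, (fun q => A q i j) =O[l] fun _ => (1 : ℝ))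
    (hB : ∀ i j, (fun q => B q i j) =o[l] fun _ => (1 : ℝ)) (i : ι) (k : o) :
    (fun q => (A q * B q) i k) =o[l] fun _ => (1 : ℝ) := by
  have h : (∑ j, fun q => A q i j * B q j k) =o[l] fun _ => (1 : ℝ) :=
    IsLittleO.sum fun j _ => ((hA i j).mul_isLittleO (hB j k)).congr_right fun _ => one_mul 1
  exact h.congr_left fun q => by simp [Finset.sum_apply, Matrix.mul_apply]

/-- J is bounded without converging, so the limit cannot be taken factor by factor. With W = Q V̂ Qᵀ
→ V, the difference telescopes into (Ĵ - J) W Ĵᵀ + J (W - V) Ĵᵀ + J V (Ĵ - J)ᵀ, and each product has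
one vanishing factor. -/
lemma tendsto_sandwich_sub [DecidableEq κ] {J Jhat : α → Matrix ι κ ℝ} {Q Vhat : α → Matrix κ κ ℝ}
    {V : Matrix κ κ ℝ} (hJ : ∀ i j, (fun q => J q i j) =O[l] fun _ => (1 : ℝ))
    (hJhat : ∀ i j, Tendsto (fun q => Jhat q i j - J q i j) l (𝓝 0))
    (hQ : ∀ i j, Tendsto (fun q => Q q i j) l (𝓝 ((1 : Matrix κ κ ℝ) i j)))
    (hV : ∀ i j, Tendsto (fun q => Vhat q i j) l (𝓝 (V i j))) (i k : ι) :
    Tendsto (fun q => (Jhat q * Q q * Vhat q * (Q q).transpose * (Jhat q).transpose -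
      J q * V * (J q).transpose) i k) l (𝓝 0) := by
  have hQ' : Tendsto Q l (𝓝 1) := tendsto_pi_nhds.2 fun i => tendsto_pi_nhds.2 fun j => hQ i j
  have hV' : Tendsto Vhat l (𝓝 V) := tendsto_pi_nhds.2 fun i => tendsto_pi_nhds.2 fun j => hV i j
  set W : α → Matrix κ κ ℝ := fun q => Q q * Vhat q * (Q q).transpose with hW
  have hcont : Continuous fun p : Matrix κ κ ℝ × Matrix κ κ ℝ => p.1 * p.2 * p.1.transpose := by
    fun_prop
  have hWlim : Tendsto W l (𝓝 V) := by
    have := (hcont.tendsto (1, V)).comp (hQ'.prodMk_nhds hV')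
    simp only [one_mul, Matrix.transpose_one, mul_one] at this
    exact this
  have hWij : ∀ i j, Tendsto (fun q => W q i j) l (𝓝 (V i j)) := fun i j =>
    tendsto_pi_nhds.1 (tendsto_pi_nhds.1 hWlim i) j
  have hE : ∀ i j, (fun q => (Jhat q - J q) i j) =o[l] fun _ => (1 : ℝ) := fun i j =>
    (isLittleO_one_iff ℝ).2 (hJhat i j)
  have hWO : ∀ i j, (fun q => W q i j) =O[l] fun _ => (1 : ℝ) := fun i j =>
    (hWij i j).isBigO_one ℝ
  have hWV : ∀ i j, (fun q => (W q - V) i j) =o[l] fun _ => (1 : ℝ) := fun i j => by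
    refine (isLittleO_one_iff ℝ).2 ?_
    simpa using (hWij i j).sub_const (V i j)
  have hJhatO : ∀ i j, (fun q => Jhat q i j) =O[l] fun _ => (1 : ℝ) := fun i j => by
    have := (hJ i j).add (hE i j).isBigO
    simpa using this
  have hVO : ∀ i j, (fun _ : α => V i j) =O[l] fun _ => (1 : ℝ) := fun i j =>
    tendsto_const_nhds.isBigO_one ℝ
  have h1 := isLittleO_one_matrix_mul_left (isLittleO_one_matrix_mul_left hE hWO)
    (B := fun q => (Jhat q).transpose) (fun i j => hJhatO j i) i k
  have h2 := isLittleO_one_matrix_mul_left (isLittleO_one_matrix_mul_right hJ hWV)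
    (B := fun q => (Jhat q).transpose) (fun i j => hJhatO j i) i k
  have h3 := isLittleO_one_matrix_mul_right (isBigO_one_matrix_mul hJ hVO)
    (B := fun q => (Jhat q - J q).transpose) (fun i j => hE j i) i k
  refine ((isLittleO_one_iff ℝ).1 ((h1.add h2).add h3)).congr fun q => ?_
  have : Jhat q * Q q * Vhat q * (Q q).transpose * (Jhat q).transpose -
      J q * V * (J q).transpose = (Jhat q - J q) * W q * (Jhat q).transpose +
        J q * (W q - V) * (Jhat q).transpose + J q * V * (Jhat q - J q).transpose := by
    simp only [hW, Matrix.sub_mul, Matrix.mul_sub, Matrix.transpose_sub, Matrix.mul_assoc]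
    abel
  rw [this]
  rfl

end Sandwich

/-! ### Boundedness and perturbation of the row block J -/

section Jacobian

open Asymptotics

variable {α : Type*} {L : ℕ} {l : Filter α} {b' b'' c' c'' : α → Fin L → ℝ}

lemma jacobian_isBigO_one (hb' : ∀ i, (fun q => b' q i) =O[l] fun _ => (1 : ℝ))
    (hb'' : ∀ i, (fun q => b'' q i) =O[l] fun _ => (1 : ℝ)) (i : Fin L) (j : AIdx L) :
    (fun q => jacobian (b' q) (b'' q) i j) =O[l] fun _ => (1 : ℝ) := by
  rcases j with (j | j) | j
  · exact (tendsto_const_nhds (x := (1 : Matrix (Fin L) (Fin L) ℝ) i j)).isBigO_one ℝ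
  · exact (tendsto_const_nhds (x := -(1 : Matrix (Fin L) (Fin L) ℝ) i j)).isBigO_one ℝ
  · fin_cases j
    · exact (hb' i).neg_left
    · exact hb'' i

lemma tendsto_jacobian_sub (h' : ∀ i, Tendsto (fun q => c' q i - b' q i) l (𝓝 0))
    (h'' : ∀ i, Tendsto (fun q => c'' q i - b'' q i) l (𝓝 0)) (i : Fin L) (j : AIdx L) :
    Tendsto (fun q => jacobian (c' q) (c'' q) i j - jacobian (b' q) (b'' q) i j) l (𝓝 0) := by
  rcases j with (j | j) | j
  · simp [jacobian, tendsto_const_nhds]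
  · simp [jacobian, tendsto_const_nhds]
  · fin_cases j
    · have := (h' i).neg
      rw [neg_zero] at this
      refine this.congr fun q => ?_
      simp [jacobian]
      ring
    · exact h'' i

end Jacobian

/-! ### Arithmetic of time averages -/

section Averages

lemma avg_apply {ι : Type*} (M T : ℕ) (g : ℕ → ι → ℝ) (i : ι) :
    (avg M T g) i = avg M T fun t => g t i := by
  simp [avg]

lemma avg_sub (M T : ℕ) (f g : ℕ → ℝ) :
    (avg M T fun t => f t - g t) = avg M T f - avg M T g := by
  simp [avg, mul_sub]

lemma avg_sum {ι : Type*} (s : Finset ι) (M T : ℕ) (f : ι → ℕ → ℝ) :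
    (avg M T fun t => ∑ i ∈ s, f i t) = ∑ i ∈ s, avg M T (f i) := by
  simp only [avg, smul_eq_mul]
  rw [Finset.sum_comm, Finset.mul_sum]

lemma avg_const_mul (M T : ℕ) (c : ℝ) (f : ℕ → ℝ) :
    (avg M T fun t => c * f t) = c * avg M T f := by
  simp only [avg, smul_eq_mul, ← Finset.mul_sum]
  ring

lemma avg_congr {M T : ℕ} {f g : ℕ → ℝ} (h : ∀ t, M ≤ t → f t = g t) : avg M T f = avg M T g := by
  simp only [avg]
  rw [Finset.sum_congr rfl fun t ht => h t (Finset.mem_Icc.1 ht).1]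

lemma avg_const {M T : ℕ} (h : M ≤ T) (c : ℝ) : (avg M T fun _ => c) = c := by
  have h1 : (0 : ℝ) < (T : ℝ) - M + 1 := by
    have : (M : ℝ) ≤ T := by exact_mod_cast h
    linarith
  rw [avg, Finset.sum_const, ← Nat.cast_smul_eq_nsmul ℝ, cast_card_Icc h, smul_eq_mul, smul_eq_mul]
  field_simp

lemma abs_avg_le {M T : ℕ} (h : M ≤ T) {f : ℕ → ℝ} {C : ℝ} (hf : ∀ t, M ≤ t → |f t| ≤ C) :
    |avg M T f| ≤ C := by
  have h1 : (0 : ℝ) < (T : ℝ) - M + 1 := by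
    have : (M : ℝ) ≤ T := by exact_mod_cast h
    linarith
  rw [← avg_const h C, avg, avg, smul_eq_mul, smul_eq_mul, abs_mul, abs_of_pos (inv_pos.2 h1)]
  exact mul_le_mul_of_nonneg_left ((Finset.abs_sum_le_sum_abs _ _).trans
    (Finset.sum_le_sum fun t ht => hf t (Finset.mem_Icc.1 ht).1)) (inv_pos.2 h1).le

lemma avg_nonneg {M T : ℕ} (h : M ≤ T) {f : ℕ → ℝ} (hf : ∀ t, 0 ≤ f t) : 0 ≤ avg M T f := by
  have h1 : (0 : ℝ) < (T : ℝ) - M + 1 := by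
    have : (M : ℝ) ≤ T := by exact_mod_cast h
    linarith
  exact mul_nonneg (inv_pos.2 h1).le (Finset.sum_nonneg fun t _ => hf t)

end Averages

/-- The sections of the empty set have failure probability one. Nontriviality permits uniqueness of
limits and passage of inequalities to the limit. -/
instance inProb_neBot {Ξ : Type*} {m0 : MeasurableSpace Ξ} (P : Measure Ξ)
    [IsProbabilityMeasure P] : (inProb P).NeBot := by
  rw [neBot_iff]
  intro h
  have h1 : (∅ : Set (ℕ × Ξ)) ∈ inProb P := by
    rw [h]
    exact mem_bot
  rw [mem_inProb] at h1
  have h2 : ∀ T : ℕ, P {ξ : Ξ | (T, ξ) ∉ (∅ : Set (ℕ × Ξ))} = 1 := fun T => by simp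
  simp only [h2] at h1
  exact one_ne_zero (tendsto_nhds_unique tendsto_const_nhds h1)

/-- Since a/r - b = (a - b)/r + b(1/r - 1), boundedness of b is enough; it need not converge. -/
lemma tendsto_div_sub_of_tendsto_one {α : Type*} {l : Filter α} {a b r : α → ℝ}
    (hab : Tendsto (fun q => a q - b q) l (𝓝 0)) (hb : b =O[l] fun _ => (1 : ℝ))
    (hr : Tendsto r l (𝓝 1)) : Tendsto (fun q => a q / r q - b q) l (𝓝 0) := by
  have h1 : Tendsto (fun q => (r q)⁻¹) l (𝓝 1) := by simpa using hr.inv₀ one_ne_zero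
  have h2 : Tendsto (fun q => b q * ((r q)⁻¹ - 1)) l (𝓝 0) := by
    have h3 : (fun q => (r q)⁻¹ - 1) =o[l] fun _ => (1 : ℝ) :=
      (Asymptotics.isLittleO_one_iff ℝ).2 (by simpa using h1.sub_const 1)
    exact (Asymptotics.isLittleO_one_iff ℝ).1
      ((hb.mul_isLittleO h3).congr_right fun _ => one_mul 1)
  have h4 := (hab.mul h1).add h2
  rw [zero_mul, add_zero] at h4
  refine h4.congr fun q => ?_
  rw [div_eq_mul_inv]
  ring

/-! ### Consistency of the plug-in averages and the variance comparison -/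

namespace Model

variable {Ω 𝒰 𝒳 ℛ Ξ : Type*} [MeasurableSpace Ω] [MeasurableSpace 𝒰] [MeasurableSpace 𝒳]
  [MeasurableSpace ℛ] [MeasurableSpace Ξ] {p L K : ℕ} {D : Model Ω 𝒰 𝒳 ℛ Ξ p L K}
  {γstar : Param K} {M : ℕ} {P : Measure Ξ} {Vps : Matrix (Fin K) (Fin K) ℝ}
  {h' h'' : Intervention Ω D.ν} {γhat : ℕ → Ξ → Param K}

/-- The Hájek normalization is common to all periods and leaves the average as a scalar. -/
lemma avg_proj_hajekPseudo (h : Intervention Ω D.ν) (T : ℕ) (γ : Param K) (ξ : Ξ) (l : Fin L) :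
    (avg M T fun t => (D.proj M t ξ).mulVec (D.hajekPseudo M h T t ξ γ)) l =
      (avg M T fun t => (D.proj M t ξ).mulVec (D.pseudo M h t ξ γ)) l /
        avg M T fun t => D.rho M h t ξ γ := by
  rw [avg_apply, avg_apply]
  simp only [hajekPseudo, pseudo, Matrix.mulVec_smul, Pi.smul_apply, smul_eq_mul]
  set R := avg M T fun t => D.rho M h t ξ γ
  simp only [avg, smul_eq_mul]
  rw [mul_div_assoc, Finset.sum_div]
  congr 1
  refine Finset.sum_congr rfl fun t _ => by ring

lemma isBigO_avg_beta (hM : 1 ≤ M) (h_ipw : D.IPWRegular P M h' h'' γstar)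
    (h : Intervention Ω D.ν) (l : Fin L) :
    (fun q : ℕ × Ξ => (avg M q.1 fun t => D.beta M h t q.2) l) =O[inProb P]
      fun _ => (1 : ℝ) := by
  obtain ⟨C, hC0, hC⟩ := exists_abs_beta_le hM h_ipw
  refine Asymptotics.IsBigO.of_bound C ?_
  filter_upwards [tendsto_fst_inProb.eventually (eventually_ge_atTop M)] with q hq
  rw [avg_apply, norm_one, mul_one]
  exact abs_avg_le hq fun t ht => hC h t ht q.2 l

variable [IsProbabilityMeasure P]

/-- Consistency of the average of `A_t` at `γhat` for the average conditional mean. -/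
lemma tendsto_avg_A_sub_meanVec (h_ps : D.PropensityRegular P M γstar Vps) (hM : 1 ≤ M)
    (h_unconf : D.Unconfounded P) (h_spec : D.CorrectlySpecified P γstar)
    (ho' : D.Overlap γstar h') (ho'' : D.Overlap γstar h'')
    (h_ipw : D.IPWRegular P M h' h'' γstar)
    (h_root : D.ConsistentRoot P M γstar γhat) (i : AIdx L) :
    Tendsto (fun q : ℕ × Ξ => (avg M q.1 fun t => D.A M h' h'' t (γhat q.1 q.2) q.2 i) -
      avg M q.1 fun t => D.meanVec M h' h'' t q.2 i) (inProb P) (𝓝 0) := by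
  obtain ⟨C, hC0, hC⟩ := exists_abs_A_le hM h_spec.1 ho' ho'' h_ipw
  have h1 := (tendsto_avg_A_sub h_ps hM h_unconf h_spec ho' ho'' h_ipw h_root).1 i
  have h2 := tendsto_avg_sub_condExp_of_bounded (P := P) (𝒢 := D.fullSigma) (M := M)
    (X := fun t ξ => D.A M h' h'' t γstar ξ i) (fun _ _ h => D.fullSigma_mono h) D.fullSigma_le
    (fun t _ => (measurable_A h_spec.1 h' h'' M t i).stronglyMeasurable)
    (fun t ht ξ => hC t ht ξ i)
  have hae : ∀ᵐ ξ ∂P, ∀ t, M ≤ t →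
      (P[fun ξ' => D.A M h' h'' t γstar ξ' i | D.fullSigma (t - M)]) ξ =
        D.meanVec M h' h'' t ξ i := by
    rw [ae_all_iff]
    intro t
    by_cases ht : M ≤ t
    · filter_upwards [condExp_A hM h_unconf h_spec ho' ho'' h_ipw ht i] with ξ hξ _ using hξ
    · exact Eventually.of_forall fun ξ h => absurd h ht
  have h3 := h1.add h2
  rw [add_zero] at h3
  refine h3.congr' ?_
  filter_upwards [eventually_inProb_of_ae hae] with q hq
  rw [avg_sub, avg_sub, avg_congr hq]
  ring

/-- Consistency of the average of `A_t A_tᵀ` at `γhat`. -/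
lemma tendsto_Vhat (h_ps : D.PropensityRegular P M γstar Vps) (hM : 1 ≤ M)
    (h_unconf : D.Unconfounded P) (h_spec : D.CorrectlySpecified P γstar)
    (ho' : D.Overlap γstar h') (ho'' : D.Overlap γstar h'')
    (h_ipw : D.IPWRegular P M h' h'' γstar)
    (h_root : D.ConsistentRoot P M γstar γhat) {Vstar : Matrix (AIdx L) (AIdx L) ℝ}
    (h_star : D.IsVarianceBound P M h' h'' γstar Vstar) (i k : AIdx L) :
    Tendsto (fun q : ℕ × Ξ => D.Vhat M h' h'' q.1 (γhat q.1 q.2) q.2 i k) (inProb P)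
      (𝓝 (Vstar i k)) := by
  obtain ⟨C, hC0, hC⟩ := exists_abs_A_le hM h_spec.1 ho' ho'' h_ipw
  have h1 := (tendsto_avg_A_sub h_ps hM h_unconf h_spec ho' ho'' h_ipw h_root).2 i k
  have h2 := tendsto_avg_sub_condExp_of_bounded (P := P) (𝒢 := D.fullSigma) (M := M)
    (X := fun t ξ => D.A M h' h'' t γstar ξ i * D.A M h' h'' t γstar ξ k) (C := C * C)
    (fun _ _ h => D.fullSigma_mono h) D.fullSigma_le
    (fun t _ => ((measurable_A h_spec.1 h' h'' M t i).mul
      (measurable_A h_spec.1 h' h'' M t k)).stronglyMeasurable)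
    (fun t ht ξ => by
      rw [abs_mul]
      exact mul_le_mul (hC t ht ξ i) (hC t ht ξ k) (abs_nonneg _) hC0)
  have h3 := (h1.add h2).add (tendsto_inProb_iff.1 (h_star i k))
  rw [add_zero, zero_add] at h3
  refine h3.congr fun q => ?_
  have h4 : (avg M q.1 fun t => condOuter P (D.fullSigma (t - M)) (D.A M h' h'' t γstar)
      (D.A M h' h'' t γstar) q.2) i k = avg M q.1 fun t =>
        (P[fun ξ => D.A M h' h'' t γstar ξ i * D.A M h' h'' t γstar ξ k | D.fullSigma (t - M)])
          q.2 := by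
    simp [avg, condOuter, Matrix.sum_apply]
  have h5 : D.Vhat M h' h'' q.1 (γhat q.1 q.2) q.2 i k = avg M q.1 fun t =>
      D.A M h' h'' t (γhat q.1 q.2) q.2 i * D.A M h' h'' t (γhat q.1 q.2) q.2 k := by
    simp [Vhat, avg, Matrix.sum_apply, Matrix.vecMulVec_apply]
  rw [h5, avg_sub, avg_sub]
  beta_reduce
  rw [h4]
  ring

/-- The second conditional moment minus the conditional covariance is m mᵀ with m the conditional
mean. The difference of the limits is thus a limit of averages of positive semidefinite matrices;
symmetry and sign both pass to the limit. -/
lemma posSemidef_sub_of_isVarianceBound {Vtil Vstar : Matrix (AIdx L) (AIdx L) ℝ}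
    (h_hajek : D.HajekRegular P M h' h'' γstar Vtil)
    (h_star : D.IsVarianceBound P M h' h'' γstar Vstar) : (Vstar - Vtil).PosSemidef := by
  set m : ℕ → Ξ → AIdx L → ℝ := fun t ξ i =>
    (P[fun ξ' => D.A M h' h'' t γstar ξ' i | D.fullSigma (t - M)]) ξ with hm
  have hlim : ∀ i k, Tendsto (fun q : ℕ × Ξ => avg M q.1 fun t => m t q.2 i * m t q.2 k)
      (inProb P) (𝓝 ((Vstar - Vtil) i k)) := by
    intro i k
    refine ((tendsto_inProb_iff.1 (h_star i k)).sub
      (tendsto_inProb_iff.1 (h_hajek.2 i k))).congr fun q => ?_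
    simp [avg, condOuter, condCov, Matrix.sum_apply, hm, ← mul_sub]
  refine Matrix.PosSemidef.of_dotProduct_mulVec_nonneg ?_ fun x => ?_
  · ext i k
    rw [Matrix.conjTranspose_apply, star_trivial]
    refine tendsto_nhds_unique (hlim k i) ((hlim i k).congr fun q => ?_)
    simp only [mul_comm]
  · have h1 : Tendsto (fun q : ℕ × Ξ => ∑ i, ∑ k, x i * x k *
        avg M q.1 fun t => m t q.2 i * m t q.2 k) (inProb P)
        (𝓝 (∑ i, ∑ k, x i * x k * (Vstar - Vtil) i k)) :=
      tendsto_finsetSum _ fun i _ => tendsto_finsetSum _ fun k _ => (hlim i k).const_mul _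
    have h2 : star x ⬝ᵥ ((Vstar - Vtil).mulVec x) =
        ∑ i, ∑ k, x i * x k * (Vstar - Vtil) i k := by
      simp only [dotProduct, Matrix.mulVec, Finset.mul_sum, star_trivial]
      exact Finset.sum_congr rfl fun i _ => Finset.sum_congr rfl fun k _ => by ring
    rw [h2]
    refine ge_of_tendsto h1 ?_
    filter_upwards [tendsto_fst_inProb.eventually (eventually_ge_atTop M)] with q hq
    have h3 : ∑ i, ∑ k, x i * x k * (avg M q.1 fun t => m t q.2 i * m t q.2 k) =
        avg M q.1 fun t => (∑ i, x i * m t q.2 i) ^ 2 := by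
      simp only [sq, Finset.sum_mul_sum]
      rw [avg_sum]
      refine Finset.sum_congr rfl fun i _ => ?_
      rw [avg_sum]
      refine Finset.sum_congr rfl fun k _ => ?_
      rw [← avg_const_mul]
      exact avg_congr fun t _ => by ring
    rw [h3]
    exact avg_nonneg hq fun t => sq_nonneg _

end Model

/-! ### Consistency of the two estimators of J -/

namespace Model

variable {Ω 𝒰 𝒳 ℛ Ξ : Type*} [MeasurableSpace Ω] [MeasurableSpace 𝒰] [MeasurableSpace 𝒳]
  [MeasurableSpace ℛ] [MeasurableSpace Ξ] {p L K : ℕ} {D : Model Ω 𝒰 𝒳 ℛ Ξ p L K}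
  {γstar : Param K} {M : ℕ} {P : Measure Ξ} {Vps : Matrix (Fin K) (Fin K) ℝ}
  [IsProbabilityMeasure P] {h' h'' : Intervention Ω D.ν} {γhat : ℕ → Ξ → Param K}

lemma tendsto_JhatRaw_sub (h_ps : D.PropensityRegular P M γstar Vps) (hM : 1 ≤ M)
    (h_unconf : D.Unconfounded P) (h_spec : D.CorrectlySpecified P γstar)
    (ho' : D.Overlap γstar h') (ho'' : D.Overlap γstar h'')
    (h_ipw : D.IPWRegular P M h' h'' γstar)
    (h_root : D.ConsistentRoot P M γstar γhat) (i : Fin L) (j : AIdx L) :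
    Tendsto (fun q : ℕ × Ξ => D.JhatRaw M h' h'' q.1 (γhat q.1 q.2) q.2 i j -
      D.J M h' h'' q.1 q.2 i j) (inProb P) (𝓝 0) := by
  have h := tendsto_avg_A_sub_meanVec h_ps hM h_unconf h_spec ho' ho'' h_ipw h_root
  refine tendsto_jacobian_sub (fun l => ?_) (fun l => ?_) i j
  · simp only [avg_apply]
    exact h (Sum.inl (Sum.inl l))
  · simp only [avg_apply]
    exact h (Sum.inl (Sum.inr l))

lemma tendsto_Jhat_sub (h_ps : D.PropensityRegular P M γstar Vps) (hM : 1 ≤ M)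
    (h_unconf : D.Unconfounded P) (h_spec : D.CorrectlySpecified P γstar)
    (ho' : D.Overlap γstar h') (ho'' : D.Overlap γstar h'')
    (h_ipw : D.IPWRegular P M h' h'' γstar)
    (h_root : D.ConsistentRoot P M γstar γhat) (i : Fin L) (j : AIdx L) :
    Tendsto (fun q : ℕ × Ξ => D.Jhat M h' h'' q.1 (γhat q.1 q.2) q.2 i j -
      D.J M h' h'' q.1 q.2 i j) (inProb P) (𝓝 0) := by
  have h := tendsto_avg_A_sub_meanVec h_ps hM h_unconf h_spec ho' ho'' h_ipw h_root
  -- The last two conditional means are constantly one, so the Hájek denominators tend to one in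
  -- probability and the normalization is asymptotically harmless.
  have hone : ∀ f : ℕ × Ξ → ℝ,
      Tendsto (fun q : ℕ × Ξ => f q - avg M q.1 fun _ => (1 : ℝ)) (inProb P) (𝓝 0) →
      Tendsto f (inProb P) (𝓝 1) := by
    intro f hf
    have h1 := hf.add_const 1
    rw [zero_add] at h1
    refine h1.congr' ?_
    filter_upwards [tendsto_fst_inProb.eventually (eventually_ge_atTop M)] with q hq
    rw [avg_const hq]
    ring
  refine tendsto_jacobian_sub (fun l => ?_) (fun l => ?_) i j
  · simp only [avg_proj_hajekPseudo]
    refine tendsto_div_sub_of_tendsto_one ?_ (isBigO_avg_beta hM h_ipw h' l)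
      (hone _ (h (Sum.inr 0)))
    simp only [avg_apply]
    exact h (Sum.inl (Sum.inl l))
  · simp only [avg_proj_hajekPseudo]
    refine tendsto_div_sub_of_tendsto_one ?_ (isBigO_avg_beta hM h_ipw h'' l)
      (hone _ (h (Sum.inr 1)))
    simp only [avg_apply]
    exact h (Sum.inl (Sum.inr l))

end Model

end SpatioTemporal

theorem mainTheorem5 {Ω 𝒰 𝒳 ℛ Ξ : Type*} [MeasurableSpace Ω] [MeasurableSpace 𝒰]
    [MeasurableSpace 𝒳] [MeasurableSpace ℛ] [MeasurableSpace Ξ]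
    (P : MeasureTheory.Measure Ξ) [MeasureTheory.IsProbabilityMeasure P]
    {p L K : ℕ} (D : SpatioTemporal.Model Ω 𝒰 𝒳 ℛ Ξ p L K)
    (M : ℕ) (hM : 1 ≤ M)
    (h' h'' : SpatioTemporal.Intervention Ω D.ν)
    (γstar : SpatioTemporal.Param K)
    (Vtil : Matrix (SpatioTemporal.AIdx L) (SpatioTemporal.AIdx L) ℝ)
    (Vps : Matrix (Fin K) (Fin K) ℝ)
    (Umat : Matrix (Fin K) (SpatioTemporal.AIdx L) ℝ)
    (h_unconf : D.Unconfounded P)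
    (h_spec : D.CorrectlySpecified P γstar)
    (h_overlap' : D.Overlap γstar h') (h_overlap'' : D.Overlap γstar h'')
    (h_ipw : D.IPWRegular P M h' h'' γstar)
    (h_ps : D.PropensityRegular P M γstar Vps)
    (h_hajek : D.HajekRegular P M h' h'' γstar Vtil)
    (h_score : D.HajekScoreRegular P M h' h'' γstar Vtil Vps Umat)
    (γhat : ℕ → Ξ → SpatioTemporal.Param K)
    (h_root : D.ConsistentRoot P M γstar γhat)
    (Vstar : Matrix (SpatioTemporal.AIdx L) (SpatioTemporal.AIdx L) ℝ)
    (h_star : D.IsVarianceBound P M h' h'' γstar Vstar)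
    (Q : ℕ → Ξ → Matrix (SpatioTemporal.AIdx L) (SpatioTemporal.AIdx L) ℝ)
    (h_Q : SpatioTemporal.MatTendstoInProb P Q 1) :
    -- consistency, with Hájek pseudo-outcomes in `Ĵ`
    SpatioTemporal.MatTendstoInProb P
      (fun T ξ =>
        D.Jhat M h' h'' T (γhat T ξ) ξ * Q T ξ * D.Vhat M h' h'' T (γhat T ξ) ξ *
            (Q T ξ).transpose * (D.Jhat M h' h'' T (γhat T ξ) ξ).transpose -
          D.J M h' h'' T ξ * Vstar * (D.J M h' h'' T ξ).transpose) 0 ∧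
    -- consistency, with the unstabilized pseudo-outcomes in `Ĵ`
    SpatioTemporal.MatTendstoInProb P
      (fun T ξ =>
        D.JhatRaw M h' h'' T (γhat T ξ) ξ * Q T ξ * D.Vhat M h' h'' T (γhat T ξ) ξ *
            (Q T ξ).transpose * (D.JhatRaw M h' h'' T (γhat T ξ) ξ).transpose -
          D.J M h' h'' T ξ * Vstar * (D.J M h' h'' T ξ).transpose) 0 ∧
    -- the estimated matrix is an upper bound of the asymptotic variance
    ∀ T ξ, (D.J M h' h'' T ξ * Vstar * (D.J M h' h'' T ξ).transpose -
      D.J M h' h'' T ξ * (Vtil - Umat.transpose * Vps⁻¹ * Umat) *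
        (D.J M h' h'' T ξ).transpose).PosSemidef := by
  have hJ := SpatioTemporal.jacobian_isBigO_one
    (fun l => SpatioTemporal.Model.isBigO_avg_beta hM h_ipw h' l)
    (fun l => SpatioTemporal.Model.isBigO_avg_beta hM h_ipw h'' l)
  have hQ := fun i j => SpatioTemporal.tendsto_inProb_iff.1 (h_Q i j)
  have hV := SpatioTemporal.Model.tendsto_Vhat h_ps hM h_unconf h_spec h_overlap' h_overlap''
    h_ipw h_root h_star
  refine ⟨fun i k => SpatioTemporal.tendsto_inProb_iff.2 ?_,
    fun i k => SpatioTemporal.tendsto_inProb_iff.2 ?_, fun T ξ => ?_⟩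
  · exact SpatioTemporal.tendsto_sandwich_sub hJ
      (SpatioTemporal.Model.tendsto_Jhat_sub h_ps hM h_unconf h_spec h_overlap' h_overlap''
        h_ipw h_root) hQ hV i k
  · exact SpatioTemporal.tendsto_sandwich_sub hJ
      (SpatioTemporal.Model.tendsto_JhatRaw_sub h_ps hM h_unconf h_spec h_overlap' h_overlap''
        h_ipw h_root) hQ hV i k
  -- The middle matrices differ by (Vstar - Vtil) + UᵀVps⁻¹U, a sum of positive semidefinite
  -- matrices, and conjugation by J preserves this for every T and ξ.
  · have h1 := SpatioTemporal.Model.posSemidef_sub_of_isVarianceBound h_hajek h_star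
    have h2 := h_ps.posDef.inv.posSemidef.conjTranspose_mul_mul_same Umat
    have h3 := (h1.add h2).mul_mul_conjTranspose_same (D.J M h' h'' T ξ)
    simp only [Matrix.conjTranspose_eq_transpose_of_trivial] at h3
    convert h3 using 1
    rw [← Matrix.sub_mul, ← Matrix.mul_sub]
    congr 2
    abel
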